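/- **Generalized Yang–Mills equations.** Let $M$ be a smooth oriented $n$-dimensional manifold, possibly with boundary $\partial M$ (Hausdorff, second countable), with a pseudo-Riemannian metric and Hodge star $\ast$. Let $G$ be a finite-dimensional Lie group with Lie algebra $\mathfrak g$, let $\langle\cdot,\cdot\rangle$ be a symmetric non-degenerate $G$-invariant bilinear form on $\mathfrak g$ with real or complex values, and let $k$ be a real constant. A $\mathfrak g$-valued *generalized $p$-form* is a pair $\mathscr M=(a,b)$ of a $\mathfrak g$-valued $p$-form $a$ and a $\mathfrak g$-valued $(p+1)$-form $b$ on $M$ (forms of negative degree are $0$). For a generalized $p$-form $(a,b)$ and a generalized $q$-form $(a',b')$ put $$\mathbf d(a,b)=(da+(-1)^{p+1}kb,\ db),\qquad \star(a,b)=((-1)^{n-p-1}\ast b,\ \ast a),$$ $$(a,b)\wedge^{[,]}(a',b')=(a\wedge^{[,]}a',\ a\wedge^{[,]}b'+(-1)^q\,b\wedge^{[,]}a'),$$ $$\langle\!\langle (a,b),(a',b')\rangle\!\rangle=(\langle a,a'\rangle,\ \langle a,b'\rangle+(-1)^q\langle b,a'\rangle),$$ and define the integral of a generalized $(n-1)$-form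 over $(\partial M,M)$ as the integral of its top component, $\int_{(\partial M,M)}(a,b)=\int_M b$ (and likewise over $(\partial K,K)$ for $K\subseteq M$ compact: $\int_K b$). Let $\mathscr A=(A^1,A^2)$ be a smooth generalized connection, i.e. a $\mathfrak g$-valued $1$-form $A^1$ and a $\mathfrak g$-valued $2$-form $A^2$ on $M$. Let $F=dA^1+A^1\wedge A^1$ with $A^1\wedge A^1=\tfrac12A^1\wedge^{[,]}A^1$, let $D\omega=d\omega+A^1\wedge^{[,]}\omega$, let $\mathscr F=\mathbf d\mathscr A+\mathscr A\wedge\mathscr A$ with $\mathscr A\wedge\mathscr A=\tfrac12\mathscr A\wedge^{[,]}\mathscr A$ (so $\mathscr F=(F+kA^2,DA^2)$), let $\mathscr D\mathscr M=\mathbf d\mathscr M+\mathscr A\wedge^{[,]}\mathscr M$, and consider the action $$S_{GYM}(\mathscr A)=\int_{(\partial M,M)}\langle\!\langle\mathscr F,\star\mathscr F\rangle\!\rangle .$$ Variations $(\delta A^1,\delta A^2)$ are smooth forms with compact support in the interior of $M$. Stationarity means that for every compact $K\subseteq M$ and every variation supported in $K$, the derivative at $t=0$ of $t\mapsto\int_{(\partial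 K,K)}\langle\!\langle\mathscr F_t,\star\mathscr F_t\rangle\!\rangle$ exists and is $0$, where $\mathscr F_t$ is the curvature of $\mathscr A+t\,\delta\mathscr A$. Then: 1. $\mathscr A$ is stationary under variations of $A^1$ alone if and only if $$D\ast F+k\,D\ast A^2+A^2\wedge^{[,]}\ast DA^2=0;\tag{1}$$ 2. $\mathscr A$ is stationary under variations of $A^2$ alone if and only if $$k\ast F+k^2\ast A^2-D\ast DA^2=0;\tag{2}$$ 3. $\mathscr A$ is stationary under joint variations of $A^1$ and $A^2$ if and only if (1) and (2) both hold; 4. if the integral $S_{GYM}(\mathscr A)$ over all of $M$ converges absolutely (for instance if $M$ is compact), then 1–3 also hold with stationarity of $S_{GYM}$ itself, i.e. of $t\mapsto S_{GYM}(\mathscr A+t\,\delta\mathscr A)$ at $t=0$; 5. (1) and (2) together are equivalent to the generalized Yang–Mills equation $\mathscr D\star\mathscr F=0$ of Nurowski and Robinson. -/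

import Mathlib

open scoped Manifold ContDiff
open Set MeasureTheory

noncomputable section

namespace GDC

/-- The model vector space `ℝⁿ`. By Mathlib's definition it is also the tangent space `T_x M` of an
`n`-dimensional manifold `M` at each point `x`, in the coordinates of the preferred chart at `x`. -/
abbrev Vec (n : ℕ) : Type := EuclideanSpace ℝ (Fin n)

/-- The `i`-th vector of the standard basis of `ℝⁿ`. -/
def stdVec {n : ℕ} (i : Fin n) : Vec n := EuclideanSpace.single i (1 : ℝ)

/-! ### Alternating maps at one point -/

section Pointwise

variable {n : ℕ}
  {V : Type*} [NormedAddCommGroup V] [NormedSpace ℝ V]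
  {W : Type*} [NormedAddCommGroup W] [NormedSpace ℝ W]
  {Z : Type*} [NormedAddCommGroup Z] [NormedSpace ℝ Z]

/-- The multilinear map `v ↦ b (α (v₁, …, v_p)) (β (v_{p+1}, …, v_{p+q}))`. -/
def mulAlt (b : V →L[ℝ] W →L[ℝ] Z) {p q r : ℕ} (h : p + q = r)
    (α : Vec n [⋀^Fin p]→L[ℝ] V) (β : Vec n [⋀^Fin q]→L[ℝ] W) :
    ContinuousMultilinearMap ℝ (fun _ : Fin r => Vec n) Z where
  toFun v := b (α fun i => v (Fin.cast h (Fin.castAdd q i)))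
    (β fun j => v (Fin.cast h (Fin.natAdd p j)))
  map_update_add' := by
    subst h
    intro dec v i x y
    simp only [Fin.cast_eq_self]
    induction i using Fin.addCases with
    | left i =>
      have h1 : ∀ z : Vec n, (fun k => Function.update v (Fin.castAdd q i) z (Fin.castAdd q k)) =
          Function.update (fun k => v (Fin.castAdd q k)) i z := by
        intro z; ext1 k; by_cases hk : k = i <;> simp [hk]
      have h2 : ∀ z : Vec n, (fun k => Function.update v (Fin.castAdd q i) z (Fin.natAdd p k)) =
          fun k => v (Fin.natAdd p k) := by
        intro z; ext1 k
        exact Function.update_of_ne (by simp [Fin.ext_iff]; omega) _ _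
      simp only [h1, h2, ContinuousAlternatingMap.map_update_add, map_add,
        add_apply]
    | right i =>
      have h1 : ∀ z : Vec n, (fun k => Function.update v (Fin.natAdd p i) z (Fin.natAdd p k)) =
          Function.update (fun k => v (Fin.natAdd p k)) i z := by
        intro z; ext1 k; by_cases hk : k = i <;> simp [hk]
      have h2 : ∀ z : Vec n, (fun k => Function.update v (Fin.natAdd p i) z (Fin.castAdd q k)) =
          fun k => v (Fin.castAdd q k) := by
        intro z; ext1 k
        exact Function.update_of_ne (by simp [Fin.ext_iff]; omega) _ _
      simp only [h1, h2, ContinuousAlternatingMap.map_update_add, map_add]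
  map_update_smul' := by
    subst h
    intro dec v i c x
    simp only [Fin.cast_eq_self]
    induction i using Fin.addCases with
    | left i =>
      have h1 : ∀ z : Vec n, (fun k => Function.update v (Fin.castAdd q i) z (Fin.castAdd q k)) =
          Function.update (fun k => v (Fin.castAdd q k)) i z := by
        intro z; ext1 k; by_cases hk : k = i <;> simp [hk]
      have h2 : ∀ z : Vec n, (fun k => Function.update v (Fin.castAdd q i) z (Fin.natAdd p k)) =
          fun k => v (Fin.natAdd p k) := by
        intro z; ext1 k
        exact Function.update_of_ne (by simp [Fin.ext_iff]; omega) _ _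
      simp only [h1, h2, ContinuousAlternatingMap.map_update_smul, map_smul,
        smul_apply]
    | right i =>
      have h1 : ∀ z : Vec n, (fun k => Function.update v (Fin.natAdd p i) z (Fin.natAdd p k)) =
          Function.update (fun k => v (Fin.natAdd p k)) i z := by
        intro z; ext1 k; by_cases hk : k = i <;> simp [hk]
      have h2 : ∀ z : Vec n, (fun k => Function.update v (Fin.natAdd p i) z (Fin.castAdd q k)) =
          fun k => v (Fin.castAdd q k) := by
        intro z; ext1 k
        exact Function.update_of_ne (by simp [Fin.ext_iff]; omega) _ _
      simp only [h1, h2, ContinuousAlternatingMap.map_update_smul, map_smul]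
  cont := by
    have h1 := α.cont
    have h2 := β.cont
    have h3 : Continuous fun v : Fin r → Vec n =>
        α fun i => v (Fin.cast h (Fin.castAdd q i)) :=
      h1.comp (continuous_pi fun i => continuous_apply _)
    have h4 : Continuous fun v : Fin r → Vec n =>
        β fun j => v (Fin.cast h (Fin.natAdd p j)) :=
      h2.comp (continuous_pi fun i => continuous_apply _)
    exact (b.continuous.comp h3).clm_apply h4

/-- The exterior product of alternating maps with respect to a bilinear map `b`:
`(α ∧ β)(v) = 1/(p! q!) ∑_σ sgn(σ) b (α (v_{σ 1}, …, v_{σ p})) (β (v_{σ(p+1)}, …, v_{σ(p+q)}))`. -/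
def wedgeAlt (b : V →L[ℝ] W →L[ℝ] Z) {p q r : ℕ} (h : p + q = r)
    (α : Vec n [⋀^Fin p]→L[ℝ] V) (β : Vec n [⋀^Fin q]→L[ℝ] W) : Vec n [⋀^Fin r]→L[ℝ] Z :=
  ((p.factorial * q.factorial : ℕ) : ℝ)⁻¹ •
    ContinuousMultilinearMap.alternatization (mulAlt b h α β)

/-- The alternating map `(w₁, …, w_q) ↦ η (u₁, …, u_p, w₁, …, w_q)`. -/
def plug {p q r : ℕ} (h : p + q = r) (η : Vec n [⋀^Fin r]→L[ℝ] ℝ) (u : Fin p → Vec n) :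
    Vec n [⋀^Fin q]→L[ℝ] ℝ where
  toFun w := η fun i => Fin.append u w (Fin.cast h.symm i)
  map_update_add' := by
    subst h
    intro dec w i x y
    have h1 : ∀ z : Vec n, (fun k => Fin.append u (Function.update w i z) (Fin.cast rfl k)) =
        Function.update (Fin.append u w) (Fin.natAdd p i) z := by
      intro z; ext1 k
      induction k using Fin.addCases with
      | left k =>
        rw [Function.update_of_ne (by simp [Fin.ext_iff]; omega)]
        simp
      | right k => by_cases hk : k = i <;> simp [hk]
    simp only [h1, ContinuousAlternatingMap.map_update_add]
  map_update_smul' := by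
    subst h
    intro dec w i c x
    have h1 : ∀ z : Vec n, (fun k => Fin.append u (Function.update w i z) (Fin.cast rfl k)) =
        Function.update (Fin.append u w) (Fin.natAdd p i) z := by
      intro z; ext1 k
      induction k using Fin.addCases with
      | left k =>
        rw [Function.update_of_ne (by simp [Fin.ext_iff]; omega)]
        simp
      | right k => by_cases hk : k = i <;> simp [hk]
    simp only [h1, ContinuousAlternatingMap.map_update_smul]
  map_eq_zero_of_eq' := by
    subst h
    intro w i j hij hne
    exact η.map_eq_zero_of_eq (i := Fin.natAdd p i) (j := Fin.natAdd p j) _ (by simpa using hij)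
      (by simpa using hne)
  cont := by
    subst h
    refine η.cont.comp (continuous_pi fun k => ?_)
    induction k using Fin.addCases with
    | left k => simpa using continuous_const
    | right k => simpa using continuous_apply _

/-- The Gram matrix `g (e_i, e_j)` of a bilinear form in the standard basis. -/
def gram (g : Vec n →L[ℝ] Vec n →L[ℝ] ℝ) : Matrix (Fin n) (Fin n) ℝ :=
  Matrix.of fun i j => g (stdVec i) (stdVec j)

/-- For nondegenerate `g`, the vector `e^i` with `g (e^i, e_j) = δ_{ij}`. -/
def dualVec (g : Vec n →L[ℝ] Vec n →L[ℝ] ℝ) (i : Fin n) : Vec n :=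
  ∑ j, (gram g)⁻¹ i j • stdVec j

/-- The Hodge star with respect to a metric `g` and a volume form `vol`:
`(∗α)(w₁, …, w_q) = 1/p! ∑ α (e_{i₁}, …, e_{i_p}) vol (e^{i₁}, …, e^{i_p}, w₁, …, w_q)`, the sum over
all `i₁, …, i_p`. In the usual index notation, `(∗α)_{j…} = 1/p! α^{i…} ε_{i… j…}`; equivalently
`α ∧ ∗β = ⟨α, β⟩ vol`. -/
def starAlt (g : Vec n →L[ℝ] Vec n →L[ℝ] ℝ) (vol : Vec n [⋀^Fin n]→L[ℝ] ℝ) {p q : ℕ}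
    (h : p + q = n) (α : Vec n [⋀^Fin p]→L[ℝ] W) : Vec n [⋀^Fin q]→L[ℝ] W :=
  ((p.factorial : ℕ) : ℝ)⁻¹ • ∑ s : Fin p → Fin n,
    (plug h vol fun i => dualVec g (s i)).smulRight (α fun i => stdVec (s i))

end Pointwise

/-! ### Differential forms on a manifold -/

section Forms

variable {n : ℕ} {H : Type*} [TopologicalSpace H] (I : ModelWithCorners ℝ (Vec n) H)
  {M : Type*} [TopologicalSpace M] [ChartedSpace H M]
  {V : Type*} [NormedAddCommGroup V] [NormedSpace ℝ V]
  {W : Type*} [NormedAddCommGroup W] [NormedSpace ℝ W]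
  {Z : Type*} [NormedAddCommGroup Z] [NormedSpace ℝ Z]

/-- `W`-valued differential forms of degree `p : ℤ` on the `n`-dimensional manifold `M` (smoothness
is a separate predicate). For `p ≥ 0` this is a field of alternating `p`-linear maps
`(T_x M)^p → W`; for `p < 0` the index set is empty and the only form is `0`. -/
abbrev DForm (n : ℕ) (M : Type*) (W : Type*) [NormedAddCommGroup W] [NormedSpace ℝ W] (p : ℤ) :
    Type _ :=
  ∀ q : {q : ℕ // (q : ℤ) = p}, M → Vec n [⋀^Fin q.1]→L[ℝ] W

/-- A form of degree `p` regarded as a form of degree `r = p`. -/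
def DForm.cast {p r : ℤ} (h : p = r) (η : DForm n M W p) : DForm n M W r :=
  fun q x => η ⟨q.1, q.2.trans h.symm⟩ x

variable [IsManifold I ∞ M]

/-- The derivative at the coordinates of `z` of the inverse of the preferred chart at `x₀`, as a map
from `ℝⁿ` to `T_z M`. -/
def chartFrame (x₀ z : M) : Vec n →L[ℝ] Vec n :=
  haveI : IsManifold I 1 M := IsManifold.of_le (n := ∞) (by exact_mod_cast le_top)
  tangentCoordChange I x₀ z z

/-- The coordinate expression of a form in the chart at `x₀`: its pull-back under the inverse of that
chart. It is meaningful on the target of the chart. -/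
def inChart {q : ℕ} (η : M → Vec n [⋀^Fin q]→L[ℝ] W) (x₀ : M) (y : Vec n) :
    Vec n [⋀^Fin q]→L[ℝ] W :=
  (η ((extChartAt I x₀).symm y)).compContinuousLinearMap
    (chartFrame I x₀ ((extChartAt I x₀).symm y))

/-- Smoothness of a form: in each chart, the coordinate expression is smooth up to the boundary. -/
def IsSmoothForm {p : ℤ} (η : DForm n M W p) : Prop :=
  ∀ q (x₀ : M), ContDiffOn ℝ ∞ (inChart I (η q) x₀) (extChartAt I x₀).target

/-- The exterior derivative. At `x` it is computed in the preferred chart at `x`, in which `T_x M`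
is identified with `ℝⁿ`. -/
def extD {p r : ℤ} (h : p + 1 = r) (η : DForm n M W p) : DForm n M W r
  | ⟨0, _⟩, _ => 0
  | ⟨q + 1, hq⟩, x =>
    extDerivWithin (inChart I (η ⟨q, by push_cast at hq; omega⟩) x) (range I) (extChartAt I x x)

/-- The exterior product `α ∧^b β` of vector-valued forms, for a bilinear map `b` on the values. -/
def wedge (b : V →L[ℝ] W →L[ℝ] Z) {p q r : ℤ} (h : p + q = r)
    (α : DForm n M V p) (β : DForm n M W q) : DForm n M Z r :=
  fun c x =>
    if hpq : 0 ≤ p ∧ 0 ≤ q then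
      wedgeAlt b (by have := c.2; omega : p.toNat + q.toNat = c.1)
        (α ⟨p.toNat, Int.toNat_of_nonneg hpq.1⟩ x) (β ⟨q.toNat, Int.toNat_of_nonneg hpq.2⟩ x)
    else 0

/-- An oriented pseudo-Riemannian metric on `M`: a smooth field of nondegenerate symmetric bilinear
forms of arbitrary signature, together with an orientation, given by its metric volume form, i.e. a
smooth `n`-form with `vol (v₁, …, v_n) ² = |det g (v_i, v_j)|` (on an orientable connected `M` there
are exactly two, one for each orientation). -/
structure OrientedMetric (M : Type*) [TopologicalSpace M] [ChartedSpace H M]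
    [IsManifold I ∞ M] where
  g : M → Vec n →L[ℝ] Vec n →L[ℝ] ℝ
  symm : ∀ x v w, g x v w = g x w v
  nondeg : ∀ x v, (∀ w, g x v w = 0) → v = 0
  smooth_g : ∀ x₀ : M, ContDiffOn ℝ ∞
    (fun y => (g ((extChartAt I x₀).symm y)).bilinearComp
      (chartFrame I x₀ ((extChartAt I x₀).symm y)) (chartFrame I x₀ ((extChartAt I x₀).symm y)))
    (extChartAt I x₀).target
  vol : M → Vec n [⋀^Fin n]→L[ℝ] ℝ
  smooth_vol : ∀ x₀ : M, ContDiffOn ℝ ∞ (inChart I vol x₀) (extChartAt I x₀).target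
  vol_sq : ∀ x (v : Fin n → Vec n),
    vol x v ^ 2 = |(Matrix.of fun i j => g x (v i) (v j)).det|

variable {I}

/-- The Hodge star `∗`, from `p`-forms to `(n - p)`-forms. -/
def hodge (Ω : OrientedMetric I M) {p q : ℤ} (h : p + q = n) (α : DForm n M W p) : DForm n M W q :=
  fun c x =>
    if hp : 0 ≤ p then
      starAlt (Ω.g x) (Ω.vol x) (by have := c.2; omega : p.toNat + c.1 = n)
        (α ⟨p.toNat, Int.toNat_of_nonneg hp⟩ x)
    else 0

/-- The Riemannian volume of the domain of the chart at `x₀`, as a measure on `M`: Lebesgue measure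
on the target of the chart with density `|vol (∂₁, …, ∂_n)| = |det (g_{ij})|^{1/2}`, carried to `M`. -/
def chartVolume [MeasurableSpace M] (Ω : OrientedMetric I M) (x₀ : M) : Measure M :=
  ((volume.restrict (extChartAt I x₀).target).withDensity
    (fun y => ENNReal.ofReal |inChart I Ω.vol x₀ y stdVec|)).map (extChartAt I x₀).symm

/-- The Riemannian volume measure of `M`. The measures `chartVolume Ω x` are restrictions of it to
the chart domains (they agree on overlaps), so it is their supremum. -/
def volumeMeasure [MeasurableSpace M] (Ω : OrientedMetric I M) : Measure M :=
  ⨆ x : M, chartVolume Ω x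

/-- The function `f` with `η = f vol`, for an `n`-form `η`. -/
def topCoeff (Ω : OrientedMetric I M) (η : DForm n M W n) (x : M) : W :=
  (Ω.vol x stdVec)⁻¹ • η ⟨n, rfl⟩ x stdVec

/-- The integral of the `n`-form `η` over the domain `D ⊆ M`, with the orientation of `vol`. -/
def formIntegral [MeasurableSpace M] (Ω : OrientedMetric I M) (D : Set M) (η : DForm n M W n) : W :=
  ∫ x in D, topCoeff Ω η x ∂(volumeMeasure Ω)

/-- The support of a form. -/
def formSupp {p : ℤ} (η : DForm n M W p) : Set M := closure {x | ∃ q, η q x ≠ 0}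

end Forms

/-! ### Generalized forms of type `N = 1` -/

section Generalized

variable {n : ℕ} {H : Type*} [TopologicalSpace H] {I : ModelWithCorners ℝ (Vec n) H}
  {M : Type*} [TopologicalSpace M] [ChartedSpace H M] [IsManifold I ∞ M]
  {V : Type*} [NormedAddCommGroup V] [NormedSpace ℝ V]
  {W : Type*} [NormedAddCommGroup W] [NormedSpace ℝ W]
  {Z : Type*} [NormedAddCommGroup Z] [NormedSpace ℝ Z]

/-- `W`-valued generalized `p`-forms: pairs of a `p`-form and a `(p + 1)`-form. -/
abbrev GForm (n : ℕ) (M : Type*) (W : Type*) [NormedAddCommGroup W] [NormedSpace ℝ W] (p : ℤ) :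
    Type _ :=
  DForm n M W p × DForm n M W (p + 1)

variable (I) in
/-- The generalized exterior derivative `𝐝 (a, b) = (d a + (-1)^{p+1} k b, d b)`. -/
def gextD (k : ℝ) {p r : ℤ} (h : p + 1 = r) (𝓜 : GForm n M W p) : GForm n M W r :=
  (extD I h 𝓜.1 + (((-1 : ℝ) ^ (p + 1)) * k) • DForm.cast h 𝓜.2,
    extD I (by omega) 𝓜.2)

/-- The generalized exterior product `(a, b) ∧ (a', b') = (a ∧ a', a ∧ b' + (-1)^q b ∧ a')`, for a
bilinear map on the values: the Lie bracket gives `∧^[,]`, an invariant form `⟨·,·⟩` gives `⟪·,·⟫`. -/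
def gwedge (b : V →L[ℝ] W →L[ℝ] Z) {p q r : ℤ} (h : p + q = r)
    (𝓜 : GForm n M V p) (𝓧 : GForm n M W q) : GForm n M Z r :=
  (wedge b h 𝓜.1 𝓧.1,
    wedge b (by omega) 𝓜.1 𝓧.2 + ((-1 : ℝ) ^ q) • wedge b (by omega) 𝓜.2 𝓧.1)

/-- The generalized Hodge star `⋆ (a, b) = ((-1)^{n-p-1} ∗b, ∗a)`, of degree `n - p - 1`. -/
def ghodge (Ω : OrientedMetric I M) {p q : ℤ} (h : p + q = n - 1) (𝓜 : GForm n M W p) :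
    GForm n M W q :=
  (((-1 : ℝ) ^ ((n : ℤ) - p - 1)) • hodge Ω (by omega) 𝓜.2, hodge Ω (by omega) 𝓜.1)

/-- The integral of a generalized `(n - 1)`-form `(a, b)` over `(∂D, D)`: the integral over `D` of the
top component `b`. -/
def gintegral [MeasurableSpace M] (Ω : OrientedMetric I M) (D : Set M)
    (𝓜 : GForm n M W ((n : ℤ) - 1)) : W :=
  formIntegral Ω D (DForm.cast (by omega) 𝓜.2)

end Generalized

/-! ### The Lie algebra of a Lie group -/

section LieAlg

/-- The Lie bracket of the Lie algebra `T₁G` of a Lie group `G` modelled on the vector space `𝔤`; as a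
vector space `T₁G` is `𝔤`. The assumption on the smoothness of `G` is Mathlib's one for the Lie
algebra to be defined, here `C³`. -/
def lieBracket (𝔤 : Type*) [NormedAddCommGroup 𝔤] [NormedSpace ℝ 𝔤] [FiniteDimensional ℝ 𝔤]
    (G : Type*) [Group G] [TopologicalSpace G] [ChartedSpace 𝔤 G]
    [LieGroup 𝓘(ℝ, 𝔤) (minSmoothness ℝ 3) G] : 𝔤 →L[ℝ] 𝔤 →L[ℝ] 𝔤 :=
  haveI : CompleteSpace 𝔤 := FiniteDimensional.complete ℝ 𝔤
  LinearMap.toContinuousBilinearMap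
    (LinearMap.mk₂ ℝ
      (fun X Y : 𝔤 => Bracket.bracket (L := GroupLieAlgebra 𝓘(ℝ, 𝔤) G)
        (M := GroupLieAlgebra 𝓘(ℝ, 𝔤) G) X Y)
      (fun X X' Y => add_lie (L := GroupLieAlgebra 𝓘(ℝ, 𝔤) G)
        (M := GroupLieAlgebra 𝓘(ℝ, 𝔤) G) X X' Y)
      (fun c X Y => smul_lie (L := GroupLieAlgebra 𝓘(ℝ, 𝔤) G)
        (M := GroupLieAlgebra 𝓘(ℝ, 𝔤) G) c X Y)
      (fun X Y Y' => lie_add (L := GroupLieAlgebra 𝓘(ℝ, 𝔤) G)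
        (M := GroupLieAlgebra 𝓘(ℝ, 𝔤) G) X Y Y')
      (fun c X Y => lie_smul (L := GroupLieAlgebra 𝓘(ℝ, 𝔤) G)
        (M := GroupLieAlgebra 𝓘(ℝ, 𝔤) G) c X Y))

/-- The adjoint action `X ↦ g X g⁻¹` of `G` on its Lie algebra: the derivative at `1` of
`x ↦ g x g⁻¹`. -/
def Ad (𝔤 : Type*) [NormedAddCommGroup 𝔤] [NormedSpace ℝ 𝔤]
    {G : Type*} [Group G] [TopologicalSpace G] [ChartedSpace 𝔤 G] (g : G) : 𝔤 →L[ℝ] 𝔤 :=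
  mfderiv 𝓘(ℝ, 𝔤) 𝓘(ℝ, 𝔤) (fun x : G => g * x * g⁻¹) 1

/-- A symmetric nondegenerate `G`-invariant bilinear form on the Lie algebra, with values in
`𝕜 = ℝ` or `ℂ`. -/
structure IsInvariantForm (𝔤 : Type*) [NormedAddCommGroup 𝔤] [NormedSpace ℝ 𝔤]
    (G : Type*) [Group G] [TopologicalSpace G] [ChartedSpace 𝔤 G]
    {𝕜 : Type*} [RCLike 𝕜] (B : 𝔤 →L[ℝ] 𝔤 →L[ℝ] 𝕜) : Prop where
  symm : ∀ X Y, B X Y = B Y X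
  nondeg : ∀ X, (∀ Y, B X Y = 0) → X = 0
  invariant : ∀ (g : G) (X Y : 𝔤), B (Ad 𝔤 g X) (Ad 𝔤 g Y) = B X Y

end LieAlg

/-! ### Connections, curvature and the action -/

section YangMills

variable {n : ℕ} {H : Type*} [TopologicalSpace H] {I : ModelWithCorners ℝ (Vec n) H}
  {M : Type*} [TopologicalSpace M] [ChartedSpace H M] [IsManifold I ∞ M]
  {𝔤 : Type*} [NormedAddCommGroup 𝔤] [NormedSpace ℝ 𝔤]
  {𝕜 : Type*} [RCLike 𝕜]

variable (I) in
/-- The curvature `F = d A + A ∧ A`, where `A ∧ A = ½ A ∧^[,] A`; `br` is the Lie bracket. -/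
def curv (br : 𝔤 →L[ℝ] 𝔤 →L[ℝ] 𝔤) (A : DForm n M 𝔤 1) : DForm n M 𝔤 2 :=
  extD I (by norm_num) A + (1 / 2 : ℝ) • wedge br (by norm_num) A A

variable (I) in
/-- The covariant derivative `D η = d η + A ∧^[,] η`. -/
def covD (br : 𝔤 →L[ℝ] 𝔤 →L[ℝ] 𝔤) (A : DForm n M 𝔤 1) {p r : ℤ} (h : p + 1 = r)
    (η : DForm n M 𝔤 p) : DForm n M 𝔤 r :=
  extD I h η + wedge br (by omega) A η

variable (I) in
/-- The generalized curvature `𝓕 = 𝐝 𝓐 + 𝓐 ∧ 𝓐`, where `𝓐 ∧ 𝓐 = ½ 𝓐 ∧^[,] 𝓐`. -/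
def gcurv (br : 𝔤 →L[ℝ] 𝔤 →L[ℝ] 𝔤) (k : ℝ) (𝓐 : GForm n M 𝔤 1) : GForm n M 𝔤 2 :=
  gextD I k (by norm_num) 𝓐 + (1 / 2 : ℝ) • gwedge br (by norm_num) 𝓐 𝓐

variable (I) in
/-- The generalized covariant derivative `𝓓 𝓜 = 𝐝 𝓜 + 𝓐 ∧^[,] 𝓜`. -/
def gcovD (br : 𝔤 →L[ℝ] 𝔤 →L[ℝ] 𝔤) (k : ℝ) (𝓐 : GForm n M 𝔤 1) {p r : ℤ} (h : p + 1 = r)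
    (𝓜 : GForm n M 𝔤 p) : GForm n M 𝔤 r :=
  gextD I k h 𝓜 + gwedge br (by omega) 𝓐 𝓜

/-- The Lagrangian `⟪𝓕, ⋆𝓕⟫`, a generalized `(n - 1)`-form. -/
def lagrangian (Ω : OrientedMetric I M) (br : 𝔤 →L[ℝ] 𝔤 →L[ℝ] 𝔤) (B : 𝔤 →L[ℝ] 𝔤 →L[ℝ] 𝕜) (k : ℝ)
    (𝓐 : GForm n M 𝔤 1) : GForm n M 𝕜 ((n : ℤ) - 1) :=
  gwedge B (q := (n : ℤ) - 3) (by omega) (gcurv I br k 𝓐) (ghodge Ω (by omega) (gcurv I br k 𝓐))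

variable [MeasurableSpace M]

/-- The action `S = ∫_{(∂D, D)} ⟪𝓕, ⋆𝓕⟫`. -/
def gymAction (Ω : OrientedMetric I M) (br : 𝔤 →L[ℝ] 𝔤 →L[ℝ] 𝔤) (B : 𝔤 →L[ℝ] 𝔤 →L[ℝ] 𝕜) (k : ℝ)
    (D : Set M) (𝓐 : GForm n M 𝔤 1) : 𝕜 :=
  gintegral Ω D (lagrangian Ω br B k 𝓐)

/-- The integral defining the action over all of `M` converges absolutely. -/
def HasFiniteAction (Ω : OrientedMetric I M) (br : 𝔤 →L[ℝ] 𝔤 →L[ℝ] 𝔤) (B : 𝔤 →L[ℝ] 𝔤 →L[ℝ] 𝕜)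
    (k : ℝ) (𝓐 : GForm n M 𝔤 1) : Prop :=
  Integrable (topCoeff Ω (DForm.cast (by omega) (lagrangian Ω br B k 𝓐).2)) (volumeMeasure Ω)

variable (I) in
/-- The variations `δ𝓐 = (δA¹, δA²)`: pairs of smooth forms with compact support in the interior
`M ∖ ∂M` of `M`. -/
def IsVariation (δ : GForm n M 𝔤 1) : Prop :=
  IsSmoothForm I δ.1 ∧ IsSmoothForm I δ.2 ∧ IsCompact (formSupp δ.1) ∧ IsCompact (formSupp δ.2) ∧
    formSupp δ.1 ⊆ I.interior M ∧ formSupp δ.2 ⊆ I.interior M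

/-- `𝓐` is a stationary point of the action over `D`, with respect to the variations in the class `𝒱`
that are supported in `D`: the derivative of `t ↦ S (𝓐 + t δ𝓐)` at `t = 0` exists and vanishes. -/
def IsStationaryOn (Ω : OrientedMetric I M) (br : 𝔤 →L[ℝ] 𝔤 →L[ℝ] 𝔤) (B : 𝔤 →L[ℝ] 𝔤 →L[ℝ] 𝕜) (k : ℝ)
    (𝓐 : GForm n M 𝔤 1) (𝒱 : Set (GForm n M 𝔤 1)) (D : Set M) : Prop :=
  ∀ δ ∈ 𝒱, IsVariation I δ → formSupp δ.1 ⊆ D → formSupp δ.2 ⊆ D →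
    HasDerivAt (fun t : ℝ => gymAction Ω br B k D (𝓐 + t • δ)) 0 0

/-- Stationarity on a manifold that need not be compact: over every compact domain. -/
def IsLocallyStationary (Ω : OrientedMetric I M) (br : 𝔤 →L[ℝ] 𝔤 →L[ℝ] 𝔤)
    (B : 𝔤 →L[ℝ] 𝔤 →L[ℝ] 𝕜) (k : ℝ) (𝓐 : GForm n M 𝔤 1) (𝒱 : Set (GForm n M 𝔤 1)) : Prop :=
  ∀ K : Set M, IsCompact K → IsStationaryOn Ω br B k 𝓐 𝒱 K

/-- `D ∗F + k D ∗A² + A² ∧^[,] ∗D A² = 0`. -/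
def Equation₁ (Ω : OrientedMetric I M) (br : 𝔤 →L[ℝ] 𝔤 →L[ℝ] 𝔤) (k : ℝ)
    (A₁ : DForm n M 𝔤 1) (A₂ : DForm n M 𝔤 2) : Prop :=
  covD I br A₁ (p := (n : ℤ) - 2) (r := (n : ℤ) - 1) (by omega) (hodge Ω (by omega) (curv I br A₁))
    + k • covD I br A₁ (p := (n : ℤ) - 2) (by omega) (hodge Ω (by omega) A₂)
    + wedge br (q := (n : ℤ) - 3) (by omega) A₂
        (hodge Ω (p := 3) (by omega) (covD I br A₁ (by norm_num) A₂)) = 0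

/-- `k ∗F + k² ∗A² - D ∗D A² = 0`. -/
def Equation₂ (Ω : OrientedMetric I M) (br : 𝔤 →L[ℝ] 𝔤 →L[ℝ] 𝔤) (k : ℝ)
    (A₁ : DForm n M 𝔤 1) (A₂ : DForm n M 𝔤 2) : Prop :=
  k • hodge Ω (q := (n : ℤ) - 2) (by omega) (curv I br A₁) + k ^ 2 • hodge Ω (by omega) A₂
    - covD I br A₁ (p := (n : ℤ) - 3) (by omega)
        (hodge Ω (p := 3) (by omega) (covD I br A₁ (by norm_num) A₂)) = 0

/-- The generalized Yang–Mills equation `𝓓 ⋆𝓕 = 0`. -/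
def GeneralizedYangMills (Ω : OrientedMetric I M) (br : 𝔤 →L[ℝ] 𝔤 →L[ℝ] 𝔤) (k : ℝ)
    (𝓐 : GForm n M 𝔤 1) : Prop :=
  gcovD I br k 𝓐 (p := (n : ℤ) - 3) (r := (n : ℤ) - 2) (by omega)
    (ghodge Ω (by omega) (gcurv I br k 𝓐)) = 0

end YangMills

end GDC

end

open GDC

/-! Put a = F + kA² and b = DA². Since the bracket is skew and two signs (-1)^(n-3) cancel, the top
component of ⟪𝓕, ⋆𝓕⟫ is ⟨a ∧ ∗a⟩ + ⟨b ∧ ∗b⟩ (`lagrangian_snd`). Under (A¹, A²) ↦ (A¹ + tα, A² + tβ)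
the pair (a, b) is exactly quadratic in t (`curvPair_variation`). The Lagrangian is therefore a
quartic polynomial in t whose non-constant coefficients have compact support, and the derivative of
the action at t = 0 is read off as a coefficient; no differentiation under the integral sign is
needed. As ⟨· ∧ ∗·⟩ is symmetric, this derivative is twice the integral of ⟨(Dα + kβ) ∧ ∗a⟩ + ⟨(Dβ +
α ∧ A²) ∧ ∗b⟩.

The Leibniz rule and the infinitesimal invariance ⟨[X,Y],Z⟩ = ⟨X,[Y,Z]⟩ move D to the other factor:
the integrand is ⟨α ∧ (D∗a + A² ∧ ∗b)⟩ + ⟨β ∧ (k∗a - D∗b)⟩ plus exact forms (`pairing_curvLin`). The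
exact forms integrate to zero by Stokes, the variations being supported in the interior
(`integral_topCoeff_extD`). The fundamental lemma of the calculus of variations
(`eq_zero_of_forall_integral_wedge`) then identifies stationarity with the vanishing of the two
brackets, which are the left-hand sides of (1) and (2). Up to a sign they are also the two
components of 𝓓⋆𝓕 (`generalizedYangMills_iff`).

The remaining work derives this calculus from the concrete definitions. Exterior algebra rests on
one device, absorbing an inner antisymmetrization into an outer one (`altSum_sum_perm`), and the
Hodge star on α ∧ ι_u vol = α(u) vol (`wedgeAlt_plug`). Infinitesimal invariance comes from
differentiating Ad in a chart at 1 (`hasFDerivAt_localAdjoint`), independence of charts from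
naturality of d and ∗ (`inChart_fieldD`, `starAlt_comp`), and the measure from the change of
variables formula (`restrict_volumeMeasure`). -/

noncomputable section

namespace GDC

set_option linter.unusedSectionVars false

/-! ### Antisymmetrization and signs of block permutations -/

section Antisymmetrization

variable {E Z : Type*} [AddCommGroup Z] {p q r : ℕ}

/-- The antisymmetrization `∑ σ, sgn σ • G (v ∘ σ)` of a function of `r` vectors. -/
def altSum (G : (Fin r → E) → Z) (v : Fin r → E) : Z :=
  ∑ σ : Equiv.Perm (Fin r), Equiv.Perm.sign σ • G (fun i => v (σ i))

/-- Reindexing the sum by σ ↦ σρ changes each sign by the factor sgn ρ. -/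
lemma altSum_comp_perm (ρ : Equiv.Perm (Fin r)) (G : (Fin r → E) → Z) (v : Fin r → E) :
    altSum (fun w => G fun i => w (ρ i)) v = Equiv.Perm.sign ρ • altSum G v := by
  unfold altSum
  rw [Finset.smul_sum]
  refine Fintype.sum_equiv (Equiv.mulRight ρ) _ _ fun σ => ?_
  rw [smul_smul]
  simp [mul_comm (Equiv.Perm.sign σ), ← mul_assoc]

lemma altSum_sum {ι : Type*} (s : Finset ι) (G : ι → (Fin r → E) → Z) (v : Fin r → E) :
    altSum (fun w => ∑ i ∈ s, G i w) v = ∑ i ∈ s, altSum (G i) v := by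
  unfold altSum
  simp_rw [Finset.smul_sum]
  exact Finset.sum_comm

lemma altSum_units_smul (c : ℤˣ) (G : (Fin r → E) → Z) (v : Fin r → E) :
    altSum (fun w => c • G w) v = c • altSum G v := by
  unfold altSum
  rw [Finset.smul_sum]
  exact Finset.sum_congr rfl fun σ _ => smul_comm _ _ _

lemma altSum_smul [Module ℝ Z] (c : ℝ) (G : (Fin r → E) → Z) (v : Fin r → E) :
    altSum (fun w => c • G w) v = c • altSum G v := by
  unfold altSum
  rw [Finset.smul_sum]
  exact Finset.sum_congr rfl fun σ _ => smul_comm _ _ _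

/-- An inner antisymmetrization over some of the slots is absorbed by the outer one, each inner term
contributing the same amount. The resulting p! cancels the factorials in the normalization of the
exterior product; associativity and the Leibniz rule both rest on this. -/
lemma altSum_sum_perm (ι : Equiv.Perm (Fin p) → Equiv.Perm (Fin r))
    (hι : ∀ τ, Equiv.Perm.sign (ι τ) = Equiv.Perm.sign τ) (G : (Fin r → E) → Z) (v : Fin r → E) :
    altSum (fun w => ∑ τ, Equiv.Perm.sign τ • G fun i => w (ι τ i)) v
      = p.factorial • altSum G v := by
  rw [altSum_sum]
  simp_rw [altSum_units_smul, altSum_comp_perm, hι, smul_smul, Int.units_mul_self, one_smul]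
  simp [Fintype.card_perm]

/-- The block permutation `τ ⊕ ρ` of `Fin r`, `r = p + q`. -/
def blockPerm (h : p + q = r) (τ : Equiv.Perm (Fin p)) (ρ : Equiv.Perm (Fin q)) :
    Equiv.Perm (Fin r) :=
  (finSumFinEquiv.trans (finCongr h)).permCongr (Equiv.Perm.sumCongr τ ρ)

lemma sign_blockPerm (h : p + q = r) (τ : Equiv.Perm (Fin p)) (ρ : Equiv.Perm (Fin q)) :
    Equiv.Perm.sign (blockPerm h τ ρ) = Equiv.Perm.sign τ * Equiv.Perm.sign ρ := by
  rw [blockPerm, Equiv.Perm.sign_permCongr, Equiv.Perm.sign_sumCongr]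

@[simp] lemma blockPerm_castAdd (h : p + q = r) (τ : Equiv.Perm (Fin p)) (ρ : Equiv.Perm (Fin q))
    (i : Fin p) :
    blockPerm h τ ρ (Fin.cast h (Fin.castAdd q i)) = Fin.cast h (Fin.castAdd q (τ i)) := by
  subst h
  simp [blockPerm, Equiv.permCongr_apply]

@[simp] lemma blockPerm_natAdd (h : p + q = r) (τ : Equiv.Perm (Fin p)) (ρ : Equiv.Perm (Fin q))
    (j : Fin q) :
    blockPerm h τ ρ (Fin.cast h (Fin.natAdd p j)) = Fin.cast h (Fin.natAdd p (ρ j)) := by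
  subst h
  simp [blockPerm, Equiv.permCongr_apply]

lemma coe_finRotate_pow (k : ℕ) (i : Fin r) : (((finRotate r) ^ k) i : ℕ) = (i + k) % r := by
  induction k with
  | zero => simp [Nat.mod_eq_of_lt i.2]
  | succ k ih =>
    obtain _ | m := r
    · exact i.elim0
    rw [pow_succ', Equiv.Perm.mul_apply, finRotate_apply, Fin.val_add, ih]
    simp [← add_assoc, Nat.add_mod]

/-- The exponent (p + q - 1)q equals pq + q(q - 1), and q(q - 1) is even. -/
lemma sign_finRotate_pow (h : p + q = r) :
    Equiv.Perm.sign ((finRotate r) ^ q) = (-1) ^ (p * q) := by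
  rw [map_pow, sign_finRotate, ← pow_mul]
  obtain _ | q := q
  · simp
  obtain rfl : r = p + q + 1 := by omega
  have : (p + q + 1 - 1) * (q + 1) = p * (q + 1) + q * (q + 1) := by
    rw [Nat.add_sub_cancel]; ring
  rw [this, pow_add, (Nat.even_mul_succ_self q).neg_one_pow, mul_one]

/-- Interchange of two blocks of vectors. -/
lemma altSum_swap (h : p + q = r) (h' : q + p = r) (G : (Fin p → E) → (Fin q → E) → Z)
    (v : Fin r → E) :
    altSum (fun w => G (fun i => w (Fin.cast h' (Fin.natAdd q i)))
        (fun j => w (Fin.cast h' (Fin.castAdd p j)))) v =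
      (-1 : ℤˣ) ^ (p * q) • altSum (fun w => G (fun i => w (Fin.cast h (Fin.castAdd q i)))
        (fun j => w (Fin.cast h (Fin.natAdd p j)))) v := by
  rw [← sign_finRotate_pow h, ← altSum_comp_perm]
  congr 1
  ext1 w
  congr 1
  · ext1 i
    congr 1
    ext
    rw [coe_finRotate_pow, Nat.mod_eq_of_lt] <;> simp <;> omega
  · ext1 j
    congr 1
    ext
    rw [coe_finRotate_pow, Fin.val_cast, Fin.val_cast, Fin.val_natAdd,
      show p + (j : ℕ) + q = j + r by omega, Nat.add_mod_right, Nat.mod_eq_of_lt]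
    · rfl
    · omega

end Antisymmetrization

/-! ### Exterior algebra at one point: commutativity, associativity, alternatization -/

section Pointwise

variable {n : ℕ}
  {V : Type*} [NormedAddCommGroup V] [NormedSpace ℝ V]
  {W : Type*} [NormedAddCommGroup W] [NormedSpace ℝ W]
  {X : Type*} [NormedAddCommGroup X] [NormedSpace ℝ X]
  {Y : Type*} [NormedAddCommGroup Y] [NormedSpace ℝ Y]
  {Z : Type*} [NormedAddCommGroup Z] [NormedSpace ℝ Z]

lemma altSum_alternating {r : ℕ} (f : Vec n [⋀^Fin r]→L[ℝ] Z) (v : Fin r → Vec n) :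
    altSum (fun w => f w) v = r.factorial • f v := by
  unfold altSum
  have h (σ : Equiv.Perm (Fin r)) : f (fun i => v (σ i)) = Equiv.Perm.sign σ • f v :=
    f.toAlternatingMap.map_perm v σ
  simp_rw [h, smul_smul, Int.units_mul_self, one_smul]
  simp [Fintype.card_perm]

lemma wedgeAlt_apply (b : V →L[ℝ] W →L[ℝ] Z) {p q r : ℕ} (h : p + q = r)
    (α : Vec n [⋀^Fin p]→L[ℝ] V) (β : Vec n [⋀^Fin q]→L[ℝ] W) (v : Fin r → Vec n) :
    wedgeAlt b h α β v = ((p.factorial * q.factorial : ℕ) : ℝ)⁻¹ •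
      altSum (fun w => b (α fun i => w (Fin.cast h (Fin.castAdd q i)))
        (β fun j => w (Fin.cast h (Fin.natAdd p j)))) v := by
  rw [wedgeAlt, ContinuousAlternatingMap.smul_apply,
    ContinuousMultilinearMap.alternatization_apply_apply]
  rfl

lemma wedgeAlt_add_left (b : V →L[ℝ] W →L[ℝ] Z) {p q r : ℕ} (h : p + q = r)
    (α α' : Vec n [⋀^Fin p]→L[ℝ] V) (β : Vec n [⋀^Fin q]→L[ℝ] W) :
    wedgeAlt b h (α + α') β = wedgeAlt b h α β + wedgeAlt b h α' β := by
  ext v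
  simp [wedgeAlt_apply, altSum, Finset.sum_add_distrib]

lemma wedgeAlt_add_right (b : V →L[ℝ] W →L[ℝ] Z) {p q r : ℕ} (h : p + q = r)
    (α : Vec n [⋀^Fin p]→L[ℝ] V) (β β' : Vec n [⋀^Fin q]→L[ℝ] W) :
    wedgeAlt b h α (β + β') = wedgeAlt b h α β + wedgeAlt b h α β' := by
  ext v
  simp [wedgeAlt_apply, altSum, Finset.sum_add_distrib]

lemma wedgeAlt_smul_left (b : V →L[ℝ] W →L[ℝ] Z) {p q r : ℕ} (h : p + q = r) (c : ℝ)
    (α : Vec n [⋀^Fin p]→L[ℝ] V) (β : Vec n [⋀^Fin q]→L[ℝ] W) :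
    wedgeAlt b h (c • α) β = c • wedgeAlt b h α β := by
  ext v
  simp only [wedgeAlt_apply, ContinuousAlternatingMap.smul_apply, map_smul, smul_apply, altSum_smul,
    smul_comm c]

lemma wedgeAlt_smul_right (b : V →L[ℝ] W →L[ℝ] Z) {p q r : ℕ} (h : p + q = r) (c : ℝ)
    (α : Vec n [⋀^Fin p]→L[ℝ] V) (β : Vec n [⋀^Fin q]→L[ℝ] W) :
    wedgeAlt b h α (c • β) = c • wedgeAlt b h α β := by
  ext v
  simp only [wedgeAlt_apply, ContinuousAlternatingMap.smul_apply, map_smul, altSum_smul,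
    smul_comm c]

lemma wedgeAlt_zero_left (b : V →L[ℝ] W →L[ℝ] Z) {p q r : ℕ} (h : p + q = r)
    (β : Vec n [⋀^Fin q]→L[ℝ] W) : wedgeAlt b h (0 : Vec n [⋀^Fin p]→L[ℝ] V) β = 0 := by
  simpa using wedgeAlt_smul_left b h 0 (0 : Vec n [⋀^Fin p]→L[ℝ] V) β

lemma wedgeAlt_zero_right (b : V →L[ℝ] W →L[ℝ] Z) {p q r : ℕ} (h : p + q = r)
    (α : Vec n [⋀^Fin p]→L[ℝ] V) : wedgeAlt b h α (0 : Vec n [⋀^Fin q]→L[ℝ] W) = 0 := by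
  simpa using wedgeAlt_smul_right b h 0 α (0 : Vec n [⋀^Fin q]→L[ℝ] W)

lemma wedgeAlt_comp (b : V →L[ℝ] W →L[ℝ] Z) {p q r : ℕ} (h : p + q = r)
    (α : Vec n [⋀^Fin p]→L[ℝ] V) (β : Vec n [⋀^Fin q]→L[ℝ] W) (L : Vec n →L[ℝ] Vec n) :
    wedgeAlt b h (α.compContinuousLinearMap L) (β.compContinuousLinearMap L) =
      (wedgeAlt b h α β).compContinuousLinearMap L := by
  ext v
  simp only [wedgeAlt_apply, ContinuousAlternatingMap.compContinuousLinearMap_apply]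
  rfl

lemma wedgeAlt_comm (b : V →L[ℝ] W →L[ℝ] Z) (b' : W →L[ℝ] V →L[ℝ] Z)
    (hb : ∀ x y, b' y x = b x y) {p q r : ℕ} (h : p + q = r) (h' : q + p = r)
    (α : Vec n [⋀^Fin p]→L[ℝ] V) (β : Vec n [⋀^Fin q]→L[ℝ] W) :
    wedgeAlt b' h' β α = (-1 : ℝ) ^ (p * q) • wedgeAlt b h α β := by
  ext v
  simp only [wedgeAlt_apply, hb, ContinuousAlternatingMap.smul_apply]
  rw [altSum_swap h h' (fun x y => b (α x) (β y)), mul_comm q.factorial, smul_comm]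
  rcases Nat.even_or_odd (p * q) with h2 | h2 <;> simp [h2.neg_one_pow]

/-- The permutations of the first s slots are absorbed by those of all t slots, which produces s!
and cancels the normalization of the outer product. The result is symmetric in its treatment of the
three factors, so comparison with the other bracketing gives associativity. -/
lemma wedgeAlt_wedgeAlt_left (b : V →L[ℝ] W →L[ℝ] Y) (c : Y →L[ℝ] X →L[ℝ] Z) {p q r s t : ℕ}
    (h : p + q = s) (h' : s + r = t) (α : Vec n [⋀^Fin p]→L[ℝ] V) (β : Vec n [⋀^Fin q]→L[ℝ] W)
    (γ : Vec n [⋀^Fin r]→L[ℝ] X) (v : Fin t → Vec n) :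
    wedgeAlt c h' (wedgeAlt b h α β) γ v =
      ((p.factorial * q.factorial * r.factorial : ℕ) : ℝ)⁻¹ •
      altSum (fun w => c (b (α fun i => w (Fin.cast h' (Fin.castAdd r (Fin.cast h (Fin.castAdd q i)))))
        (β fun j => w (Fin.cast h' (Fin.castAdd r (Fin.cast h (Fin.natAdd p j))))))
        (γ fun j => w (Fin.cast h' (Fin.natAdd s j)))) v := by
  have := altSum_sum_perm (fun τ : Equiv.Perm (Fin s) => blockPerm h' τ 1)
    (fun τ => by simp [sign_blockPerm])
    (fun w : Fin t → Vec n => c (b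
      (α fun i => w (Fin.cast h' (Fin.castAdd r (Fin.cast h (Fin.castAdd q i)))))
        (β fun j => w (Fin.cast h' (Fin.castAdd r (Fin.cast h (Fin.natAdd p j))))))
        (γ fun j => w (Fin.cast h' (Fin.natAdd s j)))) v
  rw [wedgeAlt_apply]
  simp only [wedgeAlt_apply, map_smul, smul_apply]
  rw [altSum_smul]
  have h2 : ∀ w : Fin t → Vec n, c (altSum (fun w : Fin s → Vec n =>
      b (α fun i => w (Fin.cast h (Fin.castAdd q i))) (β fun j => w (Fin.cast h (Fin.natAdd p j))))
      fun i => w (Fin.cast h' (Fin.castAdd r i))) (γ fun j => w (Fin.cast h' (Fin.natAdd s j))) =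
      ∑ τ : Equiv.Perm (Fin s), Equiv.Perm.sign τ • c (b
      (α fun i => w (blockPerm h' τ 1 (Fin.cast h' (Fin.castAdd r (Fin.cast h (Fin.castAdd q i))))))
        (β fun j => w (blockPerm h' τ 1 (Fin.cast h' (Fin.castAdd r (Fin.cast h (Fin.natAdd p j)))))))
        (γ fun j => w (blockPerm h' τ 1 (Fin.cast h' (Fin.natAdd s j)))) := by
    intro w
    simp only [altSum, map_sum, sum_apply, blockPerm_castAdd, blockPerm_natAdd, Units.smul_def,
      map_zsmul, smul_apply, Equiv.Perm.one_apply]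
  simp_rw [h2]
  rw [this, ← Nat.cast_smul_eq_nsmul ℝ, smul_smul, smul_smul]
  congr 1
  have := s.factorial_ne_zero
  push_cast
  field_simp

lemma wedgeAlt_wedgeAlt_right (b : V →L[ℝ] W →L[ℝ] Z) (c : X →L[ℝ] Y →L[ℝ] W) {p q r s t : ℕ}
    (h : q + r = s) (h' : p + s = t) (α : Vec n [⋀^Fin p]→L[ℝ] V) (β : Vec n [⋀^Fin q]→L[ℝ] X)
    (γ : Vec n [⋀^Fin r]→L[ℝ] Y) (v : Fin t → Vec n) :
    wedgeAlt b h' α (wedgeAlt c h β γ) v =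
      ((p.factorial * q.factorial * r.factorial : ℕ) : ℝ)⁻¹ •
      altSum (fun w => b (α fun i => w (Fin.cast h' (Fin.castAdd s i)))
        (c (β fun j => w (Fin.cast h' (Fin.natAdd p (Fin.cast h (Fin.castAdd r j)))))
        (γ fun j => w (Fin.cast h' (Fin.natAdd p (Fin.cast h (Fin.natAdd q j))))))) v := by
  have := altSum_sum_perm (fun τ : Equiv.Perm (Fin s) => blockPerm h' 1 τ)
    (fun τ => by simp [sign_blockPerm])
    (fun w : Fin t → Vec n => b (α fun i => w (Fin.cast h' (Fin.castAdd s i)))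
        (c (β fun j => w (Fin.cast h' (Fin.natAdd p (Fin.cast h (Fin.castAdd r j)))))
        (γ fun j => w (Fin.cast h' (Fin.natAdd p (Fin.cast h (Fin.natAdd q j))))))) v
  rw [wedgeAlt_apply]
  simp only [wedgeAlt_apply, map_smul]
  rw [altSum_smul]
  have h2 : ∀ w : Fin t → Vec n, b (α fun i => w (Fin.cast h' (Fin.castAdd s i)))
      (altSum (fun w : Fin s → Vec n =>
      c (β fun i => w (Fin.cast h (Fin.castAdd r i))) (γ fun j => w (Fin.cast h (Fin.natAdd q j))))
      fun i => w (Fin.cast h' (Fin.natAdd p i))) =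
      ∑ τ : Equiv.Perm (Fin s), Equiv.Perm.sign τ •
      b (α fun i => w (blockPerm h' 1 τ (Fin.cast h' (Fin.castAdd s i))))
        (c (β fun j => w (blockPerm h' 1 τ (Fin.cast h' (Fin.natAdd p (Fin.cast h (Fin.castAdd r j))))))
        (γ fun j => w (blockPerm h' 1 τ
          (Fin.cast h' (Fin.natAdd p (Fin.cast h (Fin.natAdd q j))))))) := by
    intro w
    simp only [altSum, map_sum, blockPerm_castAdd, blockPerm_natAdd, Units.smul_def,
      map_zsmul, Equiv.Perm.one_apply]
  simp_rw [h2]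
  rw [this, ← Nat.cast_smul_eq_nsmul ℝ, smul_smul, smul_smul]
  congr 1
  have := s.factorial_ne_zero
  push_cast
  field_simp

/-- Associativity of the exterior product. -/
lemma wedgeAlt_assoc {V' : Type*} [NormedAddCommGroup V'] [NormedSpace ℝ V']
    {W' : Type*} [NormedAddCommGroup W'] [NormedSpace ℝ W']
    (b : V →L[ℝ] W →L[ℝ] V') (c : V' →L[ℝ] X →L[ℝ] Z)
    (b' : W →L[ℝ] X →L[ℝ] W') (c' : V →L[ℝ] W' →L[ℝ] Z)
    (hbc : ∀ x y z, c (b x y) z = c' x (b' y z)) {p q r s u t : ℕ}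
    (h : p + q = s) (h' : s + r = t) (h₂ : q + r = u) (h₂' : p + u = t)
    (α : Vec n [⋀^Fin p]→L[ℝ] V) (β : Vec n [⋀^Fin q]→L[ℝ] W) (γ : Vec n [⋀^Fin r]→L[ℝ] X) :
    wedgeAlt c h' (wedgeAlt b h α β) γ = wedgeAlt c' h₂' α (wedgeAlt b' h₂ β γ) := by
  ext v
  rw [wedgeAlt_wedgeAlt_left, wedgeAlt_wedgeAlt_right]
  subst h h₂ h'
  have e₁ (i : Fin p) : Fin.castAdd r (Fin.castAdd q i) =
      Fin.cast h₂' (Fin.castAdd (q + r) i) := rfl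
  have e₂ (j : Fin q) : Fin.castAdd r (Fin.natAdd p j) =
      Fin.cast h₂' (Fin.natAdd p (Fin.castAdd r j)) := rfl
  have e₃ (j : Fin r) : Fin.natAdd (p + q) j = Fin.cast h₂' (Fin.natAdd p (Fin.natAdd q j)) := by
    ext; simp [add_assoc]
  simp only [hbc, Fin.cast_eq_self, e₁, e₂, e₃]

/-- The alternating sum over p + 1 positions is itself alternating, so antisymmetrizing it
multiplies it by (p + 1)!. Each of its terms antisymmetrizes to the same value, because the cycle
bringing position i to the front has sign (-1)^i. Dividing by p + 1 leaves the factor 1/p!. -/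
lemma alternatizeUncurryFin_eq_altSum {p : ℕ} (A : Vec n →L[ℝ] Vec n [⋀^Fin p]→L[ℝ] Z)
    (v : Fin (p + 1) → Vec n) :
    ContinuousAlternatingMap.alternatizeUncurryFin A v =
      ((p.factorial : ℕ) : ℝ)⁻¹ • altSum (fun w => A (w 0) fun i => w i.succ) v := by
  have h1 := altSum_alternating (ContinuousAlternatingMap.alternatizeUncurryFin A) v
  simp only [ContinuousAlternatingMap.alternatizeUncurryFin_apply] at h1
  rw [altSum_sum] at h1
  have h2 : ∀ i : Fin (p + 1), altSum (fun w => (-1 : ℤ) ^ (i : ℕ) • A (w i) (i.removeNth w)) v =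
      altSum (fun w => A (w 0) fun i => w i.succ) v := by
    intro i
    have h3 := altSum_comp_perm (i.cycleRange.symm) (fun w => A (w 0) fun i => w i.succ) v
    have h4 : (fun w : Fin (p + 1) → Vec n => (-1 : ℤ) ^ (i : ℕ) • A (w i) (i.removeNth w)) =
        fun w => ((-1 : ℤˣ) ^ (i : ℕ)) • A (w (i.cycleRange.symm 0))
          fun j => w (i.cycleRange.symm j.succ) := by
      ext1 w
      rw [Fin.cycleRange_symm_zero]
      simp only [Fin.cycleRange_symm_succ, Units.smul_def]
      push_cast
      rfl
    rw [h4, altSum_units_smul, h3, Equiv.Perm.sign_symm, Fin.sign_cycleRange, smul_smul,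
      Int.units_mul_self, one_smul]
  simp only [h2, Finset.sum_const, Finset.card_univ, Fintype.card_fin, Nat.factorial_succ] at h1
  rw [ContinuousAlternatingMap.alternatizeUncurryFin_apply]
  rw [← Nat.cast_smul_eq_nsmul ℝ, ← Nat.cast_smul_eq_nsmul ℝ] at h1
  have h5 : ((p + 1 : ℕ) : ℝ) ≠ 0 := by positivity
  rw [Nat.cast_mul, mul_smul] at h1
  have h6 := smul_right_injective Z h5 h1
  rw [h6, inv_smul_smul₀ (by positivity)]

end Pointwise

/-! ### Leibniz rule at one point, and products with contractions of a volume form -/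

section Pointwise

variable {n : ℕ}
  {V : Type*} [NormedAddCommGroup V] [NormedSpace ℝ V]
  {W : Type*} [NormedAddCommGroup W] [NormedSpace ℝ W]
  {Z : Type*} [NormedAddCommGroup Z] [NormedSpace ℝ Z]

/-- Pointwise form of the Leibniz rule, derivative falling on the first factor. -/
lemma alternatizeUncurryFin_wedge_left (b : V →L[ℝ] W →L[ℝ] Z) {p q r : ℕ} (h : p + q = r)
    (h' : p + 1 + q = r + 1)
    (A : Vec n →L[ℝ] Vec n [⋀^Fin p]→L[ℝ] V) (β : Vec n [⋀^Fin q]→L[ℝ] W)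
    (C : Vec n →L[ℝ] Vec n [⋀^Fin r]→L[ℝ] Z) (hC : ∀ x, C x = wedgeAlt b h (A x) β) :
    ContinuousAlternatingMap.alternatizeUncurryFin C =
      wedgeAlt b h' (ContinuousAlternatingMap.alternatizeUncurryFin A) β := by
  ext v
  set G : (Fin (r + 1) → Vec n) → Z := fun w =>
    b (A (w (Fin.cast h' (Fin.castAdd q 0))) fun i => w (Fin.cast h' (Fin.castAdd q i.succ)))
      (β fun j => w (Fin.cast h' (Fin.natAdd (p + 1) j))) with hG
  have e₁ (i : Fin p) : (Fin.cast h (Fin.castAdd q i)).succ =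
      Fin.cast h' (Fin.castAdd q i.succ) := by ext; simp
  have e₂ (j : Fin q) : (Fin.cast h (Fin.natAdd p j)).succ =
      Fin.cast h' (Fin.natAdd (p + 1) j) := by ext; simp; omega
  have e₀ : (0 : Fin (r + 1)) = Fin.cast h' (Fin.castAdd q 0) := by ext; simp
  have hl : ContinuousAlternatingMap.alternatizeUncurryFin C v =
      ((p.factorial * q.factorial : ℕ) : ℝ)⁻¹ • altSum G v := by
    rw [alternatizeUncurryFin_eq_altSum]
    simp only [hC, wedgeAlt_apply]
    rw [altSum_smul]
    -- Slot 0 carries the direction of differentiation; the permutations of the other r slots embed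
    -- as those fixing 0. The right-hand side absorbs instead the permutations of its first p + 1
    -- slots, and both sides reduce to the antisymmetrization of the same `G`.
    have := altSum_sum_perm (fun τ : Equiv.Perm (Fin r) => Equiv.Perm.decomposeFin.symm (0, τ))
      (fun τ => by simp) G v
    have h2 : ∀ w : Fin (r + 1) → Vec n, altSum (fun w' : Fin r → Vec n =>
        b (A (w 0) fun i => w' (Fin.cast h (Fin.castAdd q i)))
          (β fun j => w' (Fin.cast h (Fin.natAdd p j)))) (fun i => w i.succ) =
        ∑ τ : Equiv.Perm (Fin r), Equiv.Perm.sign τ •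
          G fun i => w (Equiv.Perm.decomposeFin.symm (0, τ) i) := by
      intro w
      simp only [altSum, hG, ← e₁, ← e₂, ← e₀, Equiv.Perm.decomposeFin_symm_apply_succ,
        Equiv.Perm.decomposeFin_symm_apply_zero, Equiv.swap_self, Equiv.refl_apply]
    simp_rw [h2]
    rw [this, ← Nat.cast_smul_eq_nsmul ℝ, smul_smul, smul_smul]
    congr 1
    have := r.factorial_ne_zero
    push_cast
    field_simp
  have hr : wedgeAlt b h' (ContinuousAlternatingMap.alternatizeUncurryFin A) β v =
      ((p.factorial * q.factorial : ℕ) : ℝ)⁻¹ • altSum G v := by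
    rw [wedgeAlt_apply]
    simp only [alternatizeUncurryFin_eq_altSum, map_smul, smul_apply]
    rw [altSum_smul]
    have := altSum_sum_perm (fun τ : Equiv.Perm (Fin (p + 1)) => blockPerm h' τ 1)
      (fun τ => by simp [sign_blockPerm]) G v
    have h2 : ∀ w : Fin (r + 1) → Vec n, b (altSum (fun w' : Fin (p + 1) → Vec n =>
        A (w' 0) fun i => w' i.succ) (fun i => w (Fin.cast h' (Fin.castAdd q i))))
          (β fun j => w (Fin.cast h' (Fin.natAdd (p + 1) j))) =
        ∑ τ : Equiv.Perm (Fin (p + 1)), Equiv.Perm.sign τ •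
          G fun i => w (blockPerm h' τ 1 i) := by
      intro w
      simp only [altSum, hG, blockPerm_castAdd, blockPerm_natAdd, map_sum, sum_apply,
        Units.smul_def, map_zsmul, smul_apply, Equiv.Perm.one_apply]
    simp_rw [h2]
    rw [this, ← Nat.cast_smul_eq_nsmul ℝ, smul_smul, smul_smul]
    congr 1
    have := (p + 1).factorial_ne_zero
    push_cast
    field_simp
  rw [hl, hr]

/-- Pointwise form of the Leibniz rule, derivative falling on the second factor. -/
lemma alternatizeUncurryFin_wedge_right (b : V →L[ℝ] W →L[ℝ] Z) {p q r : ℕ} (h : p + q = r)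
    (h' : p + (q + 1) = r + 1)
    (α : Vec n [⋀^Fin p]→L[ℝ] V) (A : Vec n →L[ℝ] Vec n [⋀^Fin q]→L[ℝ] W)
    (C : Vec n →L[ℝ] Vec n [⋀^Fin r]→L[ℝ] Z) (hC : ∀ x, C x = wedgeAlt b h α (A x)) :
    ContinuousAlternatingMap.alternatizeUncurryFin C =
      (-1 : ℝ) ^ p • wedgeAlt b h' α (ContinuousAlternatingMap.alternatizeUncurryFin A) := by
  have hflip : ∀ x y, b.flip y x = b x y := fun _ _ => rfl
  have hflip' : ∀ x y, b y x = b.flip x y := fun _ _ => rfl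
  -- Interchanging the factors costs (-1)^(pq) before differentiation and (-1)^(p(q+1)) after it;
  -- the two together leave (-1)^p.
  have h1 := alternatizeUncurryFin_wedge_left b.flip (p := q) (q := p) (r := r) (by omega) (by omega)
    A α ((-1 : ℝ) ^ (p * q) • C) (fun x => by
      rw [wedgeAlt_comm b b.flip hflip h, smul_apply, hC])
  rw [ContinuousAlternatingMap.alternatizeUncurryFin_smul, wedgeAlt_comm b b.flip hflip h'] at h1
  have h2 := congrArg (fun z => (-1 : ℝ) ^ (p * q) • z) h1
  simp only [smul_smul, ← pow_add] at h2
  rw [(show Even (p * q + p * q) from ⟨_, rfl⟩).neg_one_pow, one_smul] at h2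
  rw [h2]
  congr 1
  rw [show p * q + p * (q + 1) = 2 * (p * q) + p by ring, pow_add, pow_mul]
  simp

/-- Top-degree alternating maps which agree on a basis are equal. -/
lemma eq_of_apply_basis_eq {f g : Vec n [⋀^Fin n]→L[ℝ] Z} (e : Module.Basis (Fin n) ℝ (Vec n))
    (h : f e = g e) : f = g := by
  apply ContinuousAlternatingMap.toAlternatingMap_injective
  refine e.ext_alternating fun v hv => ?_
  let σ : Equiv.Perm (Fin n) := Equiv.ofBijective v (Finite.injective_iff_bijective.1 hv)
  have h1 := f.toAlternatingMap.map_perm e σ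
  have h2 := g.toAlternatingMap.map_perm e σ
  have h3 : f.toAlternatingMap e = g.toAlternatingMap e := h
  rw [h3, ← h2] at h1
  exact h1

lemma exists_basis_extending {p q : ℕ} (h : p + q = n) (u : Fin p → Vec n)
    (hu : LinearIndependent ℝ u) :
    ∃ e : Module.Basis (Fin n) ℝ (Vec n), ∀ i, e (Fin.cast h (Fin.castAdd q i)) = u i := by
  let e₁ := Module.Basis.sumExtend hu
  have : Finite (Fin p ⊕ Module.Basis.sumExtendIndex hu) := Module.Finite.finite_basis e₁
  have : Finite (Module.Basis.sumExtendIndex hu) := Finite.sum_right (Fin p)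
  have := Fintype.ofFinite (Module.Basis.sumExtendIndex hu)
  have hc : Fintype.card (Module.Basis.sumExtendIndex hu) = q := by
    have := Module.finrank_eq_card_basis e₁
    rw [finrank_euclideanSpace_fin, Fintype.card_sum, Fintype.card_fin] at this
    omega
  let ε : Module.Basis.sumExtendIndex hu ≃ Fin q := Fintype.equivFinOfCardEq hc
  let θ : Fin p ⊕ Module.Basis.sumExtendIndex hu ≃ Fin n :=
    ((Equiv.refl _).sumCongr ε).trans (finSumFinEquiv.trans (finCongr h))
  refine ⟨e₁.reindex θ, fun i => ?_⟩
  have : θ.symm (Fin.cast h (Fin.castAdd q i)) = Sum.inl i := by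
    rw [Equiv.symm_apply_eq]
    simp [θ]
  rw [Module.Basis.reindex_apply, this]
  simp only [e₁, Module.Basis.sumExtend, Module.Basis.reindex_apply]
  rw [Module.Basis.extend_apply_self]
  rfl

/-- A permutation of a finite set which maps the last block into itself preserves both blocks, so
only the block permutations τ ⊕ ρ can contribute. -/
lemma sum_perm_block {Z : Type*} [AddCommGroup Z] {p q r : ℕ} (h : p + q = r) (F : Equiv.Perm (Fin r) → Z)
    (hF : ∀ σ, (∃ i j, σ (Fin.cast h (Fin.natAdd p j)) = Fin.cast h (Fin.castAdd q i)) → F σ = 0) :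
    ∑ σ, F σ = ∑ x : Equiv.Perm (Fin p) × Equiv.Perm (Fin q), F (blockPerm h x.1 x.2) := by
  subst h
  rw [← (finSumFinEquiv (m := p) (n := q)).permCongr.sum_comp]
  have hinj := Equiv.Perm.sumCongrHom_injective (α := Fin p) (β := Fin q)
  have hb (x : Equiv.Perm (Fin p) × Equiv.Perm (Fin q)) : blockPerm rfl x.1 x.2 =
      finSumFinEquiv.permCongr (Equiv.Perm.sumCongrHom _ _ x) := by
    ext; rfl
  simp_rw [hb]
  refine Eq.trans (Eq.symm ?_)
    (Finset.sum_map Finset.univ ⟨_, hinj⟩ (fun σ => F (finSumFinEquiv.permCongr σ)))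
  refine Finset.sum_subset (Finset.subset_univ _) fun σ _ hσ => hF _ ?_
  by_contra! hcon
  apply hσ
  have h1 : σ ∈ (Equiv.Perm.sumCongrHom (Fin p) (Fin q)).range := by
    apply Equiv.Perm.mem_sumCongrHom_range_of_perm_mapsTo_inl
    rw [Equiv.Perm.perm_mapsTo_inl_iff_mapsTo_inr]
    rintro _ ⟨j, rfl⟩
    rcases hs : σ (Sum.inr j) with i | j'
    · exact absurd (by simp [Equiv.permCongr_apply, hs]) (hcon i j)
    · exact ⟨j', rfl⟩
  obtain ⟨x, hx⟩ := h1
  exact Finset.mem_map.2 ⟨x, Finset.mem_univ _, hx⟩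

@[simp] lemma plug_apply {p q r : ℕ} (h : p + q = r) (η : Vec n [⋀^Fin r]→L[ℝ] ℝ)
    (u : Fin p → Vec n) (w : Fin q → Vec n) :
    plug h η u w = η fun i => Fin.append u w (Fin.cast h.symm i) := rfl

/-- The identity α ∧ ι_u vol = α(u) vol, from which both the formula for α ∧ ∗β and the
nondegeneracy of the exterior product follow. If the u_i are dependent both sides vanish. Otherwise
extend u to a basis and evaluate there: the only surviving permutations are block permutations, and
all p! q! of them give the same term. -/
lemma wedgeAlt_plug (b : V →L[ℝ] W →L[ℝ] Z) {p q : ℕ} (h : p + q = n)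
    (vol : Vec n [⋀^Fin n]→L[ℝ] ℝ) (α : Vec n [⋀^Fin p]→L[ℝ] V) (u : Fin p → Vec n) (z : W) :
    wedgeAlt b h α ((plug h vol u).smulRight z) = vol.smulRight (b (α u) z) := by
  by_cases hu : LinearIndependent ℝ u
  · obtain ⟨e, he⟩ := exists_basis_extending h u hu
    apply eq_of_apply_basis_eq e
    rw [wedgeAlt_apply, altSum, sum_perm_block h]
    · have key (x : Equiv.Perm (Fin p) × Equiv.Perm (Fin q)) :
          Equiv.Perm.sign (blockPerm h x.1 x.2) • b
            (α fun i => e (blockPerm h x.1 x.2 (Fin.cast h (Fin.castAdd q i))))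
            ((plug h vol u).smulRight z
              fun j => e (blockPerm h x.1 x.2 (Fin.cast h (Fin.natAdd p j)))) =
          vol.smulRight (b (α u) z) e := by
        simp only [blockPerm_castAdd, blockPerm_natAdd, he, sign_blockPerm,
          ContinuousAlternatingMap.smulRight_apply, plug_apply]
        have h1 : (α fun i => u (x.1 i)) = Equiv.Perm.sign x.1 • α u :=
          α.toAlternatingMap.map_perm u x.1
        have h2 : (fun i => Fin.append u (fun j => e (Fin.cast h (Fin.natAdd p (x.2 j))))
            (Fin.cast h.symm i)) = fun i => e (blockPerm h 1 x.2 i) := by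
          subst h
          ext1 i
          induction i using Fin.addCases with
          | left i =>
            have := blockPerm_castAdd rfl 1 x.2 i
            simp only [Fin.cast_eq_self] at this he ⊢
            rw [this]; simp [he]
          | right j =>
            have := blockPerm_natAdd rfl (1 : Equiv.Perm (Fin p)) x.2 j
            simp only [Fin.cast_eq_self] at this he ⊢
            rw [this]; simp
        have h3 : (vol fun i => e (blockPerm h 1 x.2 i)) = Equiv.Perm.sign x.2 • vol e := by
          have := vol.toAlternatingMap.map_perm e (blockPerm h 1 x.2)
          rw [sign_blockPerm, map_one, one_mul] at this
          exact this
        rw [h1, h2, h3]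
        rcases Int.units_eq_one_or (Equiv.Perm.sign x.1) with h4 | h4 <;>
        rcases Int.units_eq_one_or (Equiv.Perm.sign x.2) with h5 | h5 <;> simp [h4, h5]
      rw [Finset.sum_congr rfl fun x _ => key x, Finset.sum_const, Finset.card_univ,
        Fintype.card_prod, Fintype.card_perm, Fintype.card_perm, Fintype.card_fin,
        Fintype.card_fin, ← Nat.cast_smul_eq_nsmul ℝ, inv_smul_smul₀]
      have := p.factorial_ne_zero
      have := q.factorial_ne_zero
      positivity
    -- Here σ puts one of the u_i among the last q arguments, where it meets the copy of u_i already
    -- inserted into `vol`.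
    · rintro σ ⟨i, j, hij⟩
      have : (plug h vol u) (fun j => e (σ (Fin.cast h (Fin.natAdd p j)))) = 0 := by
        rw [plug_apply]
        refine vol.map_eq_zero_of_eq _ (i := Fin.cast h (Fin.castAdd q i))
          (j := Fin.cast h (Fin.natAdd p j)) ?_ ?_
        · simp [hij, he]
        · simp [Fin.ext_iff]; omega
      simp [this]
  · have h1 : α u = 0 := α.toAlternatingMap.map_linearDependent u hu
    have h2 : plug h vol u = 0 := by
      ext w
      rw [plug_apply]
      refine vol.toAlternatingMap.map_linearDependent _ fun hcon => hu ?_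
      have := hcon.comp (fun i : Fin p => Fin.cast h (Fin.castAdd q i)) (fun i j hij => by
        simpa using hij)
      have h3 : ((fun i => Fin.append u w (Fin.cast h.symm i)) ∘
          fun i : Fin p => Fin.cast h (Fin.castAdd q i)) = u := by
        ext1 i
        simp
      rwa [h3] at this
    have h3 : (0 : Vec n [⋀^Fin q]→L[ℝ] ℝ).smulRight z = 0 := by ext; simp
    rw [h2, h3, wedgeAlt_zero_right, h1]
    ext; simp

end Pointwise

/-! ### The Hodge star at one point -/

section Star

variable {n : ℕ}
  {V : Type*} [NormedAddCommGroup V] [NormedSpace ℝ V]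
  {W : Type*} [NormedAddCommGroup W] [NormedSpace ℝ W]
  {Z : Type*} [NormedAddCommGroup Z] [NormedSpace ℝ Z]

lemma map_sum_smul {p : ℕ} (f : Vec n [⋀^Fin p]→L[ℝ] W) (c : Fin p → Fin n → ℝ)
    (u : Fin n → Vec n) :
    f (fun k => ∑ j, c k j • u j) = ∑ t : Fin p → Fin n, (∏ k, c k (t k)) • f fun k => u (t k) := by
  rw [show f (fun k => ∑ j, c k j • u j) = f.toMultilinearMap (fun k => ∑ j, c k j • u j) from rfl,
    MultilinearMap.map_sum]
  refine Finset.sum_congr rfl fun t _ => ?_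
  rw [MultilinearMap.map_smul_univ]
  rfl

lemma sum_smul_stdVec (v : Vec n) : ∑ i, v i • stdVec i = v := by
  have := (EuclideanSpace.basisFun (Fin n) ℝ).sum_repr v
  simpa [stdVec] using this

lemma stdVec_apply (i j : Fin n) : stdVec i j = if j = i then (1 : ℝ) else 0 := by
  simp [stdVec]

lemma starAlt_apply (g : Vec n →L[ℝ] Vec n →L[ℝ] ℝ) (vol : Vec n [⋀^Fin n]→L[ℝ] ℝ) {p q : ℕ}
    (h : p + q = n) (α : Vec n [⋀^Fin p]→L[ℝ] W) (w : Fin q → Vec n) :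
    starAlt g vol h α w = ((p.factorial : ℕ) : ℝ)⁻¹ • ∑ s : Fin p → Fin n,
      plug h vol (fun i => dualVec g (s i)) w • α fun i => stdVec (s i) := by
  rw [starAlt, ContinuousAlternatingMap.smul_apply, ContinuousAlternatingMap.sum_apply]
  rfl

lemma starAlt_add (g : Vec n →L[ℝ] Vec n →L[ℝ] ℝ) (vol : Vec n [⋀^Fin n]→L[ℝ] ℝ) {p q : ℕ}
    (h : p + q = n) (α β : Vec n [⋀^Fin p]→L[ℝ] W) :
    starAlt g vol h (α + β) = starAlt g vol h α + starAlt g vol h β := by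
  ext w
  simp [starAlt_apply, smul_add, Finset.sum_add_distrib]

lemma starAlt_smul (g : Vec n →L[ℝ] Vec n →L[ℝ] ℝ) (vol : Vec n [⋀^Fin n]→L[ℝ] ℝ) {p q : ℕ}
    (h : p + q = n) (c : ℝ) (α : Vec n [⋀^Fin p]→L[ℝ] W) :
    starAlt g vol h (c • α) = c • starAlt g vol h α := by
  ext w
  simp only [starAlt_apply, ContinuousAlternatingMap.smul_apply, Finset.smul_sum]
  exact Finset.sum_congr rfl fun s _ => by simp only [smul_comm c]

/-- The pairing of `p`-forms induced by a metric and a bilinear map on the values. -/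
def starPairing (g : Vec n →L[ℝ] Vec n →L[ℝ] ℝ) (b : V →L[ℝ] W →L[ℝ] Z) {p : ℕ}
    (α : Vec n [⋀^Fin p]→L[ℝ] V) (β : Vec n [⋀^Fin p]→L[ℝ] W) : Z :=
  ((p.factorial : ℕ) : ℝ)⁻¹ • ∑ s : Fin p → Fin n,
    b (α fun i => dualVec g (s i)) (β fun i => stdVec (s i))

lemma wedgeAlt_sum_right (b : V →L[ℝ] W →L[ℝ] Z) {p q r : ℕ} (h : p + q = r) {ι : Type*}
    (s : Finset ι) (α : Vec n [⋀^Fin p]→L[ℝ] V) (β : ι → Vec n [⋀^Fin q]→L[ℝ] W) :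
    wedgeAlt b h α (∑ i ∈ s, β i) = ∑ i ∈ s, wedgeAlt b h α (β i) := by
  classical
  induction s using Finset.induction_on with
  | empty => simpa using wedgeAlt_zero_right b h α
  | insert i s hi ih => rw [Finset.sum_insert hi, Finset.sum_insert hi, wedgeAlt_add_right, ih]

/-- The star is a sum of contractions of `vol`, so `wedgeAlt_plug` applies term by term. -/
lemma wedgeAlt_starAlt (g : Vec n →L[ℝ] Vec n →L[ℝ] ℝ) (vol : Vec n [⋀^Fin n]→L[ℝ] ℝ)
    (b : V →L[ℝ] W →L[ℝ] Z) {p q : ℕ} (h : p + q = n)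
    (α : Vec n [⋀^Fin p]→L[ℝ] V) (β : Vec n [⋀^Fin p]→L[ℝ] W) :
    wedgeAlt b h α (starAlt g vol h β) = vol.smulRight (starPairing g b α β) := by
  rw [starAlt, wedgeAlt_smul_right, wedgeAlt_sum_right]
  simp_rw [wedgeAlt_plug]
  ext v
  simp only [starPairing, ContinuousAlternatingMap.smul_apply, ContinuousAlternatingMap.sum_apply,
    ContinuousAlternatingMap.smulRight_apply, Finset.smul_sum]
  exact Finset.sum_congr rfl fun s _ => smul_comm _ _ _

lemma gram_transpose {g : Vec n →L[ℝ] Vec n →L[ℝ] ℝ} (hg : ∀ v w, g v w = g w v) :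
    (gram g).transpose = gram g := by
  ext i j
  exact hg _ _

/-- Expanding the dual vectors turns the pairing into a double sum weighted by products of entries
of the inverse Gram matrix. That matrix is symmetric, so the two multi-indices may be interchanged.
-/
lemma starPairing_comm {g : Vec n →L[ℝ] Vec n →L[ℝ] ℝ} (hg : ∀ v w, g v w = g w v)
    {b : V →L[ℝ] V →L[ℝ] Z} (hb : ∀ x y, b x y = b y x) {p : ℕ}
    (α β : Vec n [⋀^Fin p]→L[ℝ] V) : starPairing g b α β = starPairing g b β α := by
  have hG (i j : Fin n) : (gram g)⁻¹ i j = (gram g)⁻¹ j i := by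
    have := Matrix.transpose_nonsing_inv (gram g)
    rw [gram_transpose hg] at this
    exact congrFun (congrFun this j) i
  have h1 (γ δ : Vec n [⋀^Fin p]→L[ℝ] V) : starPairing g b γ δ =
      ((p.factorial : ℕ) : ℝ)⁻¹ • ∑ s : Fin p → Fin n, ∑ t : Fin p → Fin n,
        (∏ k, (gram g)⁻¹ (s k) (t k)) • b (γ fun i => stdVec (t i)) (δ fun i => stdVec (s i)) := by
    rw [starPairing]
    congr 1
    refine Finset.sum_congr rfl fun s _ => ?_
    unfold dualVec
    rw [map_sum_smul γ (fun k j => (gram g)⁻¹ (s k) j), map_sum, sum_apply]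
    exact Finset.sum_congr rfl fun t _ => by rw [map_smul, smul_apply]
  rw [h1, h1]
  congr 1
  rw [Finset.sum_comm]
  refine Finset.sum_congr rfl fun s _ => Finset.sum_congr rfl fun t _ => ?_
  rw [hb]
  congr 1
  exact Finset.prod_congr rfl fun k _ => hG _ _

/-- The matrix of a linear endomorphism of `ℝⁿ` in the standard basis. -/
def stdMatrix (L : Vec n →L[ℝ] Vec n) : Matrix (Fin n) (Fin n) ℝ := Matrix.of fun j i => L (stdVec i) j

lemma apply_stdVec (L : Vec n →L[ℝ] Vec n) (i : Fin n) :
    L (stdVec i) = ∑ j, stdMatrix L j i • stdVec j := (sum_smul_stdVec _).symm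

lemma stdMatrix_mul {L M : Vec n →L[ℝ] Vec n} (h : ∀ v, L (M v) = v) :
    stdMatrix L * stdMatrix M = 1 := by
  ext i j
  have h1 := h (stdVec j)
  rw [apply_stdVec M, map_sum] at h1
  have h2 := congrArg (fun v : Vec n => v i) h1
  simp only [map_smul, stdVec_apply] at h2
  rw [Matrix.mul_apply, Matrix.one_apply, ← h2]
  simp [stdMatrix, mul_comm]

lemma gram_bilinearComp (g : Vec n →L[ℝ] Vec n →L[ℝ] ℝ) (L : Vec n →L[ℝ] Vec n) :
    gram (g.bilinearComp L L) = (stdMatrix L).transpose * gram g * stdMatrix L := by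
  ext i j
  simp only [gram, Matrix.of_apply, ContinuousLinearMap.bilinearComp_apply, Matrix.mul_apply,
    Matrix.transpose_apply]
  rw [apply_stdVec L i, apply_stdVec L j]
  simp only [map_sum, map_smul, sum_apply, smul_apply, smul_eq_mul, Finset.mul_sum, Finset.sum_mul]
  exact Finset.sum_congr rfl fun _ _ => Finset.sum_congr rfl fun _ _ => by ring

/-- Transformation law of the dual basis. If P is the matrix of `L` and S the Gram matrix of `g`,
the pulled-back Gram matrix is PᵀSP, and P(PᵀSP)⁻¹Pᵀ = S⁻¹. -/
lemma sum_dualVec_bilinearComp (g : Vec n →L[ℝ] Vec n →L[ℝ] ℝ) {L M : Vec n →L[ℝ] Vec n}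
    (h : ∀ v, L (M v) = v) (a : Fin n) :
    ∑ i, stdMatrix L a i • L (dualVec (g.bilinearComp L L) i) = dualVec g a := by
  have hu : IsUnit (stdMatrix L).det := by
    have := congrArg Matrix.det (stdMatrix_mul h)
    rw [Matrix.det_mul, Matrix.det_one] at this
    exact IsUnit.of_mul_eq_one _ this
  have hinv : stdMatrix L * (gram (g.bilinearComp L L))⁻¹ * (stdMatrix L).transpose =
      (gram g)⁻¹ := by
    rw [gram_bilinearComp, Matrix.mul_inv_rev, Matrix.mul_inv_rev, ← Matrix.mul_assoc,
      Matrix.mul_nonsing_inv _ hu, Matrix.one_mul, Matrix.mul_assoc, Matrix.nonsing_inv_mul,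
      Matrix.mul_one]
    rwa [Matrix.det_transpose]
  unfold dualVec
  set K := (gram (g.bilinearComp L L))⁻¹ with hK
  rw [← hinv]
  have h1 (i : Fin n) : L (∑ j, K i j • stdVec j) =
      ∑ c, (∑ j, K i j * stdMatrix L c j) • stdVec c := by
    rw [map_sum]
    simp_rw [map_smul]
    calc ∑ j, K i j • L (stdVec j) = ∑ j, ∑ c, (K i j * stdMatrix L c j) • stdVec c :=
          Finset.sum_congr rfl fun j _ => by
            rw [apply_stdVec L j, Finset.smul_sum]
            exact Finset.sum_congr rfl fun c _ => smul_smul _ _ _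
      _ = _ := by
          rw [Finset.sum_comm]
          exact Finset.sum_congr rfl fun c _ => (Finset.sum_smul ..).symm
  calc ∑ i, stdMatrix L a i • L (∑ j, K i j • stdVec j)
      = ∑ i, ∑ c, (stdMatrix L a i * ∑ j, K i j * stdMatrix L c j) • stdVec c :=
        Finset.sum_congr rfl fun i _ => by
          rw [h1, Finset.smul_sum]
          exact Finset.sum_congr rfl fun c _ => smul_smul _ _ _
    _ = _ := by
        rw [Finset.sum_comm]
        refine Finset.sum_congr rfl fun c _ => ?_
        rw [← Finset.sum_smul, Matrix.mul_assoc, Matrix.mul_apply]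
        rfl

/-- Rotating the fixed vectors `w` to the front shows that a contraction is alternating in the
inserted vectors too, up to a constant sign. This allows the multilinear expansion `map_sum_smul` in
those slots. -/
lemma exists_plug_eq {p q : ℕ} (h : p + q = n) (vol : Vec n [⋀^Fin n]→L[ℝ] ℝ) (w : Fin q → Vec n) :
    ∃ f : Vec n [⋀^Fin p]→L[ℝ] ℝ, ∀ u, plug h vol u w = f u := by
  have h' : q + p = n := by omega
  refine ⟨(((Equiv.Perm.sign ((finRotate n) ^ q) : ℤˣ) : ℤ) : ℝ) • plug h' vol w, fun u => ?_⟩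
  have h1 := vol.toAlternatingMap.map_perm (fun i => Fin.append w u (Fin.cast h'.symm i))
    ((finRotate n) ^ q)
  have h2 : (fun i => Fin.append u w (Fin.cast h.symm i)) =
      (fun i => Fin.append w u (Fin.cast h'.symm i)) ∘ ((finRotate n) ^ q) := by
    ext1 k
    obtain ⟨k, rfl⟩ : ∃ k', k = Fin.cast h k' := ⟨Fin.cast h.symm k, by simp⟩
    induction k using Fin.addCases with
    | left i =>
      have : ((finRotate n) ^ q) (Fin.cast h (Fin.castAdd q i)) = Fin.cast h' (Fin.natAdd q i) := by
        ext
        rw [coe_finRotate_pow, Nat.mod_eq_of_lt] <;> simp <;> omega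
      simp [this]
    | right j =>
      have : ((finRotate n) ^ q) (Fin.cast h (Fin.natAdd p j)) = Fin.cast h' (Fin.castAdd p j) := by
        ext
        rw [coe_finRotate_pow, Fin.val_cast, Fin.val_cast, Fin.val_natAdd,
          show p + (j : ℕ) + q = j + n by omega, Nat.add_mod_right, Nat.mod_eq_of_lt]
        · rfl
        · omega
      simp [this]
  rw [plug_apply, h2]
  refine h1.trans ?_
  rw [Units.smul_def, ContinuousAlternatingMap.smul_apply, Int.cast_smul_eq_zsmul]
  rfl

/-- Naturality of the Hodge star under linear isomorphisms. -/
lemma starAlt_comp (g : Vec n →L[ℝ] Vec n →L[ℝ] ℝ) (vol : Vec n [⋀^Fin n]→L[ℝ] ℝ) {p q : ℕ}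
    (h : p + q = n) (α : Vec n [⋀^Fin p]→L[ℝ] W) {L M : Vec n →L[ℝ] Vec n}
    (hL : ∀ v, L (M v) = v) :
    starAlt (g.bilinearComp L L) (vol.compContinuousLinearMap L) h (α.compContinuousLinearMap L) =
      (starAlt g vol h α).compContinuousLinearMap L := by
  ext w
  have h1 (s : Fin p → Fin n) : (α.compContinuousLinearMap L) (fun i => stdVec (s i)) =
      ∑ t : Fin p → Fin n, (∏ k, stdMatrix L (t k) (s k)) • α fun i => stdVec (t i) := by
    rw [← map_sum_smul α (fun k j => stdMatrix L j (s k))]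
    simp_rw [← apply_stdVec]
    rfl
  have h2 (u : Fin p → Vec n) : plug h (vol.compContinuousLinearMap L) u w =
      plug h vol (fun i => L (u i)) (fun j => L (w j)) := by
    simp only [plug_apply, ContinuousAlternatingMap.compContinuousLinearMap_apply]
    refine congrArg vol (funext fun i => ?_)
    simp only [Function.comp_apply]
    generalize Fin.cast h.symm i = i
    induction i using Fin.addCases <;> simp
  rw [ContinuousAlternatingMap.compContinuousLinearMap_apply, starAlt_apply, starAlt_apply]
  simp_rw [h1, h2, Finset.smul_sum]
  rw [Finset.sum_comm]
  refine Finset.sum_congr rfl fun t _ => ?_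
  rw [← Finset.smul_sum]
  congr 1
  simp_rw [smul_smul]
  rw [← Finset.sum_smul]
  congr 1
  obtain ⟨f, hf⟩ := exists_plug_eq h vol fun j => L (w j)
  have h3 := map_sum_smul f (fun k i => stdMatrix L (t k) i)
    (fun i => L (dualVec (g.bilinearComp L L) i))
  simp_rw [sum_dualVec_bilinearComp g hL] at h3
  refine Eq.trans ?_ ((hf _).trans h3).symm
  exact Finset.sum_congr rfl fun s _ => by rw [hf, smul_eq_mul, mul_comm]

lemma det_gram_ne_zero {g : Vec n →L[ℝ] Vec n →L[ℝ] ℝ}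
    (hg : ∀ v, (∀ w, g v w = 0) → v = 0) : (gram g).det ≠ 0 := by
  intro h0
  obtain ⟨c, hc, hc'⟩ := Matrix.exists_vecMul_eq_zero_iff.2 h0
  apply hc
  have h1 : (∑ i, c i • stdVec i : Vec n) = 0 := by
    apply hg
    intro w
    rw [← sum_smul_stdVec w]
    simp only [map_sum, map_smul, sum_apply, smul_apply, smul_eq_mul]
    refine Finset.sum_eq_zero fun j _ => ?_
    have := congrFun hc' j
    simp only [Matrix.vecMul, dotProduct, gram, Matrix.of_apply, Pi.zero_apply] at this
    rw [this, mul_zero]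
  ext i
  have := congrArg (fun v : Vec n => v i) h1
  simpa [stdVec_apply] using this

/-- Nondegeneracy of the exterior product in complementary degrees. -/
lemma eq_zero_of_wedgeAlt_eq_zero {b : V →L[ℝ] W →L[ℝ] Z} (hb : ∀ y, (∀ x, b x y = 0) → y = 0)
    {p q : ℕ} (h : p + q = n) {vol : Vec n [⋀^Fin n]→L[ℝ] ℝ} (hvol : vol stdVec ≠ 0)
    {η : Vec n [⋀^Fin q]→L[ℝ] W} (hη : ∀ α : Vec n [⋀^Fin p]→L[ℝ] V, wedgeAlt b h α η = 0) :
    η = 0 := by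
  ext u
  refine hb _ fun x => ?_
  -- The test form is ι_u vol ⊗ x, whose product with η is, up to sign, b(x, η(u)) vol.
  have h1 := wedgeAlt_comm b b.flip (fun _ _ => rfl) h (by omega : q + p = n)
    ((plug (by omega : q + p = n) vol u).smulRight x) η
  rw [hη, smul_zero, wedgeAlt_plug] at h1
  have h2 : vol stdVec • b.flip (η u) x = 0 := DFunLike.congr_fun h1 stdVec
  exact (smul_eq_zero.1 h2).resolve_left hvol

end Star

/-! ### The derivative of the adjoint action in a local group -/

section LocalGroup

variable {E : Type*} [NormedAddCommGroup E] [NormedSpace ℝ E]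

open Filter Topology in
/-- In a local group with product `f` and conjugation `c (x, y) = x y x⁻¹`, the derivative of the
adjoint action is the commutator of the second derivatives of the product. -/
lemma hasFDerivAt_localAdjoint {f c : E × E → E} {e : E} (hf : ContDiffAt ℝ 2 f (e, e))
    (hc : ContDiffAt ℝ 2 c (e, e)) (hfx : ∀ᶠ x in 𝓝 e, f (x, e) = x)
    (hcx : ∀ᶠ x in 𝓝 e, c (x, e) = e) (hcy : ∀ᶠ y in 𝓝 e, c (e, y) = y)
    (hcf : ∀ᶠ p in 𝓝 (e, e), f (c p, p.1) = f p) (v : E) :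
    ∃ A : E →L[ℝ] E, HasFDerivAt (fun x => fderiv ℝ c (x, e) (0, v)) A e ∧
      ∀ u, A u = fderiv ℝ (fderiv ℝ f) (e, e) (u, 0) (0, v) -
        fderiv ℝ (fderiv ℝ f) (e, e) (v, 0) (0, u) := by
  have hF : DifferentiableAt ℝ (fderiv ℝ f) (e, e) :=
    (hf.fderiv_right (m := 1) (by norm_num)).differentiableAt (by norm_num)
  have hC : DifferentiableAt ℝ (fderiv ℝ c) (e, e) :=
    (hc.fderiv_right (m := 1) (by norm_num)).differentiableAt (by norm_num)
  have hsymm : ∀ a b, fderiv ℝ (fderiv ℝ f) (e, e) a b = fderiv ℝ (fderiv ℝ f) (e, e) b a :=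
    hf.isSymmSndFDerivAt (by simp)
  set F := fderiv ℝ f with hFdef
  set C := fderiv ℝ c with hCdef
  have hce : c (e, e) = e := hcx.self_of_nhds
  have hCv : C (e, e) (0, v) = v := by
    have h1 : HasFDerivAt (fun y => c (e, y)) ((C (e, e)).comp (.inr ℝ E E)) e :=
      (hc.differentiableAt (by norm_num)).hasFDerivAt.comp e (hasFDerivAt_prodMk_right e e)
    have h2 := (h1.congr_of_eventuallyEq (EventuallyEq.symm hcy)).unique (hasFDerivAt_id e)
    exact DFunLike.congr_fun h2 v
  have hFv (w : E) : F (e, e) (w, 0) = w := by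
    have h1 : HasFDerivAt (fun x => f (x, e)) ((F (e, e)).comp (.inl ℝ E E)) e :=
      (hf.differentiableAt (by norm_num)).hasFDerivAt.comp (f := fun x : E => (x, e)) e
        (hasFDerivAt_prodMk_left e e)
    have h2 := (h1.congr_of_eventuallyEq (EventuallyEq.symm hfx)).unique (hasFDerivAt_id e)
    exact DFunLike.congr_fun h2 w
  have hT : Tendsto (fun x : E => (x, e)) (𝓝 e) (𝓝 (e, e)) :=
    (Continuous.prodMk_left e).tendsto e
  have hT' : Tendsto (fun x : E => (e, x)) (𝓝 e) (𝓝 (e, e)) :=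
    (Continuous.prodMk_right e).tendsto e
  have hfd : ∀ᶠ p in 𝓝 (e, e), DifferentiableAt ℝ f p := by
    filter_upwards [hf.eventually (by norm_num)] with p hp using hp.differentiableAt (by norm_num)
  have hcd : ∀ᶠ p in 𝓝 (e, e), DifferentiableAt ℝ c p := by
    filter_upwards [hc.eventually (by norm_num)] with p hp using hp.differentiableAt (by norm_num)
  -- This is (x y x⁻¹) x = x y, differentiated with respect to y at the unit.
  have key : ∀ᶠ x in 𝓝 e, F (e, x) (C (x, e) (0, v), 0) = F (x, e) (0, v) := by
    filter_upwards [hT.eventually hfd, hT'.eventually hfd, hT.eventually hcd, hcx,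
      hT.eventually hcf.eventually_nhds] with x h1 h2 h3 h4 h5
    have h6 : HasFDerivAt (fun y => c (x, y)) ((C (x, e)).comp (.inr ℝ E E)) e :=
      h3.hasFDerivAt.comp e (hasFDerivAt_prodMk_right x e)
    have h2' : HasFDerivAt f (F (e, x)) (c (x, e), x) := by rw [h4]; exact h2.hasFDerivAt
    have h7 : HasFDerivAt (fun y => f (c (x, y), x)) _ e :=
      h2'.comp e (h6.prodMk (hasFDerivAt_const x e))
    have h8 : HasFDerivAt (fun y => f (x, y)) ((F (x, e)).comp (.inr ℝ E E)) e :=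
      h1.hasFDerivAt.comp e (hasFDerivAt_prodMk_right x e)
    have h9 : (fun y => f (c (x, y), x)) =ᶠ[𝓝 e] fun y => f (x, y) :=
      ((Continuous.prodMk_right x).tendsto e).eventually h5
    exact DFunLike.congr_fun (h7.unique (h8.congr_of_eventuallyEq h9)) v
  have ha : HasFDerivAt (fun x => C (x, e) (0, v)) (((ContinuousLinearMap.apply ℝ E ((0 : E), v)).comp
      (fderiv ℝ C (e, e))).comp (.inl ℝ E E)) e :=
    ((ContinuousLinearMap.apply ℝ E ((0 : E), v)).hasFDerivAt.comp (e, e) hC.hasFDerivAt).comp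
      (f := fun x : E => (x, e)) e (hasFDerivAt_prodMk_left e e)
  refine ⟨_, ha, fun u => ?_⟩
  have hl : HasFDerivAt (fun x => F (e, x) (C (x, e) (0, v), (0 : E))) _ e :=
    (hF.hasFDerivAt.comp e (hasFDerivAt_prodMk_right e e)).clm_apply
      (ha.prodMk (hasFDerivAt_const (0 : E) e))
  have hr : HasFDerivAt (fun x => F (x, e) ((0 : E), v)) _ e :=
    (hF.hasFDerivAt.comp (f := fun x : E => (x, e)) e (hasFDerivAt_prodMk_left e e)).clm_apply
      (hasFDerivAt_const ((0 : E), v) e)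
  -- Now differentiate `key` with respect to x at the unit. Since the first partial derivative of
  -- the product there is the identity, A u appears by itself and the equation can be solved for it.
  have h1 := DFunLike.congr_fun (hl.unique (hr.congr_of_eventuallyEq key)) u
  simp [hCv, hFv] at h1
  rw [hsymm (v, 0) (0, u), ← h1]
  simp

open Filter Topology VectorField in
lemma lieBracketWithin_univ_of_eventuallyEq {V W V' W' : E → E} {e : E}
    (hV : V =ᶠ[𝓝 e] V') (hW : W =ᶠ[𝓝 e] W') :
    lieBracketWithin ℝ V W univ e = fderiv ℝ W' e (V' e) - fderiv ℝ V' e (W' e) := by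
  rw [lieBracketWithin_univ, hV.lieBracket_vectorField_eq hW, lieBracket_eq]

end LocalGroup

/-! ### The Lie bracket and Ad in a chart at 1; infinitesimal invariance -/

section LieGroup

open VectorField Filter Topology

variable {𝔤 : Type*} [NormedAddCommGroup 𝔤] [NormedSpace ℝ 𝔤]
  (G : Type*) [Group G] [TopologicalSpace G] [ChartedSpace 𝔤 G]

/-- The product of `G` in the preferred chart at `1`. -/
def chartMul (p : 𝔤 × 𝔤) : 𝔤 :=
  extChartAt 𝓘(ℝ, 𝔤) (1 : G)
    ((extChartAt 𝓘(ℝ, 𝔤) (1 : G)).symm p.1 * (extChartAt 𝓘(ℝ, 𝔤) (1 : G)).symm p.2)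

/-- Conjugation in `G` in the preferred chart at `1`. -/
def chartConj (p : 𝔤 × 𝔤) : 𝔤 :=
  extChartAt 𝓘(ℝ, 𝔤) (1 : G)
    ((extChartAt 𝓘(ℝ, 𝔤) (1 : G)).symm p.1 * (extChartAt 𝓘(ℝ, 𝔤) (1 : G)).symm p.2 *
      ((extChartAt 𝓘(ℝ, 𝔤) (1 : G)).symm p.1)⁻¹)

/-- The unit of `G` in the preferred chart at `1`. -/
def chartOne : 𝔤 := extChartAt 𝓘(ℝ, 𝔤) (1 : G) 1

lemma symm_chartOne : (extChartAt 𝓘(ℝ, 𝔤) (1 : G)).symm (chartOne G : 𝔤) = 1 :=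
  extChartAt_to_inv 1

lemma eventually_chart_mem : ∀ᶠ x in 𝓝 (chartOne G : 𝔤), x ∈ (extChartAt 𝓘(ℝ, 𝔤) (1 : G)).target :=
  extChartAt_target_mem_nhds 1

variable [LieGroup 𝓘(ℝ, 𝔤) (minSmoothness ℝ 3) G]

include 𝔤 in
lemma isManifold_lieGroup : IsManifold 𝓘(ℝ, 𝔤) 3 G := by
  have : IsManifold 𝓘(ℝ, 𝔤) (minSmoothness ℝ 3) G := inferInstance
  simpa using this

lemma contMDiffAt_chart_symm :
    ContMDiffAt 𝓘(ℝ, 𝔤) 𝓘(ℝ, 𝔤) 3 (extChartAt 𝓘(ℝ, 𝔤) (1 : G)).symm (chartOne G : 𝔤) := by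
  have := isManifold_lieGroup (𝔤 := 𝔤) G
  exact (contMDiffOn_extChartAt_symm (1 : G)).contMDiffAt (extChartAt_target_mem_nhds 1)

lemma lieGroup_three : LieGroup 𝓘(ℝ, 𝔤) 3 G := by
  have : LieGroup 𝓘(ℝ, 𝔤) (minSmoothness ℝ 3) G := inferInstance
  simpa using this

lemma contDiffAt_chartMul : ContDiffAt ℝ 3 (chartMul (𝔤 := 𝔤) G) (chartOne G, chartOne G) := by
  have := lieGroup_three (𝔤 := 𝔤) G
  rw [← contMDiffAt_iff_contDiffAt]
  have h1 : ContMDiffAt 𝓘(ℝ, 𝔤 × 𝔤) 𝓘(ℝ, 𝔤) 3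
      (fun p : 𝔤 × 𝔤 => (extChartAt 𝓘(ℝ, 𝔤) (1 : G)).symm p.1) (chartOne G, chartOne G) :=
    ContMDiffAt.comp (x := ((chartOne G : 𝔤), (chartOne G : 𝔤)))
      (contMDiffAt_chart_symm G) contDiffAt_fst.contMDiffAt
  have h2 : ContMDiffAt 𝓘(ℝ, 𝔤 × 𝔤) 𝓘(ℝ, 𝔤) 3
      (fun p : 𝔤 × 𝔤 => (extChartAt 𝓘(ℝ, 𝔤) (1 : G)).symm p.2) (chartOne G, chartOne G) :=
    ContMDiffAt.comp (x := ((chartOne G : 𝔤), (chartOne G : 𝔤)))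
      (contMDiffAt_chart_symm G) contDiffAt_snd.contMDiffAt
  refine ContMDiffAt.comp_of_eq (y := (1 : G)) contMDiffAt_extChartAt (h1.mul h2) ?_
  simp only [symm_chartOne, mul_one]

lemma contDiffAt_chartConj : ContDiffAt ℝ 3 (chartConj (𝔤 := 𝔤) G) (chartOne G, chartOne G) := by
  have := lieGroup_three (𝔤 := 𝔤) G
  rw [← contMDiffAt_iff_contDiffAt]
  have h1 : ContMDiffAt 𝓘(ℝ, 𝔤 × 𝔤) 𝓘(ℝ, 𝔤) 3
      (fun p : 𝔤 × 𝔤 => (extChartAt 𝓘(ℝ, 𝔤) (1 : G)).symm p.1) (chartOne G, chartOne G) :=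
    ContMDiffAt.comp (x := ((chartOne G : 𝔤), (chartOne G : 𝔤)))
      (contMDiffAt_chart_symm G) contDiffAt_fst.contMDiffAt
  have h2 : ContMDiffAt 𝓘(ℝ, 𝔤 × 𝔤) 𝓘(ℝ, 𝔤) 3
      (fun p : 𝔤 × 𝔤 => (extChartAt 𝓘(ℝ, 𝔤) (1 : G)).symm p.2) (chartOne G, chartOne G) :=
    ContMDiffAt.comp (x := ((chartOne G : 𝔤), (chartOne G : 𝔤)))
      (contMDiffAt_chart_symm G) contDiffAt_snd.contMDiffAt
  refine ContMDiffAt.comp_of_eq (y := (1 : G)) contMDiffAt_extChartAt ((h1.mul h2).mul h1.inv) ?_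
  simp only [symm_chartOne, mul_one, inv_one]

lemma hasMFDerivAt_chart_symm :
    HasMFDerivAt 𝓘(ℝ, 𝔤) 𝓘(ℝ, 𝔤) (extChartAt 𝓘(ℝ, 𝔤) (1 : G)).symm (chartOne G : 𝔤)
      (ContinuousLinearMap.id ℝ 𝔤) := by
  have h3 := isManifold_lieGroup (𝔤 := 𝔤) G
  have : IsManifold 𝓘(ℝ, 𝔤) 1 G := IsManifold.of_le (n := 3) (by norm_num)
  have h1 := ((contMDiffAt_chart_symm (𝔤 := 𝔤) G).mdifferentiableAt (by norm_num)).hasMFDerivAt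
  have h2 := mfderivWithin_range_extChartAt_symm (I := 𝓘(ℝ, 𝔤)) (x := (1 : G))
  simp only [modelWithCornersSelf_coe, range_id, mfderivWithin_univ] at h2
  rw [chartOne] at h1 ⊢
  rw [h2] at h1
  exact h1

/-- Conjugation fixes 1, and the derivative of the preferred chart at 1 is the identity, so passing
to the chart does not alter the derivative that defines Ad. -/
lemma Ad_symm {x : 𝔤} (v : 𝔤) (hx : DifferentiableAt ℝ (chartConj G) (x, (chartOne G : 𝔤))) :
    Ad 𝔤 ((extChartAt 𝓘(ℝ, 𝔤) (1 : G)).symm x) v = fderiv ℝ (chartConj G) (x, chartOne G) (0, v) := by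
  have h3 := lieGroup_three (𝔤 := 𝔤) G
  have h3' := isManifold_lieGroup (𝔤 := 𝔤) G
  have : IsManifold 𝓘(ℝ, 𝔤) 1 G := IsManifold.of_le (n := 3) (by norm_num)
  set g := (extChartAt 𝓘(ℝ, 𝔤) (1 : G)).symm x with hg
  have hconj : g * 1 * g⁻¹ = 1 := by simp
  have h1 : HasMFDerivAt 𝓘(ℝ, 𝔤) 𝓘(ℝ, 𝔤) (fun y : G => g * y * g⁻¹) 1 (Ad 𝔤 g) := by
    have : ContMDiff 𝓘(ℝ, 𝔤) 𝓘(ℝ, 𝔤) 3 (fun y : G => g * y * g⁻¹) :=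
      (contMDiff_const.mul contMDiff_id).mul contMDiff_const
    exact (this.mdifferentiableAt (by norm_num)).hasMFDerivAt
  have h2 : HasMFDerivAt 𝓘(ℝ, 𝔤) 𝓘(ℝ, 𝔤) (extChartAt 𝓘(ℝ, 𝔤) (1 : G)) (g * 1 * g⁻¹)
      (ContinuousLinearMap.id ℝ 𝔤) := by
    rw [hconj]
    have := (mdifferentiableAt_extChartAt (I := 𝓘(ℝ, 𝔤)) (mem_chart_source 𝔤 (1 : G))).hasMFDerivAt
    rw [mfderiv_extChartAt_self] at this
    exact this
  have h4 : HasMFDerivAt 𝓘(ℝ, 𝔤) 𝓘(ℝ, 𝔤) (fun y : G => g * y * g⁻¹)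
      ((extChartAt 𝓘(ℝ, 𝔤) (1 : G)).symm (chartOne G : 𝔤)) (Ad 𝔤 g) := by
    rw [symm_chartOne]; exact h1
  have h2' : HasMFDerivAt 𝓘(ℝ, 𝔤) 𝓘(ℝ, 𝔤) (extChartAt 𝓘(ℝ, 𝔤) (1 : G))
      (g * (extChartAt 𝓘(ℝ, 𝔤) (1 : G)).symm (chartOne G : 𝔤) * g⁻¹)
      (ContinuousLinearMap.id ℝ 𝔤) := by
    rw [symm_chartOne]; exact h2
  have h5 := h2'.comp (chartOne G : 𝔤) (h4.comp (chartOne G : 𝔤) (hasMFDerivAt_chart_symm G))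
  have h6 : HasFDerivAt (fun y => chartConj G (x, y)) (Ad 𝔤 g) (chartOne G : 𝔤) := h5.hasFDerivAt
  have h7 : HasFDerivAt (fun y => chartConj G (x, y)) ((fderiv ℝ (chartConj G) (x, chartOne G)).comp
      (.inr ℝ 𝔤 𝔤)) (chartOne G : 𝔤) :=
    hx.hasFDerivAt.comp _ (hasFDerivAt_prodMk_right _ _)
  exact DFunLike.congr_fun (h6.unique h7) v

/-- The invariant field at g is the derivative of left multiplication by g applied to v. The
pull-back applies the inverse of the derivative of the inverse chart, which is the derivative of the
chart itself; the chain rule combines the two. -/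
lemma mpullback_mulInvariantVectorField_chart {x : 𝔤} (v : 𝔤)
    (hxt : x ∈ (extChartAt 𝓘(ℝ, 𝔤) (1 : G)).target)
    (hx : DifferentiableAt ℝ (chartMul G) (x, (chartOne G : 𝔤))) :
    mpullbackWithin 𝓘(ℝ, 𝔤) 𝓘(ℝ, 𝔤) (extChartAt 𝓘(ℝ, 𝔤) (1 : G)).symm
      (mulInvariantVectorField (v : GroupLieAlgebra 𝓘(ℝ, 𝔤) G)) (range 𝓘(ℝ, 𝔤)) x =
      fderiv ℝ (chartMul G) (x, chartOne G) ((0 : 𝔤), v) := by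
  have h3 := lieGroup_three (𝔤 := 𝔤) G
  have h3' := isManifold_lieGroup (𝔤 := 𝔤) G
  have : IsManifold 𝓘(ℝ, 𝔤) 1 G := IsManifold.of_le (n := 3) (by norm_num)
  set g := (extChartAt 𝓘(ℝ, 𝔤) (1 : G)).symm x with hg
  have hgs : g ∈ (chartAt 𝔤 (1 : G)).source := by
    rw [← extChartAt_source 𝓘(ℝ, 𝔤)]
    exact (extChartAt 𝓘(ℝ, 𝔤) (1 : G)).map_target hxt
  have h1 : HasMFDerivAt 𝓘(ℝ, 𝔤) 𝓘(ℝ, 𝔤) (fun y : G => g * y)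
      ((extChartAt 𝓘(ℝ, 𝔤) (1 : G)).symm (chartOne G : 𝔤))
      (mfderiv 𝓘(ℝ, 𝔤) 𝓘(ℝ, 𝔤) (fun y : G => g * y) 1 : 𝔤 →L[ℝ] 𝔤) := by
    rw [symm_chartOne]
    have : ContMDiff 𝓘(ℝ, 𝔤) 𝓘(ℝ, 𝔤) 3 (fun y : G => g * y) := contMDiff_const.mul contMDiff_id
    exact (this.mdifferentiableAt (by norm_num)).hasMFDerivAt
  have h2 : HasMFDerivAt 𝓘(ℝ, 𝔤) 𝓘(ℝ, 𝔤) (extChartAt 𝓘(ℝ, 𝔤) (1 : G))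
      (g * (extChartAt 𝓘(ℝ, 𝔤) (1 : G)).symm (chartOne G : 𝔤))
      (mfderiv 𝓘(ℝ, 𝔤) 𝓘(ℝ, 𝔤) (extChartAt 𝓘(ℝ, 𝔤) (1 : G)) g : 𝔤 →L[ℝ] 𝔤) := by
    rw [symm_chartOne, mul_one]
    exact (mdifferentiableAt_extChartAt hgs).hasMFDerivAt
  have h5 := h2.comp (chartOne G : 𝔤) (h1.comp (chartOne G : 𝔤) (hasMFDerivAt_chart_symm G))
  let P : 𝔤 →L[ℝ] 𝔤 := mfderiv 𝓘(ℝ, 𝔤) 𝓘(ℝ, 𝔤) (extChartAt 𝓘(ℝ, 𝔤) (1 : G)) g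
  let Q : 𝔤 →L[ℝ] 𝔤 := mfderiv 𝓘(ℝ, 𝔤) 𝓘(ℝ, 𝔤) (fun y : G => g * y) 1
  have h6 : HasFDerivAt (fun y => chartMul G (x, y)) (P.comp Q) (chartOne G : 𝔤) := h5.hasFDerivAt
  have h7 : HasFDerivAt (fun y => chartMul G (x, y)) ((fderiv ℝ (chartMul G) (x, chartOne G)).comp
      (.inr ℝ 𝔤 𝔤)) (chartOne G : 𝔤) :=
    hx.hasFDerivAt.comp _ (hasFDerivAt_prodMk_right _ _)
  have h8 : P (Q v) = fderiv ℝ (chartMul G) (x, chartOne G) ((0 : 𝔤), v) :=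
    DFunLike.congr_fun (h6.unique h7) v
  rw [mpullbackWithin_apply, ContinuousLinearMap.inverse_eq
    (mfderivWithin_extChartAt_symm_comp_mfderiv_extChartAt hxt)
    (mfderiv_extChartAt_comp_mfderivWithin_extChartAt_symm hxt)]
  exact h8

/-- In the chart an invariant field is x ↦ ∂₂m(x, e)v for the local product m, with value v at e.
The bracket of two such fields is the antisymmetrized mixed second derivative of m, the same
expression as in `hasFDerivAt_localAdjoint`. -/
lemma bracket_eq_fderiv_chartMul (v w : 𝔤) :
    (Bracket.bracket (L := GroupLieAlgebra 𝓘(ℝ, 𝔤) G) (M := GroupLieAlgebra 𝓘(ℝ, 𝔤) G) v w : 𝔤) =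
      fderiv ℝ (fderiv ℝ (chartMul G)) (chartOne G, chartOne G) (v, 0) (0, w) -
      fderiv ℝ (fderiv ℝ (chartMul G)) (chartOne G, chartOne G) (w, 0) (0, v) := by
  have h3' := isManifold_lieGroup (𝔤 := 𝔤) G
  have : IsManifold 𝓘(ℝ, 𝔤) 1 G := IsManifold.of_le (n := 3) (by norm_num)
  have hm := contDiffAt_chartMul (𝔤 := 𝔤) G
  have hF : DifferentiableAt ℝ (fderiv ℝ (chartMul (𝔤 := 𝔤) G)) (chartOne G, chartOne G) :=
    (hm.fderiv_right (m := 2) (by norm_num)).differentiableAt (by norm_num)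
  have hT : Tendsto (fun x : 𝔤 => (x, (chartOne G : 𝔤))) (𝓝 (chartOne G)) (𝓝 (chartOne G, chartOne G)) :=
    (Continuous.prodMk_left _).tendsto _
  have hmd : ∀ᶠ p in 𝓝 ((chartOne G : 𝔤), (chartOne G : 𝔤)), DifferentiableAt ℝ (chartMul G) p := by
    filter_upwards [hm.eventually (by norm_num)] with p hp using hp.differentiableAt (by norm_num)
  have hev (v : 𝔤) : mpullbackWithin 𝓘(ℝ, 𝔤) 𝓘(ℝ, 𝔤) (extChartAt 𝓘(ℝ, 𝔤) (1 : G)).symm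
      (mulInvariantVectorField (v : GroupLieAlgebra 𝓘(ℝ, 𝔤) G)) (range 𝓘(ℝ, 𝔤))
      =ᶠ[𝓝 (chartOne G : 𝔤)] fun x => fderiv ℝ (chartMul G) (x, chartOne G) ((0 : 𝔤), v) := by
    filter_upwards [eventually_chart_mem G, hT.eventually hmd] with x h1 h2
    exact mpullback_mulInvariantVectorField_chart G v h1 h2
  have hd (v : 𝔤) : HasFDerivAt (fun x => fderiv ℝ (chartMul G) (x, chartOne G) ((0 : 𝔤), v))
      (((ContinuousLinearMap.apply ℝ 𝔤 ((0 : 𝔤), v)).comp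
      (fderiv ℝ (fderiv ℝ (chartMul G)) (chartOne G, chartOne G))).comp (.inl ℝ 𝔤 𝔤))
      (chartOne G : 𝔤) :=
    ((ContinuousLinearMap.apply ℝ 𝔤 ((0 : 𝔤), v)).hasFDerivAt.comp (chartOne G, chartOne G)
      hF.hasFDerivAt).comp (f := fun x : 𝔤 => (x, (chartOne G : 𝔤))) _ (hasFDerivAt_prodMk_left _ _)
  have hval (v : 𝔤) : fderiv ℝ (chartMul G) (chartOne G, chartOne G) ((0 : 𝔤), v) = v := by
    have h1 : HasFDerivAt (fun y => chartMul G (chartOne G, y))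
        ((fderiv ℝ (chartMul G) (chartOne G, chartOne G)).comp (.inr ℝ 𝔤 𝔤)) (chartOne G : 𝔤) :=
      (hm.differentiableAt (by norm_num)).hasFDerivAt.comp _ (hasFDerivAt_prodMk_right _ _)
    have h2 : (fun y => chartMul G (chartOne G, y)) =ᶠ[𝓝 (chartOne G : 𝔤)] id := by
      filter_upwards [eventually_chart_mem G] with y hy
      simp only [chartMul, symm_chartOne, one_mul, id]
      exact (extChartAt 𝓘(ℝ, 𝔤) (1 : G)).right_inv hy
    exact DFunLike.congr_fun ((h1.congr_of_eventuallyEq h2.symm).unique (hasFDerivAt_id _)) v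
  change mlieBracket 𝓘(ℝ, 𝔤) (mulInvariantVectorField (v : GroupLieAlgebra 𝓘(ℝ, 𝔤) G))
    (mulInvariantVectorField (w : GroupLieAlgebra 𝓘(ℝ, 𝔤) G)) (1 : G) = _
  rw [← mlieBracketWithin_univ, mlieBracketWithin_apply, mfderiv_extChartAt_self]
  change (ContinuousLinearMap.id ℝ 𝔤).inverse (lieBracketWithin ℝ _ _ _ (chartOne G : 𝔤)) = _
  rw [ContinuousLinearMap.inverse_id, ContinuousLinearMap.id_apply, preimage_univ, univ_inter]
  simp only [modelWithCornersSelf_coe, range_id]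
  have hv := hev v
  have hw := hev w
  simp only [modelWithCornersSelf_coe, range_id] at hv hw
  refine (lieBracketWithin_univ_of_eventuallyEq hv hw).trans ?_
  simp only [(hd v).fderiv, (hd w).fderiv, hval]
  simp

variable {G}

variable (𝔤 G) in
lemma lieBracket_skew [FiniteDimensional ℝ 𝔤] (X Y : 𝔤) :
    lieBracket 𝔤 G Y X = -lieBracket 𝔤 G X Y := by
  have : CompleteSpace 𝔤 := FiniteDimensional.complete ℝ 𝔤
  have hbr (v w : 𝔤) : lieBracket 𝔤 G v w =
      fderiv ℝ (fderiv ℝ (chartMul G)) (chartOne G, chartOne G) (v, 0) (0, w) -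
      fderiv ℝ (fderiv ℝ (chartMul G)) (chartOne G, chartOne G) (w, 0) (0, v) :=
    bracket_eq_fderiv_chartMul G v w
  rw [hbr, hbr, neg_sub]

/-- Infinitesimal invariance of an invariant form on the Lie algebra. -/
lemma IsInvariantForm.lieBracket_left [FiniteDimensional ℝ 𝔤] {𝕜 : Type*} [RCLike 𝕜]
    {B : 𝔤 →L[ℝ] 𝔤 →L[ℝ] 𝕜} (hB : IsInvariantForm 𝔤 G B) (X Y Z : 𝔤) :
    B (lieBracket 𝔤 G X Y) Z = B X (lieBracket 𝔤 G Y Z) := by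
  have : CompleteSpace 𝔤 := FiniteDimensional.complete ℝ 𝔤
  have hm := contDiffAt_chartMul (𝔤 := 𝔤) G
  have hc := contDiffAt_chartConj (𝔤 := 𝔤) G
  have h23 : (2 : WithTop ℕ∞) ≤ 3 := by norm_num
  have hT : Tendsto (fun x : 𝔤 => (x, (chartOne G : 𝔤))) (𝓝 (chartOne G)) (𝓝 (chartOne G, chartOne G)) :=
    (Continuous.prodMk_left _).tendsto _
  have hcd : ∀ᶠ p in 𝓝 ((chartOne G : 𝔤), (chartOne G : 𝔤)), DifferentiableAt ℝ (chartConj G) p := by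
    filter_upwards [hc.eventually (by norm_num)] with p hp using hp.differentiableAt (by norm_num)
  have hbr (v w : 𝔤) : lieBracket 𝔤 G v w =
      fderiv ℝ (fderiv ℝ (chartMul G)) (chartOne G, chartOne G) (v, 0) (0, w) -
      fderiv ℝ (fderiv ℝ (chartMul G)) (chartOne G, chartOne G) (w, 0) (0, v) :=
    bracket_eq_fderiv_chartMul G v w
  have had := hasFDerivAt_localAdjoint (hm.of_le h23) (hc.of_le h23) (by
      filter_upwards [eventually_chart_mem G] with y hy
      simp only [chartMul, symm_chartOne, mul_one]
      exact (extChartAt 𝓘(ℝ, 𝔤) (1 : G)).right_inv hy) (by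
      filter_upwards with y
      simp only [chartConj, symm_chartOne, mul_one, mul_inv_cancel]
      rfl) (by
      filter_upwards [eventually_chart_mem G] with y hy
      simp only [chartConj, symm_chartOne, one_mul, inv_one, mul_one]
      exact (extChartAt 𝓘(ℝ, 𝔤) (1 : G)).right_inv hy) (by
      have hcont : ContinuousAt (fun p : 𝔤 × 𝔤 => (extChartAt 𝓘(ℝ, 𝔤) (1 : G)).symm p.1 *
          (extChartAt 𝓘(ℝ, 𝔤) (1 : G)).symm p.2 * ((extChartAt 𝓘(ℝ, 𝔤) (1 : G)).symm p.1)⁻¹)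
          (chartOne G, chartOne G) := by
        have := lieGroup_three (𝔤 := 𝔤) G
        have := topologicalGroup_of_lieGroup 𝓘(ℝ, 𝔤) 3 (G := G)
        have h0 := (contMDiffAt_chart_symm (𝔤 := 𝔤) G).continuousAt
        have h1 : ContinuousAt (fun p : 𝔤 × 𝔤 => (extChartAt 𝓘(ℝ, 𝔤) (1 : G)).symm p.1)
          (chartOne G, chartOne G) := ContinuousAt.comp (x := ((chartOne G : 𝔤), (chartOne G : 𝔤))) h0 continuousAt_fst
        have h2 : ContinuousAt (fun p : 𝔤 × 𝔤 => (extChartAt 𝓘(ℝ, 𝔤) (1 : G)).symm p.2)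
          (chartOne G, chartOne G) := ContinuousAt.comp (x := ((chartOne G : 𝔤), (chartOne G : 𝔤))) h0 continuousAt_snd
        exact (h1.mul h2).mul h1.inv
      have hs := hcont.eventually_mem (s := (extChartAt 𝓘(ℝ, 𝔤) (1 : G)).source) (by
        simp only [symm_chartOne, mul_one, inv_one]
        exact extChartAt_source_mem_nhds 1)
      filter_upwards [hs] with p hp
      simp only [chartMul, chartConj]
      rw [(extChartAt 𝓘(ℝ, 𝔤) (1 : G)).left_inv hp, inv_mul_cancel_right])
  -- Differentiate at the unit, in the direction u, the locally constant function x ↦ B(Ad_x v, Ad_x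
  -- w).
  have key (v w u : 𝔤) : B (lieBracket 𝔤 G u v) w + B v (lieBracket 𝔤 G u w) = 0 := by
    obtain ⟨A, hA, hA'⟩ := had v
    obtain ⟨A₂, hA₂, hA₂'⟩ := had w
    have hval (v : 𝔤) : fderiv ℝ (chartConj G) (chartOne G, chartOne G) ((0 : 𝔤), v) = v := by
      rw [← Ad_symm G v hcd.self_of_nhds, symm_chartOne]
      have : (fun x : G => 1 * x * 1⁻¹) = id := by ext; simp
      rw [Ad, this, mfderiv_id]
      rfl
    have h1 := ContinuousLinearMap.hasFDerivAt_of_bilinear B hA hA₂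
    have h2 : (fun x => B (fderiv ℝ (chartConj G) (x, chartOne G) ((0 : 𝔤), v))
        (fderiv ℝ (chartConj G) (x, chartOne G) ((0 : 𝔤), w))) =ᶠ[𝓝 (chartOne G)]
        fun _ => B v w := by
      filter_upwards [hT.eventually hcd] with x hx
      rw [← Ad_symm G v hx, ← Ad_symm G w hx, hB.invariant]
    have h3 := DFunLike.congr_fun (h1.unique ((hasFDerivAt_const _ _).congr_of_eventuallyEq h2)) u
    have h4 : B (fderiv ℝ (chartConj G) (chartOne G, chartOne G) ((0 : 𝔤), v)) (A₂ u) +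
        B (A u) (fderiv ℝ (chartConj G) (chartOne G, chartOne G) ((0 : 𝔤), w)) = 0 := h3
    rwa [hval, hval, hA', hA₂', ← hbr, ← hbr, add_comm] at h4
  have := key X Z Y
  rw [lieBracket_skew 𝔤 G Y X, map_neg, neg_apply]
  linear_combination -this

end LieGroup

/-! ### Smoothness of families of alternating maps -/

section Smoothness

variable {n : ℕ} {W : Type*} [NormedAddCommGroup W] [NormedSpace ℝ W]
  {E : Type*} [NormedAddCommGroup E] [NormedSpace ℝ E]

/-- The components of an alternating map in the standard basis. -/
def evalStd (n q : ℕ) (W : Type*) [NormedAddCommGroup W] [NormedSpace ℝ W] :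
    (Vec n [⋀^Fin q]→L[ℝ] W) →ₗ[ℝ] ((Fin q → Fin n) → W) where
  toFun f s := f fun i => stdVec (s i)
  map_add' _ _ := rfl
  map_smul' _ _ := rfl

lemma evalStd_injective (q : ℕ) : Function.Injective (evalStd n q W) := by
  intro f g h
  ext v
  have hv (f : Vec n [⋀^Fin q]→L[ℝ] W) : f v =
      ∑ t : Fin q → Fin n, (∏ k, (v k) (t k)) • evalStd n q W f t := by
    conv_lhs => rw [show v = fun k => ∑ j, (v k) j • stdVec j from
      funext fun k => (sum_smul_stdVec _).symm]
    exact map_sum_smul f (fun k => v k) stdVec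
  rw [hv f, hv g, h]

instance finiteDimensional_alternating [FiniteDimensional ℝ W] (q : ℕ) :
    FiniteDimensional ℝ (Vec n [⋀^Fin q]→L[ℝ] W) :=
  FiniteDimensional.of_injective (evalStd n q W) (evalStd_injective q)

lemma contDiffOn_apply {q : ℕ} {f : E → Vec n [⋀^Fin q]→L[ℝ] W} {s : Set E} {N : WithTop ℕ∞}
    (hf : ContDiffOn ℝ N f s) (v : Fin q → Vec n) : ContDiffOn ℝ N (fun y => f y v) s :=
  (ContinuousAlternatingMap.apply ℝ (Vec n) W v).contDiff.comp_contDiffOn hf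

/-- The components in the standard basis determine an alternating map through a linear injection of
finite-dimensional spaces. Such a map has a linear, hence continuous, left inverse. -/
lemma contDiffOn_of_apply [FiniteDimensional ℝ W] {q : ℕ} {f : E → Vec n [⋀^Fin q]→L[ℝ] W}
    {s : Set E} {N : WithTop ℕ∞}
    (hf : ∀ v : Fin q → Fin n, ContDiffOn ℝ N (fun y => f y fun i => stdVec (v i)) s) :
    ContDiffOn ℝ N f s := by
  obtain ⟨L, hL⟩ := (evalStd n q W).exists_leftInverse_of_injective
    (LinearMap.ker_eq_bot.2 (evalStd_injective q))
  have h1 : f = fun y => (LinearMap.toContinuousLinearMap L) (evalStd n q W (f y)) := by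
    ext1 y
    exact (LinearMap.congr_fun hL (f y)).symm
  rw [h1]
  refine (LinearMap.toContinuousLinearMap L).contDiff.comp_contDiffOn ?_
  exact contDiffOn_pi.2 fun t => hf t

/-- The exterior product as a continuous bilinear map. -/
def wedgeCLM {V Z : Type*} [NormedAddCommGroup V] [NormedSpace ℝ V] [NormedAddCommGroup Z]
    [NormedSpace ℝ Z] [FiniteDimensional ℝ V] [FiniteDimensional ℝ W]
    (b : V →L[ℝ] W →L[ℝ] Z) {p q r : ℕ} (h : p + q = r) :
    (Vec n [⋀^Fin p]→L[ℝ] V) →L[ℝ] (Vec n [⋀^Fin q]→L[ℝ] W) →L[ℝ] (Vec n [⋀^Fin r]→L[ℝ] Z) :=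
  LinearMap.toContinuousBilinearMap (LinearMap.mk₂ ℝ (wedgeAlt b h)
    (wedgeAlt_add_left b h) (fun c α β => wedgeAlt_smul_left b h c α β) (wedgeAlt_add_right b h)
    (fun c α β => wedgeAlt_smul_right b h c α β))

lemma wedgeCLM_apply {V Z : Type*} [NormedAddCommGroup V] [NormedSpace ℝ V] [NormedAddCommGroup Z]
    [NormedSpace ℝ Z] [FiniteDimensional ℝ V] [FiniteDimensional ℝ W]
    (b : V →L[ℝ] W →L[ℝ] Z) {p q r : ℕ} (h : p + q = r) (α : Vec n [⋀^Fin p]→L[ℝ] V)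
    (β : Vec n [⋀^Fin q]→L[ℝ] W) : wedgeCLM b h α β = wedgeAlt b h α β := rfl

end Smoothness

/-! ### Coordinate expressions, change of charts and the exterior derivative -/

section Charts

variable {n : ℕ} {H : Type*} [TopologicalSpace H] {I : ModelWithCorners ℝ (Vec n) H}
  {M : Type*} [TopologicalSpace M] [ChartedSpace H M] [IsManifold I ∞ M]
  {V : Type*} [NormedAddCommGroup V] [NormedSpace ℝ V]
  {W : Type*} [NormedAddCommGroup W] [NormedSpace ℝ W]
  {Z : Type*} [NormedAddCommGroup Z] [NormedSpace ℝ Z]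

variable (I) in
lemma isManifold_one (M : Type*) [TopologicalSpace M] [ChartedSpace H M] [IsManifold I ∞ M] :
    IsManifold I 1 M := IsManifold.of_le (n := ∞) (by exact_mod_cast le_top)

variable (I) in
/-- The derivative at `z` of the change of coordinates from the chart at `x` to the chart at `y`. -/
def transition (x y z : M) : Vec n →L[ℝ] Vec n :=
  haveI := isManifold_one I M
  tangentCoordChange I x y z

lemma chartFrame_eq (x₀ z : M) : chartFrame I x₀ z = transition I x₀ z z := rfl

lemma transition_self {x z : M} (h : z ∈ (extChartAt I x).source) (v : Vec n) :
    transition I x x z v = v :=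
  haveI := isManifold_one I M
  tangentCoordChange_self h

lemma transition_comp {w x y z : M} (hw : z ∈ (extChartAt I w).source)
    (hx : z ∈ (extChartAt I x).source) (hy : z ∈ (extChartAt I y).source) (v : Vec n) :
    transition I x y z (transition I w x z v) = transition I w y z v :=
  haveI := isManifold_one I M
  tangentCoordChange_comp ⟨⟨hw, hx⟩, hy⟩

lemma chartFrame_transition {x₀ z : M} (h : z ∈ (extChartAt I x₀).source) (v : Vec n) :
    chartFrame I x₀ z (transition I z x₀ z v) = v := by
  rw [chartFrame_eq, transition_comp (mem_extChartAt_source z) h (mem_extChartAt_source z),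
    transition_self (mem_extChartAt_source z)]

lemma transition_chartFrame {x₀ z : M} (h : z ∈ (extChartAt I x₀).source) (v : Vec n) :
    transition I z x₀ z (chartFrame I x₀ z v) = v := by
  rw [chartFrame_eq, transition_comp h (mem_extChartAt_source z) h, transition_self h]

lemma transition_eq_fderivWithin (x y z : M) : transition I x y z =
    fderivWithin ℝ (extChartAt I y ∘ (extChartAt I x).symm) (range I) (extChartAt I x z) := rfl

/-- Both sides evaluate θ at z; the cocycle rule for changes of coordinates matches the arguments.
-/
lemma comp_transition_eq {q : ℕ} (θ : M → Vec n [⋀^Fin q]→L[ℝ] W) {x₀ x₁ z : M}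
    (h₀ : z ∈ (extChartAt I x₀).source) (h₁ : z ∈ (extChartAt I x₁).source) :
    inChart I θ x₀ (extChartAt I x₀ z) =
      (inChart I θ x₁ (extChartAt I x₁ z)).compContinuousLinearMap (transition I x₀ x₁ z) := by
  ext v
  simp only [inChart, ContinuousAlternatingMap.compContinuousLinearMap_apply,
    (extChartAt I x₀).left_inv h₀, (extChartAt I x₁).left_inv h₁]
  congr 1
  ext1 i
  simp only [Function.comp_apply, chartFrame_eq]
  rw [transition_comp h₀ h₁ (mem_extChartAt_source z)]

lemma inChart_self {q : ℕ} (θ : M → Vec n [⋀^Fin q]→L[ℝ] W) (x : M) :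
    inChart I θ x (extChartAt I x x) = θ x := by
  ext v
  simp only [inChart, ContinuousAlternatingMap.compContinuousLinearMap_apply,
    extChartAt_to_inv, chartFrame_eq]
  congr 1
  ext1 i
  exact transition_self (mem_extChartAt_source x) _

lemma eq_inChart_comp {q : ℕ} (θ : M → Vec n [⋀^Fin q]→L[ℝ] W) {x₀ z : M}
    (h : z ∈ (extChartAt I x₀).source) :
    θ z = (inChart I θ x₀ (extChartAt I x₀ z)).compContinuousLinearMap (transition I z x₀ z) := by
  rw [← comp_transition_eq θ (mem_extChartAt_source z) h, inChart_self]

lemma inChart_eq_zero_iff {q : ℕ} (θ : M → Vec n [⋀^Fin q]→L[ℝ] W) {x₀ z : M}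
    (h : z ∈ (extChartAt I x₀).source) : inChart I θ x₀ (extChartAt I x₀ z) = 0 ↔ θ z = 0 := by
  constructor
  · intro h0
    rw [eq_inChart_comp θ h, h0]
    rfl
  · intro h0
    rw [inChart, (extChartAt I x₀).left_inv h, h0]
    rfl

variable (I) in
/-- Smoothness of a field of alternating maps of a fixed degree. -/
def SmoothField {q : ℕ} (θ : M → Vec n [⋀^Fin q]→L[ℝ] W) : Prop :=
  ∀ x₀ : M, ContDiffOn ℝ ∞ (inChart I θ x₀) (extChartAt I x₀).target

variable (I) in
/-- The exterior derivative of a field of alternating maps of a fixed degree. -/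
def fieldD {q : ℕ} (θ : M → Vec n [⋀^Fin q]→L[ℝ] W) (x : M) : Vec n [⋀^Fin (q + 1)]→L[ℝ] W :=
  extDerivWithin (inChart I θ x) (range I) (extChartAt I x x)

lemma SmoothField.contDiffWithinAt {q : ℕ} {θ : M → Vec n [⋀^Fin q]→L[ℝ] W} (hθ : SmoothField I θ)
    {x₀ : M} {y : Vec n} (hy : y ∈ (extChartAt I x₀).target) :
    ContDiffWithinAt ℝ ∞ (inChart I θ x₀) (range I) y :=
  (hθ x₀ y hy).mono_of_mem_nhdsWithin (extChartAt_target_mem_nhdsWithin_of_mem hy)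

lemma SmoothField.differentiableWithinAt {q : ℕ} {θ : M → Vec n [⋀^Fin q]→L[ℝ] W}
    (hθ : SmoothField I θ) {x₀ : M} {y : Vec n} (hy : y ∈ (extChartAt I x₀).target) :
    DifferentiableWithinAt ℝ (inChart I θ x₀) (range I) y :=
  (hθ.contDiffWithinAt hy).differentiableWithinAt (by simp)

/-- The definition of d uses a different chart at every point. Naturality of the exterior derivative
under the coordinate change τ shows that a single chart gives the same result, which is what makes
dθ smooth and computable over a whole chart. -/
lemma inChart_fieldD {q : ℕ} {θ : M → Vec n [⋀^Fin q]→L[ℝ] W} (hθ : SmoothField I θ) {x₀ : M}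
    {y : Vec n} (hy : y ∈ (extChartAt I x₀).target) :
    inChart I (fieldD I θ) x₀ y = extDerivWithin (inChart I θ x₀) (range I) y := by
  set z := (extChartAt I x₀).symm y with hz
  have hz₀ : z ∈ (extChartAt I x₀).source := (extChartAt I x₀).map_target hy
  have hzy : extChartAt I x₀ z = y := (extChartAt I x₀).right_inv hy
  set τ := extChartAt I z ∘ (extChartAt I x₀).symm with hτ
  have hyr : y ∈ range I := extChartAt_target_subset_range x₀ hy
  have hcd : ContDiffWithinAt ℝ ∞ τ (range I) y := by
    rw [← hzy]
    refine contDiffWithinAt_ext_coord_change z x₀ ?_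
    rw [PartialEquiv.trans_source'', PartialEquiv.symm_symm, PartialEquiv.symm_target]
    exact mem_image_of_mem _ ⟨hz₀, mem_extChartAt_source z⟩
  have hmap : MapsTo τ (range I) (range I) := fun y' _ => by
    simp only [hτ, Function.comp_apply, extChartAt_coe]
    exact mem_range_self _
  have hpb := extDerivWithin_pullback (f := τ) (t := range I) (s := range I)
    (x := y) (r := ∞) (hθ.differentiableWithinAt (mem_extChartAt_target z)) hcd
    (by rw [minSmoothness_of_isRCLikeNormedField]; exact WithTop.coe_le_coe.2 le_top) I.uniqueDiffOn (I.range_subset_closure_interior hyr) hyr hmap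
  have hev : inChart I θ x₀ =ᶠ[nhdsWithin y (range I)] fun y' =>
      (inChart I θ z (τ y')).compContinuousLinearMap (fderivWithin ℝ τ (range I) y') := by
    have h1 : (extChartAt I x₀).target ∩ (extChartAt I x₀).symm ⁻¹' (extChartAt I z).source ∈
        nhdsWithin y (range I) := by
      refine Filter.inter_mem (extChartAt_target_mem_nhdsWithin_of_mem hy) ?_
      have := (continuousAt_extChartAt_symm'' hy).preimage_mem_nhds
        (extChartAt_source_mem_nhds (I := I) z)
      exact nhdsWithin_le_nhds this
    filter_upwards [h1] with y' hy'
    have h2 := comp_transition_eq θ ((extChartAt I x₀).map_target hy'.1) hy'.2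
    rw [transition_eq_fderivWithin, (extChartAt I x₀).right_inv hy'.1] at h2
    exact h2
  rw [hev.extDerivWithin_eq_of_mem hyr, hpb]
  rw [inChart, ← hz, chartFrame_eq, transition_eq_fderivWithin, hzy]
  rfl

lemma SmoothField.fieldD [FiniteDimensional ℝ W] {q : ℕ} {θ : M → Vec n [⋀^Fin q]→L[ℝ] W}
    (hθ : SmoothField I θ) : SmoothField I (fieldD I θ) := by
  intro x₀
  have h1 : ContDiffOn ℝ ∞ (extDerivWithin (inChart I θ x₀) (range I)) (extChartAt I x₀).target := by
    intro y hy
    have hyr : y ∈ range I := extChartAt_target_subset_range x₀ hy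
    have h2 := (hθ.contDiffWithinAt hy).fderivWithin_right (m := ∞) I.uniqueDiffOn (by simp) hyr
    have h3 := (ContinuousAlternatingMap.alternatizeUncurryFinCLM ℝ (Vec n) W
      (n := q)).contDiff.contDiffAt.comp_contDiffWithinAt y h2
    exact h3.mono (extChartAt_target_subset_range x₀)
  exact h1.congr fun y hy => inChart_fieldD hθ hy

lemma SmoothField.add {q : ℕ} {θ η : M → Vec n [⋀^Fin q]→L[ℝ] W} (hθ : SmoothField I θ)
    (hη : SmoothField I η) : SmoothField I (θ + η) := fun x₀ => (hθ x₀).add (hη x₀)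

lemma SmoothField.const_smul {q : ℕ} {θ : M → Vec n [⋀^Fin q]→L[ℝ] W} (c : ℝ)
    (hθ : SmoothField I θ) : SmoothField I (c • θ) := fun x₀ => (hθ x₀).const_smul c

lemma SmoothField.zero {q : ℕ} : SmoothField I (0 : M → Vec n [⋀^Fin q]→L[ℝ] W) :=
  fun _ => contDiffOn_const (c := 0)

lemma uniqueDiffWithinAt_range (x : M) : UniqueDiffWithinAt ℝ (range I) (extChartAt I x x) :=
  I.uniqueDiffOn _ (extChartAt_target_subset_range x (mem_extChartAt_target x))

lemma fieldD_add {q : ℕ} {θ η : M → Vec n [⋀^Fin q]→L[ℝ] W} (hθ : SmoothField I θ)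
    (hη : SmoothField I η) : fieldD I (θ + η) = fieldD I θ + fieldD I η := by
  ext1 x
  exact extDerivWithin_add (uniqueDiffWithinAt_range x)
    (hθ.differentiableWithinAt (mem_extChartAt_target x))
    (hη.differentiableWithinAt (mem_extChartAt_target x))

lemma fieldD_smul {q : ℕ} (c : ℝ) (θ : M → Vec n [⋀^Fin q]→L[ℝ] W) :
    fieldD I (c • θ) = c • fieldD I θ := by
  ext1 x
  exact extDerivWithin_smul c (inChart I θ x) (uniqueDiffWithinAt_range (I := I) x)

lemma fieldD_congr {q : ℕ} {θ η : M → Vec n [⋀^Fin q]→L[ℝ] W} {x : M}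
    (h : θ =ᶠ[nhds x] η) : fieldD I θ x = fieldD I η x := by
  have h1 : inChart I θ x =ᶠ[nhds (extChartAt I x x)] inChart I η x := by
    have h2 : ContinuousAt (extChartAt I x).symm (extChartAt I x x) := continuousAt_extChartAt_symm x
    rw [ContinuousAt, extChartAt_to_inv] at h2
    filter_upwards [h2.eventually h] with y hy
    show ContinuousAlternatingMap.compContinuousLinearMap _ _ =
      ContinuousAlternatingMap.compContinuousLinearMap _ _
    rw [hy]
  exact Filter.EventuallyEq.extDerivWithin_eq_nhds h1

section Products

variable [FiniteDimensional ℝ V] [FiniteDimensional ℝ W]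

lemma inChart_wedge (b : V →L[ℝ] W →L[ℝ] Z) {p q r : ℕ} (h : p + q = r)
    (α : M → Vec n [⋀^Fin p]→L[ℝ] V) (β : M → Vec n [⋀^Fin q]→L[ℝ] W) (x₀ : M) :
    inChart I (fun x => wedgeAlt b h (α x) (β x)) x₀ =
      fun y => wedgeAlt b h (inChart I α x₀ y) (inChart I β x₀ y) := by
  ext1 y
  exact (wedgeAlt_comp b h _ _ _).symm

lemma SmoothField.wedge (b : V →L[ℝ] W →L[ℝ] Z) {p q r : ℕ} (h : p + q = r)
    {α : M → Vec n [⋀^Fin p]→L[ℝ] V} {β : M → Vec n [⋀^Fin q]→L[ℝ] W} (hα : SmoothField I α)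
    (hβ : SmoothField I β) : SmoothField I (fun x => wedgeAlt b h (α x) (β x)) := by
  intro x₀
  rw [inChart_wedge]
  exact ((wedgeCLM b h).contDiff.comp_contDiffOn (hα x₀)).clm_apply (hβ x₀)

/-- In the preferred chart the product is a continuous bilinear map of the two coordinate
expressions. Its derivative has two terms, each alternatized by one of the pointwise Leibniz rules.
-/
lemma fieldD_wedge (b : V →L[ℝ] W →L[ℝ] Z) {p q r : ℕ} (h : p + q = r) (h₁ : p + 1 + q = r + 1)
    (h₂ : p + (q + 1) = r + 1) {α : M → Vec n [⋀^Fin p]→L[ℝ] V} {β : M → Vec n [⋀^Fin q]→L[ℝ] W}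
    (hα : SmoothField I α) (hβ : SmoothField I β) (x : M) :
    fieldD I (fun x => wedgeAlt b h (α x) (β x)) x =
      wedgeAlt b h₁ (fieldD I α x) (β x) + (-1 : ℝ) ^ p • wedgeAlt b h₂ (α x) (fieldD I β x) := by
  have hx := mem_extChartAt_target (I := I) x
  have h3 := (wedgeCLM b h).hasFDerivWithinAt_of_bilinear
    (hα.differentiableWithinAt hx).hasFDerivWithinAt
    (hβ.differentiableWithinAt hx).hasFDerivWithinAt
  have h4 := h3.fderivWithin (uniqueDiffWithinAt_range x)
  rw [fieldD, inChart_wedge, extDerivWithin]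
  simp only [wedgeCLM_apply] at h4
  rw [h4, ContinuousAlternatingMap.alternatizeUncurryFin_add]
  refine (add_comm _ _).trans ?_
  simp only [inChart_self]
  congr 1
  · exact alternatizeUncurryFin_wedge_left b h h₁ _ _ _ fun v => rfl
  · exact alternatizeUncurryFin_wedge_right b h h₂ _ _ _ fun v => rfl

end Products

end Charts

/-! ### Smooth dependence of the Hodge star on its data -/

section StarSmooth

variable {n : ℕ} {W : Type*} [NormedAddCommGroup W] [NormedSpace ℝ W]
  {E : Type*} [NormedAddCommGroup E] [NormedSpace ℝ E]

lemma contDiffOn_det {m : ℕ} {A : E → Matrix (Fin m) (Fin m) ℝ} {s : Set E} {N : WithTop ℕ∞}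
    (hA : ∀ i j, ContDiffOn ℝ N (fun y => A y i j) s) : ContDiffOn ℝ N (fun y => (A y).det) s := by
  simp only [Matrix.det_apply]
  exact ContDiffOn.sum fun σ _ => (contDiffOn_prod fun i _ => hA _ _).const_smul _

/-- Cramer's rule: the entries are polynomials in those of A divided by a nonvanishing determinant.
-/
lemma contDiffOn_inv_apply {m : ℕ} {A : E → Matrix (Fin m) (Fin m) ℝ} {s : Set E} {N : WithTop ℕ∞}
    (hA : ∀ i j, ContDiffOn ℝ N (fun y => A y i j) s) (h0 : ∀ y ∈ s, (A y).det ≠ 0)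
    (i j : Fin m) : ContDiffOn ℝ N (fun y => (A y)⁻¹ i j) s := by
  simp only [Matrix.inv_def, Ring.inverse_eq_inv', Matrix.smul_apply, smul_eq_mul,
    Matrix.adjugate_apply]
  refine ((contDiffOn_det hA).inv h0).mul (contDiffOn_det fun k l => ?_)
  by_cases hk : k = j
  · subst hk
    simpa using contDiffOn_const
  · simpa [Matrix.updateRow_ne hk] using hA k l

lemma plug_dualVec (g : Vec n →L[ℝ] Vec n →L[ℝ] ℝ) (vol : Vec n [⋀^Fin n]→L[ℝ] ℝ) {p q : ℕ}
    (h : p + q = n) (s : Fin p → Fin n) (w : Fin q → Vec n) :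
    plug h vol (fun i => dualVec g (s i)) w = ∑ t : Fin p → Fin n,
      (∏ k, (gram g)⁻¹ (s k) (t k)) • vol fun i =>
        Fin.append (fun i => stdVec (t i)) w (Fin.cast h.symm i) := by
  obtain ⟨f, hf⟩ := exists_plug_eq h vol w
  rw [hf]
  simp only [dualVec]
  rw [map_sum_smul f (fun k j => (gram g)⁻¹ (s k) j)]
  simp only [← hf, plug_apply]

lemma contDiffOn_starAlt [FiniteDimensional ℝ W] {g : E → Vec n →L[ℝ] Vec n →L[ℝ] ℝ}
    {vol : E → Vec n [⋀^Fin n]→L[ℝ] ℝ} {p q : ℕ} (h : p + q = n)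
    {α : E → Vec n [⋀^Fin p]→L[ℝ] W} {s : Set E} {N : WithTop ℕ∞} (hg : ContDiffOn ℝ N g s)
    (hv : ContDiffOn ℝ N vol s) (hα : ContDiffOn ℝ N α s)
    (h0 : ∀ y ∈ s, ∀ v, (∀ w, g y v w = 0) → v = 0) :
    ContDiffOn ℝ N (fun y => starAlt (g y) (vol y) h (α y)) s := by
  refine contDiffOn_of_apply fun w => ?_
  have hG (i j : Fin n) : ContDiffOn ℝ N (fun y => (gram (g y))⁻¹ i j) s :=
    contDiffOn_inv_apply
      (fun i j => (hg.clm_apply contDiffOn_const).clm_apply contDiffOn_const)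
      (fun y hy => det_gram_ne_zero (h0 y hy)) i j
  have hP (t : Fin p → Fin n) : ContDiffOn ℝ N (fun y =>
      plug h (vol y) (fun i => dualVec (g y) (t i)) fun i => stdVec (w i)) s := by
    simp only [plug_dualVec]
    exact ContDiffOn.sum fun t' _ => (contDiffOn_prod fun k _ => hG _ _).smul (contDiffOn_apply hv _)
  simp only [starAlt_apply]
  exact (ContDiffOn.sum fun t _ => (hP t).smul (contDiffOn_apply hα _)).const_smul _

end StarSmooth

/-! ### Calculus of forms with integer degrees -/

section Forms

variable {n : ℕ} {H : Type*} [TopologicalSpace H] {I : ModelWithCorners ℝ (Vec n) H}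
  {M : Type*} [TopologicalSpace M] [ChartedSpace H M] [IsManifold I ∞ M]
  {V : Type*} [NormedAddCommGroup V] [NormedSpace ℝ V]
  {W : Type*} [NormedAddCommGroup W] [NormedSpace ℝ W]
  {Z : Type*} [NormedAddCommGroup Z] [NormedSpace ℝ Z]
  {Y : Type*} [NormedAddCommGroup Y] [NormedSpace ℝ Y]

lemma dform_ext {p : ℤ} {η η' : DForm n M W p}
    (h : ∀ (q : ℕ) (hq : (q : ℤ) = p) (x : M), η ⟨q, hq⟩ x = η' ⟨q, hq⟩ x) : η = η' :=
  funext fun q => funext fun x => h q.1 q.2 x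

lemma wedge_apply (b : V →L[ℝ] W →L[ℝ] Z) {p q r : ℤ} (h : p + q = r) (α : DForm n M V p)
    (β : DForm n M W q) {P Q R : ℕ} (hP : (P : ℤ) = p) (hQ : (Q : ℤ) = q) (hR : (R : ℤ) = r)
    (h' : P + Q = R) (x : M) :
    wedge b h α β ⟨R, hR⟩ x = wedgeAlt b h' (α ⟨P, hP⟩ x) (β ⟨Q, hQ⟩ x) := by
  subst hP hQ
  exact dif_pos ⟨by omega, by omega⟩

/-- Degrees such as n - 2 and n - 3 are negative for small n. The vanishing of forms in negative
degree lets every identity below hold without a restriction on n. -/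
lemma wedge_of_neg (b : V →L[ℝ] W →L[ℝ] Z) {p q r : ℤ} (h : p + q = r) (α : DForm n M V p)
    (β : DForm n M W q) (hpq : p < 0 ∨ q < 0) : wedge b h α β = 0 :=
  dform_ext fun _ _ _ => dif_neg (by omega)

lemma hodge_apply (Ω : OrientedMetric I M) {p q : ℤ} (h : p + q = n) (α : DForm n M W p)
    {P Q : ℕ} (hP : (P : ℤ) = p) (hQ : (Q : ℤ) = q) (h' : P + Q = n) (x : M) :
    hodge Ω h α ⟨Q, hQ⟩ x = starAlt (Ω.g x) (Ω.vol x) h' (α ⟨P, hP⟩ x) := by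
  subst hP
  exact dif_pos (by omega)

lemma hodge_of_neg (Ω : OrientedMetric I M) {p q : ℤ} (h : p + q = n) (α : DForm n M W p)
    (hp : p < 0) : hodge Ω h α = 0 :=
  dform_ext fun _ _ _ => dif_neg (by omega)

lemma extD_apply_succ {p r : ℤ} (h : p + 1 = r) (η : DForm n M W p) {P : ℕ} (hP : (P : ℤ) = p)
    (hR : ((P + 1 : ℕ) : ℤ) = r) (x : M) : extD I h η ⟨P + 1, hR⟩ x = fieldD I (η ⟨P, hP⟩) x := rfl

lemma extD_of_neg {p r : ℤ} (h : p + 1 = r) (η : DForm n M W p) (hp : p < 0) :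
    extD I h η = 0 := by
  refine dform_ext fun q hq x => ?_
  cases q with
  | zero => rfl
  | succ q => push_cast at hq; omega

/-! ### Algebra of forms -/

lemma wedge_add_left (b : V →L[ℝ] W →L[ℝ] Z) {p q r : ℤ} (h : p + q = r) (α α' : DForm n M V p)
    (β : DForm n M W q) : wedge b h (α + α') β = wedge b h α β + wedge b h α' β := by
  refine dform_ext fun c hc x => ?_
  by_cases hpq : 0 ≤ p ∧ 0 ≤ q
  · obtain ⟨P, rfl⟩ := Int.eq_ofNat_of_zero_le hpq.1
    obtain ⟨Q, rfl⟩ := Int.eq_ofNat_of_zero_le hpq.2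
    simp only [Pi.add_apply, wedge_apply b h _ _ rfl rfl hc (by omega : P + Q = c),
      wedgeAlt_add_left]
  · simp [wedge_of_neg b h _ β (by omega : p < 0 ∨ q < 0)]

lemma wedge_add_right (b : V →L[ℝ] W →L[ℝ] Z) {p q r : ℤ} (h : p + q = r) (α : DForm n M V p)
    (β β' : DForm n M W q) : wedge b h α (β + β') = wedge b h α β + wedge b h α β' := by
  refine dform_ext fun c hc x => ?_
  by_cases hpq : 0 ≤ p ∧ 0 ≤ q
  · obtain ⟨P, rfl⟩ := Int.eq_ofNat_of_zero_le hpq.1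
    obtain ⟨Q, rfl⟩ := Int.eq_ofNat_of_zero_le hpq.2
    simp only [Pi.add_apply, wedge_apply b h _ _ rfl rfl hc (by omega : P + Q = c),
      wedgeAlt_add_right]
  · simp [wedge_of_neg b h α _ (by omega : p < 0 ∨ q < 0)]

lemma wedge_smul_left (b : V →L[ℝ] W →L[ℝ] Z) {p q r : ℤ} (h : p + q = r) (c : ℝ)
    (α : DForm n M V p) (β : DForm n M W q) : wedge b h (c • α) β = c • wedge b h α β := by
  refine dform_ext fun R hR x => ?_
  by_cases hpq : 0 ≤ p ∧ 0 ≤ q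
  · obtain ⟨P, rfl⟩ := Int.eq_ofNat_of_zero_le hpq.1
    obtain ⟨Q, rfl⟩ := Int.eq_ofNat_of_zero_le hpq.2
    simp only [Pi.smul_apply, wedge_apply b h _ _ rfl rfl hR (by omega : P + Q = R),
      wedgeAlt_smul_left]
  · simp [wedge_of_neg b h _ β (by omega : p < 0 ∨ q < 0)]

lemma wedge_smul_right (b : V →L[ℝ] W →L[ℝ] Z) {p q r : ℤ} (h : p + q = r) (c : ℝ)
    (α : DForm n M V p) (β : DForm n M W q) : wedge b h α (c • β) = c • wedge b h α β := by
  refine dform_ext fun R hR x => ?_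
  by_cases hpq : 0 ≤ p ∧ 0 ≤ q
  · obtain ⟨P, rfl⟩ := Int.eq_ofNat_of_zero_le hpq.1
    obtain ⟨Q, rfl⟩ := Int.eq_ofNat_of_zero_le hpq.2
    simp only [Pi.smul_apply, wedge_apply b h _ _ rfl rfl hR (by omega : P + Q = R),
      wedgeAlt_smul_right]
  · simp [wedge_of_neg b h α _ (by omega : p < 0 ∨ q < 0)]

lemma wedge_zero_left (b : V →L[ℝ] W →L[ℝ] Z) {p q r : ℤ} (h : p + q = r)
    (β : DForm n M W q) : wedge b h (0 : DForm n M V p) β = 0 := by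
  have := wedge_smul_left b h 0 (0 : DForm n M V p) β
  simpa using this

lemma wedge_zero_right (b : V →L[ℝ] W →L[ℝ] Z) {p q r : ℤ} (h : p + q = r)
    (α : DForm n M V p) : wedge b h α (0 : DForm n M W q) = 0 := by
  have := wedge_smul_right b h 0 α (0 : DForm n M W q)
  simpa using this

lemma wedge_comm {b : V →L[ℝ] W →L[ℝ] Z} {b' : W →L[ℝ] V →L[ℝ] Z} (hb : ∀ x y, b' y x = b x y)
    {p q r : ℤ} (h : p + q = r) (h' : q + p = r) (α : DForm n M V p) (β : DForm n M W q) {P Q : ℕ}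
    (hP : (P : ℤ) = p) (hQ : (Q : ℤ) = q) :
    wedge b' h' β α = (-1 : ℝ) ^ (P * Q) • wedge b h α β := by
  refine dform_ext fun R hR x => ?_
  rw [Pi.smul_apply, Pi.smul_apply, wedge_apply b h _ _ hP hQ hR (by omega),
    wedge_apply b' h' _ _ hQ hP hR (by omega), wedgeAlt_comm b b' hb]

lemma wedge_assoc {X : Type*} [NormedAddCommGroup X] [NormedSpace ℝ X]
    {U : Type*} [NormedAddCommGroup U] [NormedSpace ℝ U]
    {b : V →L[ℝ] W →L[ℝ] X} {c : X →L[ℝ] Y →L[ℝ] Z} {b' : W →L[ℝ] Y →L[ℝ] U} {c' : V →L[ℝ] U →L[ℝ] Z}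
    (hbc : ∀ x y z, c (b x y) z = c' x (b' y z)) {p q r s t u : ℤ} (h : p + q = s) (h' : q + r = t)
    (h₂ : s + r = u) (h₂' : p + t = u) (α : DForm n M V p) (β : DForm n M W q) (γ : DForm n M Y r) :
    wedge c h₂ (wedge b h α β) γ = wedge c' h₂' α (wedge b' h' β γ) := by
  by_cases hp : p < 0
  · rw [wedge_of_neg b h _ _ (.inl hp), wedge_zero_left, wedge_of_neg _ _ _ _ (.inl hp)]
  by_cases hq : q < 0
  · rw [wedge_of_neg b h _ _ (.inr hq), wedge_zero_left, wedge_of_neg b' _ _ _ (.inl hq),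
      wedge_zero_right]
  by_cases hr : r < 0
  · rw [wedge_of_neg c _ _ _ (.inr hr), wedge_of_neg b' _ _ _ (.inr hr), wedge_zero_right]
  obtain ⟨P, rfl⟩ := Int.eq_ofNat_of_zero_le (not_lt.1 hp)
  obtain ⟨Q, rfl⟩ := Int.eq_ofNat_of_zero_le (not_lt.1 hq)
  obtain ⟨R, rfl⟩ := Int.eq_ofNat_of_zero_le (not_lt.1 hr)
  refine dform_ext fun T hT x => ?_
  have hs : ((P + Q : ℕ) : ℤ) = s := by omega
  have ht : ((Q + R : ℕ) : ℤ) = t := by omega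
  rw [wedge_apply c h₂ _ _ hs rfl hT (by omega), wedge_apply c' h₂' _ _ rfl ht hT (by omega),
    wedge_apply b h _ _ rfl rfl hs rfl, wedge_apply b' h' _ _ rfl rfl ht rfl]
  exact wedgeAlt_assoc b c b' c' hbc _ _ _ _ _ _ _

lemma hodge_add (Ω : OrientedMetric I M) {p q : ℤ} (h : p + q = n) (α β : DForm n M W p) :
    hodge Ω h (α + β) = hodge Ω h α + hodge Ω h β := by
  by_cases hp : p < 0
  · simp [hodge_of_neg Ω h _ hp]
  obtain ⟨P, rfl⟩ := Int.eq_ofNat_of_zero_le (not_lt.1 hp)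
  refine dform_ext fun Q hQ x => ?_
  simp only [Pi.add_apply, hodge_apply Ω h _ rfl hQ (by omega), starAlt_add]

lemma hodge_smul (Ω : OrientedMetric I M) {p q : ℤ} (h : p + q = n) (c : ℝ) (α : DForm n M W p) :
    hodge Ω h (c • α) = c • hodge Ω h α := by
  by_cases hp : p < 0
  · simp [hodge_of_neg Ω h _ hp]
  obtain ⟨P, rfl⟩ := Int.eq_ofNat_of_zero_le (not_lt.1 hp)
  refine dform_ext fun Q hQ x => ?_
  simp only [Pi.smul_apply, hodge_apply Ω h _ rfl hQ (by omega), starAlt_smul]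

lemma wedge_hodge_comm (Ω : OrientedMetric I M) {b : V →L[ℝ] V →L[ℝ] Z} (hb : ∀ x y, b x y = b y x)
    {p q r : ℤ} (h : p + q = r) (h' : p + q = n) (α β : DForm n M V p) :
    wedge b h α (hodge Ω h' β) = wedge b h β (hodge Ω h' α) := by
  by_cases hpq : p < 0 ∨ q < 0
  · rw [wedge_of_neg b h _ _ hpq, wedge_of_neg b h _ _ hpq]
  obtain ⟨P, rfl⟩ := Int.eq_ofNat_of_zero_le (by omega : 0 ≤ p)
  obtain ⟨Q, rfl⟩ := Int.eq_ofNat_of_zero_le (by omega : 0 ≤ q)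
  refine dform_ext fun R hR x => ?_
  obtain rfl : R = n := by omega
  rw [wedge_apply b h _ _ rfl rfl hR (by omega), wedge_apply b h _ _ rfl rfl hR (by omega),
    hodge_apply Ω h' _ rfl rfl (by omega), hodge_apply Ω h' _ rfl rfl (by omega),
    wedgeAlt_starAlt, wedgeAlt_starAlt, starPairing_comm (Ω.symm x) hb]

/-! ### Smooth forms -/

lemma extD_smul {p r : ℤ} (h : p + 1 = r) (c : ℝ) (η : DForm n M W p) :
    extD I h (c • η) = c • extD I h η := by
  refine dform_ext fun q hq x => ?_
  cases q with
  | zero => exact (smul_zero c).symm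
  | succ q =>
    have hq' : (q : ℤ) = p := by push_cast at hq; omega
    exact congrFun (fieldD_smul c (η ⟨q, hq'⟩)) x

lemma extD_zero {p r : ℤ} (h : p + 1 = r) : extD I h (0 : DForm n M W p) = 0 := by
  simpa using extD_smul (I := I) h 0 (0 : DForm n M W p)

variable [FiniteDimensional ℝ V] [FiniteDimensional ℝ W]

lemma IsSmoothForm.field {p : ℤ} {η : DForm n M W p} (h : IsSmoothForm I η) {q : ℕ}
    (hq : (q : ℤ) = p) : SmoothField I (η ⟨q, hq⟩) := h ⟨q, hq⟩

lemma IsSmoothForm.zero {p : ℤ} : IsSmoothForm I (0 : DForm n M W p) := fun _ => SmoothField.zero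

lemma IsSmoothForm.add {p : ℤ} {η θ : DForm n M W p} (hη : IsSmoothForm I η)
    (hθ : IsSmoothForm I θ) : IsSmoothForm I (η + θ) :=
  fun q => SmoothField.add (hη q) (hθ q)

lemma IsSmoothForm.const_smul {p : ℤ} {η : DForm n M W p} (c : ℝ) (hη : IsSmoothForm I η) :
    IsSmoothForm I (c • η) :=
  fun q => SmoothField.const_smul c (hη q)

lemma IsSmoothForm.extD {p r : ℤ} (h : p + 1 = r) {η : DForm n M W p} (hη : IsSmoothForm I η) :
    IsSmoothForm I (extD I h η) := by
  rintro ⟨q, hq⟩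
  cases q with
  | zero => exact SmoothField.zero
  | succ q => exact SmoothField.fieldD (hη.field (by push_cast at hq; omega))

lemma IsSmoothForm.wedge (b : V →L[ℝ] W →L[ℝ] Z) {p q r : ℤ} (h : p + q = r)
    {α : DForm n M V p} {β : DForm n M W q} (hα : IsSmoothForm I α) (hβ : IsSmoothForm I β) :
    IsSmoothForm I (wedge b h α β) := by
  by_cases hpq : p < 0 ∨ q < 0
  · rw [wedge_of_neg b h _ _ hpq]
    exact fun _ _ => contDiffOn_const (c := 0)
  obtain ⟨P, rfl⟩ := Int.eq_ofNat_of_zero_le (by omega : 0 ≤ p)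
  obtain ⟨Q, rfl⟩ := Int.eq_ofNat_of_zero_le (by omega : 0 ≤ q)
  rintro ⟨R, hR⟩
  have hPQ : P + Q = R := by omega
  rw [show GDC.wedge b h α β ⟨R, hR⟩ = fun x => wedgeAlt b hPQ (α ⟨P, rfl⟩ x) (β ⟨Q, rfl⟩ x)
    from funext fun x => wedge_apply b h _ _ rfl rfl hR hPQ x]
  exact SmoothField.wedge b _ (hα.field rfl) (hβ.field rfl)

/-- Naturality identifies the coordinate expression of ∗α with the star formed from the coordinate
expressions of g, vol and α. The pulled-back metric stays nondegenerate because the chart frame is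
invertible. -/
lemma IsSmoothForm.hodge (Ω : OrientedMetric I M) {p q : ℤ} (h : p + q = n) {α : DForm n M W p}
    (hα : IsSmoothForm I α) : IsSmoothForm I (hodge Ω h α) := by
  by_cases hp : p < 0
  · rw [hodge_of_neg Ω h _ hp]
    exact IsSmoothForm.zero
  obtain ⟨P, rfl⟩ := Int.eq_ofNat_of_zero_le (by omega : 0 ≤ p)
  rintro ⟨Q, hQ⟩ x₀
  have hPQ : P + Q = n := by omega
  rw [show GDC.hodge Ω h α ⟨Q, hQ⟩ = fun x => starAlt (Ω.g x) (Ω.vol x) hPQ (α ⟨P, rfl⟩ x)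
    from funext fun x => hodge_apply Ω h _ rfl hQ hPQ x]
  refine (contDiffOn_starAlt hPQ (Ω.smooth_g x₀) (Ω.smooth_vol x₀)
    (hα.field rfl x₀) fun y hy v hv => ?_).congr fun y hy => ?_
  · have hz := (extChartAt I x₀).map_target hy
    have h1 : chartFrame I x₀ ((extChartAt I x₀).symm y) v = 0 := by
      refine Ω.nondeg ((extChartAt I x₀).symm y) _ fun w => ?_
      have h2 := hv (transition I ((extChartAt I x₀).symm y) x₀ ((extChartAt I x₀).symm y) w)
      rwa [ContinuousLinearMap.bilinearComp_apply, chartFrame_transition hz] at h2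
    rw [← transition_chartFrame hz v, h1, map_zero]
  · have hz := (extChartAt I x₀).map_target hy
    exact (starAlt_comp _ _ _ _ (chartFrame_transition hz)).symm

lemma extD_add {p r : ℤ} (h : p + 1 = r) {η θ : DForm n M W p} (hη : IsSmoothForm I η)
    (hθ : IsSmoothForm I θ) : extD I h (η + θ) = extD I h η + extD I h θ := by
  refine dform_ext fun q hq x => ?_
  cases q with
  | zero => exact (add_zero _).symm
  | succ q =>
    have hq' : (q : ℤ) = p := by push_cast at hq; omega
    exact congrFun (fieldD_add (hη.field hq') (hθ.field hq')) x

lemma extD_wedge (b : V →L[ℝ] W →L[ℝ] Z) {p q r s p' q' : ℤ} (h : p + q = r) (hs : r + 1 = s)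
    (hp : p + 1 = p') (hq : q + 1 = q') {α : DForm n M V p} {β : DForm n M W q}
    (hα : IsSmoothForm I α) (hβ : IsSmoothForm I β) :
    extD I hs (wedge b h α β) = wedge b (by omega) (extD I hp α) β +
      (-1 : ℝ) ^ p • wedge b (by omega) α (extD I hq β) := by
  by_cases h0 : p < 0
  · rw [wedge_of_neg b h _ _ (.inl h0), extD_of_neg hp α h0, wedge_zero_left,
      wedge_of_neg b _ α _ (.inl h0), smul_zero, add_zero]
    exact extD_zero hs
  by_cases h1 : q < 0
  · rw [wedge_of_neg b h _ _ (.inr h1), extD_of_neg hq β h1, wedge_zero_right,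
      wedge_of_neg b _ _ β (.inr h1), smul_zero, add_zero]
    exact extD_zero hs
  obtain ⟨P, rfl⟩ := Int.eq_ofNat_of_zero_le (not_lt.1 h0)
  obtain ⟨Q, rfl⟩ := Int.eq_ofNat_of_zero_le (not_lt.1 h1)
  refine dform_ext fun S hS x => ?_
  obtain ⟨R, rfl⟩ : ∃ R, S = R + 1 := ⟨P + Q, by omega⟩
  have hR : (R : ℤ) = r := by push_cast at hS; omega
  have hPQ : P + Q = R := by omega
  have hP : ((P + 1 : ℕ) : ℤ) = p' := by push_cast; omega
  have hQ : ((Q + 1 : ℕ) : ℤ) = q' := by push_cast; omega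
  rw [extD_apply_succ hs _ hR, Pi.add_apply, Pi.add_apply, Pi.smul_apply, Pi.smul_apply,
    wedge_apply b _ _ _ hP rfl hS (by omega), wedge_apply b _ _ _ rfl hQ hS (by omega),
    extD_apply_succ hp _ rfl, extD_apply_succ hq _ rfl,
    show wedge b h α β ⟨R, hR⟩ = fun x => wedgeAlt b hPQ (α ⟨P, rfl⟩ x) (β ⟨Q, rfl⟩ x)
      from funext fun x => wedge_apply b h _ _ rfl rfl hR hPQ x,
    fieldD_wedge b hPQ (by omega) (by omega) (hα.field rfl) (hβ.field rfl), zpow_natCast]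

end Forms

/-! ### Forms of top degree and determinants -/

section TopDegree

variable {n : ℕ} {W : Type*} [NormedAddCommGroup W] [NormedSpace ℝ W]

lemma apply_eq_det_smul (f : Vec n [⋀^Fin n]→L[ℝ] W) (e : Module.Basis (Fin n) ℝ (Vec n))
    (v : Fin n → Vec n) : f v = e.det v • f e := by
  have h : f.toAlternatingMap =
      (LinearMap.toSpanSingleton ℝ W (f e)).compAlternatingMap e.det := by
    refine e.ext_alternating fun v hv => ?_
    let σ : Equiv.Perm (Fin n) := Equiv.ofBijective v (Finite.injective_iff_bijective.1 hv)
    have h1 := f.toAlternatingMap.map_perm e σ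
    have h2 := e.det.map_perm e σ
    have h3 : (fun i => e (v i)) = e ∘ σ := rfl
    rw [h3, h1, LinearMap.compAlternatingMap_apply, h2, e.det_self,
      LinearMap.toSpanSingleton_apply]
    rcases Int.units_eq_one_or (Equiv.Perm.sign σ) with hs | hs <;> simp [hs]
  exact congrArg (fun g : Vec n [⋀^Fin n]→ₗ[ℝ] W => g v) h

lemma compContinuousLinearMap_stdVec (f : Vec n [⋀^Fin n]→L[ℝ] W) (L : Vec n →L[ℝ] Vec n) :
    f.compContinuousLinearMap L stdVec = L.det • f stdVec := by
  set e := (EuclideanSpace.basisFun (Fin n) ℝ).toBasis with he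
  have h1 : (e : Fin n → Vec n) = stdVec := by
    ext1 i
    simp [he, stdVec]
  have h2 := apply_eq_det_smul f e (L ∘ e)
  rw [show (L ∘ e : Fin n → Vec n) = (L : Vec n →ₗ[ℝ] Vec n) ∘ e from rfl, e.det_comp, e.det_self,
    mul_one] at h2
  rw [← h1]
  exact h2

lemma det_ne_zero_of_leftInverse {L L' : Vec n →L[ℝ] Vec n} (h : ∀ v, L (L' v) = v) :
    L.det ≠ 0 := by
  have h1 : (L : Vec n →ₗ[ℝ] Vec n) ∘ₗ (L' : Vec n →ₗ[ℝ] Vec n) = LinearMap.id :=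
    LinearMap.ext h
  have h2 := congrArg LinearMap.det h1
  rw [LinearMap.det_comp, LinearMap.det_id] at h2
  exact left_ne_zero_of_mul_eq_one h2

end TopDegree

/-! ### The volume measure and coefficients of top-degree forms -/

section Volume

variable {n : ℕ} {H : Type*} [TopologicalSpace H] {I : ModelWithCorners ℝ (Vec n) H}
  {M : Type*} [TopologicalSpace M] [ChartedSpace H M] [IsManifold I ∞ M]
  {W : Type*} [NormedAddCommGroup W] [NormedSpace ℝ W]

lemma vol_stdVec_ne_zero (Ω : OrientedMetric I M) (x : M) : Ω.vol x stdVec ≠ 0 := by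
  intro h
  have h1 := Ω.vol_sq x stdVec
  rw [h, zero_pow two_ne_zero, eq_comm, abs_eq_zero] at h1
  exact det_gram_ne_zero (Ω.nondeg x) h1

lemma inChart_stdVec (θ : M → Vec n [⋀^Fin n]→L[ℝ] W) {x₀ z : M}
    (hz : z ∈ (extChartAt I x₀).source) :
    inChart I θ x₀ (extChartAt I x₀ z) stdVec = (chartFrame I x₀ z).det • θ z stdVec := by
  rw [inChart, compContinuousLinearMap_stdVec, (extChartAt I x₀).left_inv hz]

lemma det_chartFrame_ne_zero {x₀ z : M} (hz : z ∈ (extChartAt I x₀).source) :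
    (chartFrame I x₀ z).det ≠ 0 := det_ne_zero_of_leftInverse (chartFrame_transition hz)

/-- The coefficient of the volume form in the chart at `x₀`. -/
def chartDensity (Ω : OrientedMetric I M) (x₀ : M) (y : Vec n) : ℝ := inChart I Ω.vol x₀ y stdVec

lemma chartDensity_ne_zero (Ω : OrientedMetric I M) {x₀ : M} {y : Vec n}
    (hy : y ∈ (extChartAt I x₀).target) : chartDensity Ω x₀ y ≠ 0 := by
  have hz := (extChartAt I x₀).map_target hy
  rw [chartDensity, ← (extChartAt I x₀).right_inv hy, inChart_stdVec _ hz]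
  exact smul_ne_zero (det_chartFrame_ne_zero hz) (vol_stdVec_ne_zero Ω _)

lemma continuousOn_chartDensity (Ω : OrientedMetric I M) (x₀ : M) :
    ContinuousOn (chartDensity Ω x₀) (extChartAt I x₀).target :=
  (contDiffOn_apply (Ω.smooth_vol x₀) _).continuousOn

/-- The determinant of the chart frame multiplies both η and vol, and cancels in the quotient. -/
lemma topCoeff_eq (Ω : OrientedMetric I M) (η : DForm n M W n) {x₀ z : M}
    (hz : z ∈ (extChartAt I x₀).source) :
    topCoeff Ω η z = (chartDensity Ω x₀ (extChartAt I x₀ z))⁻¹ •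
      inChart I (η ⟨n, rfl⟩) x₀ (extChartAt I x₀ z) stdVec := by
  rw [chartDensity, inChart_stdVec _ hz, inChart_stdVec _ hz, topCoeff, smul_eq_mul, mul_inv_rev,
    smul_smul, mul_assoc, inv_mul_cancel₀ (det_chartFrame_ne_zero hz), mul_one]

lemma continuous_topCoeff (Ω : OrientedMetric I M) {η : DForm n M W n} (hη : IsSmoothForm I η) :
    Continuous (topCoeff Ω η) := by
  refine continuous_iff_continuousAt.2 fun x => ?_
  have h1 : ContinuousOn (fun z => (chartDensity Ω x (extChartAt I x z))⁻¹ •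
      inChart I (η ⟨n, rfl⟩) x (extChartAt I x z) stdVec) (extChartAt I x).source := by
    have hm := (extChartAt I x).mapsTo
    refine ContinuousOn.smul (ContinuousOn.inv₀ ((continuousOn_chartDensity Ω x).comp
      (continuousOn_extChartAt x) hm) fun z hz => chartDensity_ne_zero Ω (hm hz)) ?_
    exact (contDiffOn_apply (hη ⟨n, rfl⟩ x) stdVec).continuousOn.comp (continuousOn_extChartAt x) hm
  exact ((h1.congr fun z hz => topCoeff_eq Ω η hz)).continuousAt (extChartAt_source_mem_nhds x)

section Measure

variable [MeasurableSpace M] [BorelSpace M]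

variable (I) in
lemma measurableSet_extChartAt_target (x₀ : M) : MeasurableSet (extChartAt I x₀).target := by
  rw [extChartAt_target]
  exact ((chartAt H x₀).open_target.preimage I.continuous_symm).measurableSet.inter
    I.isClosed_range.measurableSet

variable (I) in
lemma measurableSet_extChartAt_source (x₀ : M) : MeasurableSet (extChartAt I x₀).source :=
  (isOpen_extChartAt_source x₀).measurableSet

variable (I) in
-- The inverse chart is continuous only on its target, so measurability is obtained on that subtype.
lemma measurableSet_target_inter_preimage (x₀ : M) {S : Set M} (hS : MeasurableSet S) :
    MeasurableSet ((extChartAt I x₀).target ∩ (extChartAt I x₀).symm ⁻¹' S) := by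
  have h1 : Measurable ((extChartAt I x₀).target.domRestrict (extChartAt I x₀).symm) :=
    (continuousOn_iff_continuous_domRestrict.1 (continuousOn_extChartAt_symm x₀)).measurable
  have h2 := (measurableSet_extChartAt_target I x₀).subtype_image (h1 hS)
  convert h2 using 1
  ext y
  constructor
  · rintro ⟨h, h'⟩
    exact ⟨⟨y, h⟩, h', rfl⟩
  · rintro ⟨⟨y, h⟩, h', rfl⟩
    exact ⟨h, h'⟩

lemma aemeasurable_extChartAt_symm (x₀ : M) : AEMeasurable (extChartAt I x₀).symm
    (volume.restrict (extChartAt I x₀).target) :=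
  (continuousOn_extChartAt_symm x₀).aemeasurable (measurableSet_extChartAt_target I x₀)

lemma aemeasurable_chartDensity (Ω : OrientedMetric I M) (x₀ : M) :
    AEMeasurable (chartDensity Ω x₀) (volume.restrict (extChartAt I x₀).target) :=
  (continuousOn_chartDensity Ω x₀).aemeasurable (measurableSet_extChartAt_target I x₀)

lemma chartVolume_apply (Ω : OrientedMetric I M) (x₀ : M) {S : Set M} (hS : MeasurableSet S) :
    chartVolume Ω x₀ S = ∫⁻ y in (extChartAt I x₀).target ∩ (extChartAt I x₀).symm ⁻¹' S,
      ENNReal.ofReal |chartDensity Ω x₀ y| := by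
  rw [chartVolume, Measure.map_apply_of_aemeasurable
    ((aemeasurable_extChartAt_symm x₀).mono_ac (withDensity_absolutelyContinuous _ _)) hS,
    withDensity_apply', Measure.restrict_restrict' (measurableSet_extChartAt_target I x₀), inter_comm]
  rfl

lemma chartVolume_inter_source (Ω : OrientedMetric I M) (x₀ : M) {S : Set M}
    (hS : MeasurableSet S) :
    chartVolume Ω x₀ (S ∩ (extChartAt I x₀).source) = chartVolume Ω x₀ S := by
  rw [chartVolume_apply Ω x₀ hS, chartVolume_apply Ω x₀ (hS.inter (measurableSet_extChartAt_source I x₀))]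
  congr 2
  ext y
  simp only [mem_inter_iff, mem_preimage, and_congr_right_iff, and_iff_left_iff_imp]
  exact fun hy _ => (extChartAt I x₀).map_target hy

/-- Change of variables along the coordinate change τ: the density |vol(∂₁, …, ∂ₙ)| transforms by
|det dτ|, which is exactly the Jacobian factor. -/
lemma chartVolume_eq_of_subset (Ω : OrientedMetric I M) {x₀ x₁ : M} {S : Set M}
    (hS : MeasurableSet S) (h₀ : S ⊆ (extChartAt I x₀).source) (h₁ : S ⊆ (extChartAt I x₁).source) :
    chartVolume Ω x₀ S = chartVolume Ω x₁ S := by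
  rw [chartVolume_apply Ω x₀ hS, chartVolume_apply Ω x₁ hS]
  set A := (extChartAt I x₀).target ∩ (extChartAt I x₀).symm ⁻¹' S with hA
  set τ := extChartAt I x₁ ∘ (extChartAt I x₀).symm with hτ
  have himg : (extChartAt I x₁).target ∩ (extChartAt I x₁).symm ⁻¹' S = τ '' A := by
    ext y
    constructor
    · rintro ⟨hy, hyS⟩
      refine ⟨extChartAt I x₀ ((extChartAt I x₁).symm y),
        ⟨(extChartAt I x₀).map_source (h₀ hyS), ?_⟩, ?_⟩
      · rw [mem_preimage, (extChartAt I x₀).left_inv (h₀ hyS)]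
        exact hyS
      · rw [hτ, Function.comp_apply, (extChartAt I x₀).left_inv (h₀ hyS),
          (extChartAt I x₁).right_inv hy]
    · rintro ⟨y', ⟨hy', hS'⟩, rfl⟩
      refine ⟨(extChartAt I x₁).map_source (h₁ hS'), ?_⟩
      rw [mem_preimage, hτ, Function.comp_apply, (extChartAt I x₁).left_inv (h₁ hS')]
      exact hS'
  have hder : ∀ y ∈ A, HasFDerivWithinAt τ (transition I x₀ x₁ ((extChartAt I x₀).symm y)) A y := by
    rintro y ⟨hy, hyS⟩
    have := isManifold_one I M
    have h2 := hasFDerivWithinAt_tangentCoordChange (I := I) (x := x₀) (y := x₁) ⟨h₀ hyS, h₁ hyS⟩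
    rw [(extChartAt I x₀).right_inv hy] at h2
    exact h2.mono (inter_subset_left.trans (extChartAt_target_subset_range x₀))
  have hinj : InjOn τ A := by
    rintro y ⟨hy, hyS⟩ y' ⟨hy', hyS'⟩ h
    have h3 := (extChartAt I x₁).injOn (h₁ hyS) (h₁ hyS') h
    exact (extChartAt I x₀).symm.injOn hy hy' h3
  rw [himg, lintegral_image_eq_lintegral_abs_det_fderiv_mul volume
    (measurableSet_target_inter_preimage I x₀ hS) hder hinj]
  refine setLIntegral_congr_fun (measurableSet_target_inter_preimage I x₀ hS) fun y hy => ?_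
  have h4 := comp_transition_eq Ω.vol (h₀ hy.2) (h₁ hy.2)
  rw [(extChartAt I x₀).right_inv hy.1] at h4
  simp only [chartDensity, h4, compContinuousLinearMap_stdVec, smul_eq_mul, abs_mul]
  rw [ENNReal.ofReal_mul (abs_nonneg _)]
  rfl

lemma chartVolume_le (Ω : OrientedMetric I M) (x₀ : M) : chartVolume Ω x₀ ≤ volumeMeasure Ω :=
  le_iSup (chartVolume Ω) x₀

lemma restrict_volumeMeasure (Ω : OrientedMetric I M) (x₀ : M) :
    (volumeMeasure Ω).restrict (extChartAt I x₀).source = chartVolume Ω x₀ := by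
  set U := (extChartAt I x₀).source with hU
  have hUm : MeasurableSet U := measurableSet_extChartAt_source I x₀
  have hself : (chartVolume Ω x₀).restrict U = chartVolume Ω x₀ := by
    ext S hS
    rw [Measure.restrict_apply hS, chartVolume_inter_source Ω x₀ hS]
  refine le_antisymm ?_ ?_
  -- It suffices to bound each member of the supremum. On U its mass lies in the overlap of the two
  -- charts, where the chart measures agree; off U it is bounded by the supremum itself. No
  -- countability of the family of charts is used.
  · have h1 : volumeMeasure Ω ≤ chartVolume Ω x₀ + (volumeMeasure Ω).restrict Uᶜ := by
      refine iSup_le fun x => Measure.le_iff.2 fun S hS => ?_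
      rw [Measure.add_apply, Measure.restrict_apply hS,
        ← measure_inter_add_sdiff S hUm (μ := chartVolume Ω x)]
      refine add_le_add ?_ ?_
      · rw [← chartVolume_inter_source Ω x (hS.inter hUm),
          chartVolume_eq_of_subset Ω (x₁ := x₀) ((hS.inter hUm).inter
            (measurableSet_extChartAt_source I x)) inter_subset_right
            (inter_subset_left.trans inter_subset_right)]
        exact measure_mono (inter_subset_left.trans inter_subset_left)
      · exact chartVolume_le Ω x _
    refine (Measure.restrict_mono le_rfl h1).trans ?_
    rw [Measure.restrict_add, hself, Measure.restrict_restrict hUm, inter_compl_self,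
      Measure.restrict_empty, add_zero]
  · rw [← hself]
    exact Measure.restrict_mono le_rfl (chartVolume_le Ω x₀)

/-- The density is continuous, hence bounded near the point, and a coordinate ball has finite
Lebesgue measure. -/
instance isLocallyFiniteMeasure_volumeMeasure (Ω : OrientedMetric I M) :
    IsLocallyFiniteMeasure (volumeMeasure Ω) := by
  refine ⟨fun x => ?_⟩
  have hx := mem_extChartAt_target (I := I) x
  have h1 : ∀ᶠ y in nhdsWithin (extChartAt I x x) (extChartAt I x).target,
      |chartDensity Ω x y| < |chartDensity Ω x (extChartAt I x x)| + 1 :=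
    ((continuousOn_chartDensity Ω x).abs _ hx).eventually_lt_const (lt_add_one _)
  obtain ⟨r, hr, hb⟩ := Metric.mem_nhdsWithin_iff.1 h1
  set U := (extChartAt I x).source ∩ extChartAt I x ⁻¹' Metric.ball (extChartAt I x x) r with hU
  have hUo : IsOpen U := isOpen_extChartAt_preimage' x Metric.isOpen_ball
  refine ⟨U, hUo.mem_nhds ⟨mem_extChartAt_source x, Metric.mem_ball_self hr⟩, ?_⟩
  rw [show volumeMeasure Ω U = chartVolume Ω x U by
    rw [← restrict_volumeMeasure, Measure.restrict_apply hUo.measurableSet,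
      inter_eq_left.2 inter_subset_left], chartVolume_apply Ω x hUo.measurableSet]
  have hsub : (extChartAt I x).target ∩ (extChartAt I x).symm ⁻¹' U ⊆
      (extChartAt I x).target ∩ Metric.ball (extChartAt I x x) r := by
    rintro y ⟨hy, hyU⟩
    refine ⟨hy, ?_⟩
    have := hyU.2
    rwa [mem_preimage, (extChartAt I x).right_inv hy] at this
  calc _ ≤ ∫⁻ y in (extChartAt I x).target ∩ (extChartAt I x).symm ⁻¹' U,
        ENNReal.ofReal (|chartDensity Ω x (extChartAt I x x)| + 1) := by
        refine setLIntegral_mono' (measurableSet_target_inter_preimage I x hUo.measurableSet)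
          fun y hy => ENNReal.ofReal_le_ofReal ?_
        exact le_of_lt (hb ⟨(hsub hy).2, hy.1⟩)
    _ = ENNReal.ofReal (|chartDensity Ω x (extChartAt I x x)| + 1) *
        volume ((extChartAt I x).target ∩ (extChartAt I x).symm ⁻¹' U) := setLIntegral_const _ _
    _ < ⊤ := ENNReal.mul_lt_top ENNReal.ofReal_lt_top
        ((measure_mono (hsub.trans inter_subset_right)).trans_lt measure_ball_lt_top)

/-- The density vanishes nowhere on the chart target, so a null open set would have a Lebesgue-null
coordinate image. -/
instance isOpenPosMeasure_volumeMeasure (Ω : OrientedMetric I M) :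
    (volumeMeasure Ω).IsOpenPosMeasure := by
  refine ⟨fun U hU ⟨x, hx⟩ h0 => ?_⟩
  have h1 : chartVolume Ω x U = 0 := le_antisymm ((chartVolume_le Ω x U).trans_eq h0) bot_le
  rw [chartVolume_apply Ω x hU.measurableSet, lintegral_eq_zero_iff' (by
    refine (aemeasurable_chartDensity Ω x).abs.ennreal_ofReal.mono_measure ?_
    exact Measure.restrict_mono inter_subset_left le_rfl)] at h1
  have h2 : volume ((extChartAt I x).target ∩ (extChartAt I x).symm ⁻¹' U) = 0 := by
    rw [Filter.EventuallyEq, ae_restrict_iff' (measurableSet_target_inter_preimage I x hU.measurableSet)]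
      at h1
    rw [ae_iff] at h1
    refine measure_mono_null ?_ h1
    intro y hy
    rw [mem_ofPred_eq]
    intro hy'
    have h3 := hy' hy
    simp only [Pi.zero_apply, ENNReal.ofReal_eq_zero, abs_nonpos_iff] at h3
    exact chartDensity_ne_zero Ω hy.1 h3
  have hmem : (extChartAt I x).target ∩ (extChartAt I x).symm ⁻¹' U ∈
      nhdsWithin (extChartAt I x x) (range I) := by
    refine Filter.inter_mem (extChartAt_target_mem_nhdsWithin x) (nhdsWithin_le_nhds ?_)
    have h4 : ContinuousAt (extChartAt I x).symm (extChartAt I x x) := continuousAt_extChartAt_symm x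
    exact h4.preimage_mem_nhds (by rw [extChartAt_to_inv]; exact hU.mem_nhds hx)
  obtain ⟨V, hVo, hVx, hV⟩ := mem_nhdsWithin.1 hmem
  -- At a boundary point the coordinate image is only relatively open in the range of the model. It
  -- still contains a nonempty open subset of ℝⁿ, since the range lies in the closure of its
  -- interior.
  have hcl := I.range_subset_closure_interior (extChartAt_target_subset_range x
    (mem_extChartAt_target x))
  have hne : (V ∩ interior (range I)).Nonempty := mem_closure_iff.1 hcl V hVo hVx
  refine ((hVo.inter isOpen_interior).measure_pos volume hne).ne' (measure_mono_null ?_ h2)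
  exact (inter_subset_inter_right _ interior_subset).trans hV

end Measure

end Volume

/-! ### Integrals of exact forms on Euclidean space -/

section Euclidean

variable {m : ℕ} {W : Type*} [NormedAddCommGroup W] [NormedSpace ℝ W]

/-- Integration by parts against the constant function 1. -/
lemma integral_fderiv_eq_zero {E : Type*} [NormedAddCommGroup E] [NormedSpace ℝ E]
    [FiniteDimensional ℝ E] [MeasurableSpace E] [BorelSpace E] (μ : Measure E) [μ.IsAddHaarMeasure]
    {f : E → W} (hf : ContDiff ℝ ∞ f) (hs : HasCompactSupport f) (v : E) :
    Integrable (fun x => fderiv ℝ f x v) μ ∧ ∫ x, fderiv ℝ f x v ∂μ = 0 := by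
  have h1 : Continuous fun x => fderiv ℝ f x v :=
    (hf.continuous_fderiv (by simp)).clm_apply continuous_const
  have h2 : HasCompactSupport fun x => fderiv ℝ f x v := hs.fderiv_apply ℝ v
  have h3 : Integrable (fun x => fderiv ℝ f x v) μ := h1.integrable_of_hasCompactSupport h2
  refine ⟨h3, ?_⟩
  have h4 := integral_smul_fderiv_eq_neg_fderiv_smul_of_integrable (μ := μ) (𝕜 := ℝ)
    (f := fun _ => (1 : ℝ)) (g := f) (v := v) (by simp) (by simpa using h3)
    (by simpa using hf.continuous.integrable_of_hasCompactSupport hs)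
    (fun x _ => differentiableAt_const _) (fun x _ => (hf.differentiable (by simp)) x)
  simpa using h4

lemma integral_extDeriv_eq_zero {ψ : Vec (m + 1) → Vec (m + 1) [⋀^Fin m]→L[ℝ] W}
    (hψ : ContDiff ℝ ∞ ψ) (hs : HasCompactSupport ψ) (v : Fin (m + 1) → Vec (m + 1)) :
    ∫ y, extDeriv ψ y v = 0 := by
  have h1 (i : Fin (m + 1)) := integral_fderiv_eq_zero (volume : Measure (Vec (m + 1)))
    (f := fun y => ψ y (i.removeNth v))
    ((ContinuousAlternatingMap.apply ℝ (Vec (m + 1)) W (i.removeNth v)).contDiff.comp hψ)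
    (hs.comp_left (g := fun f : Vec (m + 1) [⋀^Fin m]→L[ℝ] W => f (i.removeNth v)) rfl) (v i)
  simp_rw [extDeriv_apply (hψ.differentiable (by simp) _), ← Int.cast_smul_eq_zsmul ℝ]
  rw [integral_finsetSum]
  · refine Finset.sum_eq_zero fun i _ => ?_
    rw [integral_smul, (h1 i).2, smul_zero]
  · exact fun i _ => Integrable.smul _ (h1 i).1

end Euclidean

/-! ### Stokes' theorem for compact support in the interior -/

section Stokes

variable {n : ℕ} {H : Type*} [TopologicalSpace H] {I : ModelWithCorners ℝ (Vec n) H}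
  {M : Type*} [TopologicalSpace M] [ChartedSpace H M] [IsManifold I ∞ M]
  {W : Type*} [NormedAddCommGroup W] [NormedSpace ℝ W]

lemma SmoothField.smul_fun {q : ℕ} {θ : M → Vec n [⋀^Fin q]→L[ℝ] W} {f : M → ℝ}
    (hf : ContMDiff I 𝓘(ℝ) ∞ f) (hθ : SmoothField I θ) : SmoothField I fun x => f x • θ x := by
  intro x₀
  have h1 : ContDiffOn ℝ ∞ (fun y => f ((extChartAt I x₀).symm y)) (extChartAt I x₀).target :=
    (hf.comp_contMDiffOn (contMDiffOn_extChartAt_symm x₀)).contDiffOn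
  exact h1.smul (hθ x₀)

lemma IsSmoothForm.smul_fun {p : ℤ} {η : DForm n M W p} {f : M → ℝ}
    (hf : ContMDiff I 𝓘(ℝ) ∞ f) (hη : IsSmoothForm I η) :
    IsSmoothForm I (fun q x => f x • η q x : DForm n M W p) :=
  fun q => SmoothField.smul_fun hf (hη q)

lemma IsSmoothForm.sum {p : ℤ} {ι : Type*} (F : Finset ι) {η : ι → DForm n M W p}
    (hη : ∀ i, IsSmoothForm I (η i)) : IsSmoothForm I (∑ i ∈ F, η i) := by
  classical
  induction F using Finset.induction_on with
  | empty => exact fun _ _ => contDiffOn_const (c := 0)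
  | insert i F hi ih =>
    rw [Finset.sum_insert hi]
    exact fun q => SmoothField.add (hη i q) (ih q)

lemma extD_sum [FiniteDimensional ℝ W] {p r : ℤ} (h : p + 1 = r) {ι : Type*} (F : Finset ι)
    {η : ι → DForm n M W p}
    (hη : ∀ i, IsSmoothForm I (η i)) : extD I h (∑ i ∈ F, η i) = ∑ i ∈ F, extD I h (η i) := by
  classical
  induction F using Finset.induction_on with
  | empty => exact extD_zero h
  | insert i F hi ih =>
    rw [Finset.sum_insert hi, Finset.sum_insert hi, extD_add h (hη i) (IsSmoothForm.sum F hη), ih]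

lemma topCoeff_sum (Ω : OrientedMetric I M) {ι : Type*} (F : Finset ι) (η : ι → DForm n M W n)
    (x : M) : topCoeff Ω (∑ i ∈ F, η i) x = ∑ i ∈ F, topCoeff Ω (η i) x := by
  simp only [topCoeff, Finset.sum_apply, ContinuousAlternatingMap.sum_apply, Finset.smul_sum]

lemma eq_zero_of_notMem_formSupp {p : ℤ} {η : DForm n M W p} {x : M} (hx : x ∉ formSupp η)
    (q : {q : ℕ // (q : ℤ) = p}) : η q x = 0 := by
  by_contra h
  exact hx (subset_closure ⟨q, h⟩)

lemma extD_eq_zero_of_notMem_formSupp {p r : ℤ} (h : p + 1 = r) {η : DForm n M W p} {x : M}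
    (hx : x ∉ formSupp η) (q : {q : ℕ // (q : ℤ) = r}) : extD I h η q x = 0 := by
  rcases q with ⟨q, hq⟩
  cases q with
  | zero => rfl
  | succ q =>
    have hq' : (q : ℤ) = p := by push_cast at hq; omega
    rw [extD_apply_succ h η hq' hq]
    have h1 : η ⟨q, hq'⟩ =ᶠ[nhds x] 0 := by
      filter_upwards [isClosed_closure.isOpen_compl.mem_nhds hx] with z hz
      exact eq_zero_of_notMem_formSupp hz _
    rw [fieldD_congr h1]
    have h2 := fieldD_smul (I := I) (0 : ℝ) (0 : M → Vec n [⋀^Fin q]→L[ℝ] W)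
    rw [zero_smul, zero_smul] at h2
    rw [h2]
    rfl

variable [MeasurableSpace M] [BorelSpace M] [SecondCountableTopology M]

lemma integrable_topCoeff [FiniteDimensional ℝ W] (Ω : OrientedMetric I M) {η : DForm n M W n}
    (hη : IsSmoothForm I η) {K : Set M} (hK : IsCompact K) (hKc : IsClosed K)
    (h0 : ∀ x ∉ K, ∀ q, η q x = 0) : Integrable (topCoeff Ω η) (volumeMeasure Ω) := by
  have hz : ∀ x ∉ K, topCoeff Ω η x = 0 := fun x hx => by simp [topCoeff, h0 x hx]
  refine (continuous_topCoeff Ω hη).integrable_of_hasCompactSupport ?_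
  exact hK.of_isClosed_subset isClosed_closure (closure_minimal
    (fun x hx => by_contra fun h => hx (hz x h)) hKc)

variable [FiniteDimensional ℝ W]

lemma setIntegral_source (Ω : OrientedMetric I M) (x₀ : M) {g : M → W} (hg : Continuous g) :
    ∫ x in (extChartAt I x₀).source, g x ∂(volumeMeasure Ω) =
      ∫ y in (extChartAt I x₀).target, |chartDensity Ω x₀ y| • g ((extChartAt I x₀).symm y) := by
  have hm := aemeasurable_chartDensity Ω x₀
  rw [restrict_volumeMeasure, chartVolume, integral_map
    ((aemeasurable_extChartAt_symm x₀).mono_ac (withDensity_absolutelyContinuous _ _))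
    hg.aestronglyMeasurable]
  change (∫ y, g ((extChartAt I x₀).symm y) ∂(volume.restrict (extChartAt I x₀).target).withDensity
    fun y => ENNReal.ofReal |chartDensity Ω x₀ y|) = _
  rw [integral_withDensity_eq_integral_toReal_smul₀ hm.abs.ennreal_ofReal
    (Filter.Eventually.of_forall fun _ => ENNReal.ofReal_lt_top)]
  refine integral_congr_ae (Filter.Eventually.of_forall fun y => ?_)
  simp only [ENNReal.toReal_ofReal (abs_nonneg _)]

/-- The density is continuous without zeros, so it has one sign on a connected set. A chart target
may be disconnected and a chart may reverse the orientation, hence the restriction to B and the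
unspecified constant. -/
lemma exists_sign_chartDensity (Ω : OrientedMetric I M) {x₀ : M} {B : Set (Vec n)}
    (hB : IsPreconnected B) (hBt : B ⊆ (extChartAt I x₀).target) :
    ∃ s : ℝ, ∀ y ∈ B, |chartDensity Ω x₀ y| * (chartDensity Ω x₀ y)⁻¹ = s := by
  by_cases h : ∃ y ∈ B, chartDensity Ω x₀ y < 0
  · obtain ⟨y₀, hy₀, hneg⟩ := h
    refine ⟨-1, fun y hy => ?_⟩
    have h1 : chartDensity Ω x₀ y < 0 := by
      by_contra h2
      obtain ⟨y', hy', h3⟩ := hB.intermediate_value hy₀ hy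
        ((continuousOn_chartDensity Ω x₀).mono hBt) ⟨hneg.le, not_lt.1 h2⟩
      exact chartDensity_ne_zero Ω (hBt hy') h3
    rw [abs_of_neg h1, neg_mul, mul_inv_cancel₀ h1.ne]
  · push Not at h
    refine ⟨1, fun y hy => ?_⟩
    rw [abs_of_nonneg (h y hy), mul_inv_cancel₀ (chartDensity_ne_zero Ω (hBt hy))]

/-- In the chart the integral becomes a constant sign times the integral over ℝⁿ of the exterior
derivative of a compactly supported form, which is zero. -/
lemma integral_topCoeff_extD_of_subset_chart [T2Space M] (Ω : OrientedMetric I M) {p : ℤ}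
    (hp : p + 1 = n) {η : DForm n M W p} (hη : IsSmoothForm I η) (hK : IsCompact (formSupp η))
    {x₀ : M} {B : Set (Vec n)} (hB : IsPreconnected B) (hBo : IsOpen B)
    (hBt : B ⊆ (extChartAt I x₀).target)
    (hKB : formSupp η ⊆ (extChartAt I x₀).source ∩ extChartAt I x₀ ⁻¹' B) :
    ∫ x, topCoeff Ω (extD I hp η) x ∂(volumeMeasure Ω) = 0 := by
  classical
  cases n with
  | zero =>
    refine integral_eq_zero_of_ae (Filter.Eventually.of_forall fun x => ?_)
    simp [topCoeff, extD]
  | succ m =>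
  have hm : (m : ℤ) = p := by push_cast at hp; omega
  set θ := η ⟨m, hm⟩ with hθ
  have hθs : SmoothField I θ := hη.field hm
  have hsub := hKB.trans inter_subset_left
  -- Extension by zero is smooth on all of ℝⁿ, since the support is a compact subset of the open set
  -- B.
  set ψ : Vec (m + 1) → Vec (m + 1) [⋀^Fin m]→L[ℝ] W :=
    fun y => if y ∈ B then inChart I θ x₀ y else 0 with hψ
  have hψB : ∀ y ∈ B, ψ =ᶠ[nhds y] inChart I θ x₀ := fun y hy => by
    filter_upwards [hBo.mem_nhds hy] with y' hy'
    exact if_pos hy'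
  set K' := extChartAt I x₀ '' formSupp η with hK'
  have hK'c : IsCompact K' := hK.image_of_continuousOn ((continuousOn_extChartAt x₀).mono hsub)
  have hψ0 : ∀ y ∉ K', ψ y = 0 := by
    intro y hy
    by_cases hyB : y ∈ B
    · have hyt := hBt hyB
      rw [hψ]
      simp only [hyB, if_true]
      rw [← (extChartAt I x₀).right_inv hyt,
        inChart_eq_zero_iff θ ((extChartAt I x₀).map_target hyt)]
      exact eq_zero_of_notMem_formSupp (fun h => hy ⟨_, h, (extChartAt I x₀).right_inv hyt⟩) _
    · exact if_neg hyB
  have hψ0' : ∀ y ∉ K', ψ =ᶠ[nhds y] 0 := fun y hy => by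
    filter_upwards [hK'c.isClosed.isOpen_compl.mem_nhds hy] with y' hy'
    exact hψ0 y' hy'
  have hK'B : K' ⊆ B := by
    rintro _ ⟨z, hz, rfl⟩
    exact (hKB hz).2
  have hcd : ContDiff ℝ ∞ ψ := by
    refine contDiff_iff_contDiffAt.2 fun y => ?_
    by_cases hy : y ∈ K'
    · exact ((hθs x₀).contDiffAt (Filter.mem_of_superset (hBo.mem_nhds (hK'B hy)) hBt)).congr_of_eventuallyEq
        (hψB y (hK'B hy))
    · exact contDiffAt_const.congr_of_eventuallyEq (hψ0' y hy)
  have hcs : HasCompactSupport ψ := HasCompactSupport.intro hK'c hψ0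
  have hD0 : ∀ y ∉ K', extDeriv ψ y = 0 := fun y hy => by
    rw [(hψ0' y hy).extDeriv_eq]
    simpa using extDeriv_smul (𝕜 := ℝ) 0 (0 : Vec (m + 1) → Vec (m + 1) [⋀^Fin m]→L[ℝ] W) (x := y)
  -- B is open in ℝⁿ and contained in the range of the model, so the derivative within the range is
  -- the ordinary one.
  have hDB : ∀ y ∈ B, inChart I (fieldD I θ) x₀ y = extDeriv ψ y := fun y hy => by
    rw [inChart_fieldD hθs (hBt hy), (hψB y hy).extDeriv_eq, extDerivWithin, extDeriv,
      fderivWithin_of_mem_nhds (Filter.mem_of_superset (hBo.mem_nhds hy)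
        (hBt.trans (extChartAt_target_subset_range x₀)))]
  obtain ⟨s, hs⟩ := exists_sign_chartDensity Ω hB hBt
  have htop0 : ∀ z ∉ formSupp η, topCoeff Ω (extD I hp η) z = 0 := fun z hz => by
    rw [topCoeff, extD_eq_zero_of_notMem_formSupp hp hz]
    simp
  rw [← setIntegral_eq_integral_of_forall_compl_eq_zero
    (s := (extChartAt I x₀).source) fun z hz => htop0 z fun h => hz (hsub h),
    setIntegral_source Ω x₀ (continuous_topCoeff Ω (hη.extD hp))]
  have hcongr : ∀ y ∈ (extChartAt I x₀).target, |chartDensity Ω x₀ y| •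
      topCoeff Ω (extD I hp η) ((extChartAt I x₀).symm y) = s • extDeriv ψ y stdVec := by
    intro y hy
    have hz := (extChartAt I x₀).map_target hy
    by_cases hyK : y ∈ K'
    · rw [topCoeff_eq Ω _ hz, (extChartAt I x₀).right_inv hy, smul_smul, hs y (hK'B hyK),
        ← hDB y (hK'B hyK)]
      rfl
    · rw [hD0 y hyK, htop0 _ fun h => hyK ⟨_, h, (extChartAt I x₀).right_inv hy⟩]
      simp
  rw [setIntegral_congr_fun (measurableSet_extChartAt_target I x₀) hcongr,
    setIntegral_eq_integral_of_forall_compl_eq_zero fun y hy => ?_, integral_smul,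
    integral_extDeriv_eq_zero hcd hcs, smul_zero]
  rw [hD0 y fun h => hy (hBt (hK'B h))]
  simp

/-- Stokes' theorem for forms with compact support in the interior. -/
theorem integral_topCoeff_extD [T2Space M] (Ω : OrientedMetric I M) {p : ℤ}
    (hp : p + 1 = n) {η : DForm n M W p} (hη : IsSmoothForm I η) (hK : IsCompact (formSupp η))
    (hKI : formSupp η ⊆ I.interior M) :
    ∫ x, topCoeff Ω (extD I hp η) x ∂(volumeMeasure Ω) = 0 := by
  classical
  have : LocallyCompactSpace H := I.locallyCompactSpace
  have : LocallyCompactSpace M := ChartedSpace.locallyCompactSpace H M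
  -- Interior points have coordinate balls, connected and open in ℝⁿ, inside the chart target. A
  -- partition of unity subordinate to these balls reduces to the case of one chart; by local
  -- finiteness only finitely many of its functions meet the compact support.
  have hball (x : I.interior M) : ∃ r > 0,
      Metric.ball (extChartAt I x.1 x.1) r ⊆ (extChartAt I x.1).target :=
    Metric.mem_nhds_iff.1 (mem_interior_iff_mem_nhds.1
      ((ModelWithCorners.isInteriorPoint_iff (I := I)).1 x.2))
  choose r hr hrB using hball
  set U : I.interior M → Set M := fun x => (extChartAt I x.1).source ∩
    extChartAt I x.1 ⁻¹' Metric.ball (extChartAt I x.1 x.1) (r x) with hU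
  have hUo (x : I.interior M) : IsOpen (U x) := isOpen_extChartAt_preimage' x.1 Metric.isOpen_ball
  obtain ⟨ρ, hρ⟩ := SmoothPartitionOfUnity.exists_isSubordinate I
    (isClosed_closure : IsClosed (formSupp η)) U hUo fun x hx => mem_iUnion.2
      ⟨⟨x, hKI hx⟩, mem_extChartAt_source x, Metric.mem_ball_self (hr _)⟩
  have hfin := ρ.locallyFinite.finite_nonempty_inter_compact hK
  set F := hfin.toFinset with hF
  set ζ : I.interior M → DForm n M W p := fun i q x => ρ i x • η q x with hζ
  have hζs (i : I.interior M) : IsSmoothForm I (ζ i) := hη.smul_fun (ρ i).contMDiff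
  have hζsub (i : I.interior M) : formSupp (ζ i) ⊆ formSupp η ∩ tsupport (ρ i) := by
    refine closure_minimal ?_ (isClosed_closure.inter isClosed_closure)
    rintro x ⟨q, hq⟩
    exact ⟨subset_closure ⟨q, right_ne_zero_of_smul hq⟩,
      subset_closure (left_ne_zero_of_smul hq)⟩
  have hζK (i : I.interior M) : IsCompact (formSupp (ζ i)) :=
    hK.of_isClosed_subset isClosed_closure ((hζsub i).trans inter_subset_left)
  have hsum : η = ∑ i ∈ F, ζ i := by
    refine dform_ext fun q hq x => ?_
    rw [Finset.sum_apply, Finset.sum_apply]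
    simp only [hζ]
    rw [← Finset.sum_smul]
    by_cases hx : x ∈ formSupp η
    · have h1 := ρ.sum_eq_one hx
      rw [finsum_eq_sum_of_support_subset (s := F)] at h1
      · rw [h1, one_smul]
      · intro i hi
        simp only [hF, Finite.coe_toFinset, mem_ofPred_eq]
        exact ⟨x, hi, hx⟩
    · rw [eq_zero_of_notMem_formSupp hx, smul_zero]
  rw [hsum, extD_sum hp F hζs]
  simp only [topCoeff_sum]
  rw [integral_finsetSum]
  · refine Finset.sum_eq_zero fun i _ => ?_
    exact integral_topCoeff_extD_of_subset_chart Ω hp (hζs i) (hζK i)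
      (convex_ball _ _).isPreconnected Metric.isOpen_ball (hrB i)
      (((hζsub i).trans inter_subset_right).trans (hρ i))
  · exact fun i _ => integrable_topCoeff Ω ((hζs i).extD hp) (hζK i) isClosed_closure
      fun x hx => extD_eq_zero_of_notMem_formSupp hp hx

end Stokes

/-! ### The fundamental lemma of the calculus of variations -/

section FundamentalLemma

variable {n : ℕ} {H : Type*} [TopologicalSpace H] {I : ModelWithCorners ℝ (Vec n) H}
  {M : Type*} [TopologicalSpace M] [ChartedSpace H M] [IsManifold I ∞ M]
  {V : Type*} [NormedAddCommGroup V] [NormedSpace ℝ V] [FiniteDimensional ℝ V]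
  {W : Type*} [NormedAddCommGroup W] [NormedSpace ℝ W] [FiniteDimensional ℝ W]
  {Z : Type*} [NormedAddCommGroup Z] [NormedSpace ℝ Z]

lemma contDiff_compContinuousLinearMap {q : ℕ} (a : Vec n [⋀^Fin q]→L[ℝ] V) :
    ContDiff ℝ ∞ fun L : Vec n →L[ℝ] Vec n => a.compContinuousLinearMap L := by
  rw [← contDiffOn_univ]
  refine contDiffOn_of_apply fun v => ?_
  rw [contDiffOn_univ]
  exact (a.toContinuousMultilinearMap.contDiff (n := ∞)).comp
    (contDiff_pi.2 fun i => contDiff_id.clm_apply contDiff_const)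

variable (I) in
/-- The form which is constant in the chart at `x₀`. -/
def chartForm (x₀ : M) {q : ℕ} (a : Vec n [⋀^Fin q]→L[ℝ] V) (z : M) : Vec n [⋀^Fin q]→L[ℝ] V :=
  a.compContinuousLinearMap (transition I z x₀ z)

lemma inChart_chartForm {x₀ x₁ : M} {q : ℕ} (a : Vec n [⋀^Fin q]→L[ℝ] V) {y : Vec n}
    (hy : y ∈ (extChartAt I x₁).target)
    (h : (extChartAt I x₁).symm y ∈ (extChartAt I x₀).source) :
    inChart I (chartForm I x₀ a) x₁ y = a.compContinuousLinearMap
      (fderivWithin ℝ (extChartAt I x₀ ∘ (extChartAt I x₁).symm) (range I) y) := by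
  ext v
  have h1 := transition_eq_fderivWithin (I := I) x₁ x₀ ((extChartAt I x₁).symm y)
  rw [(extChartAt I x₁).right_inv hy] at h1
  rw [← h1]
  simp only [inChart, chartForm, ContinuousAlternatingMap.compContinuousLinearMap_apply]
  congr 1
  ext1 i
  exact transition_comp ((extChartAt I x₁).map_target hy) (mem_extChartAt_source _) h _

lemma inChart_chartForm_self {x₀ : M} {q : ℕ} (a : Vec n [⋀^Fin q]→L[ℝ] V) {z : M}
    (hz : z ∈ (extChartAt I x₀).source) :
    inChart I (chartForm I x₀ a) x₀ (extChartAt I x₀ z) = a := by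
  ext v
  simp only [inChart, chartForm, ContinuousAlternatingMap.compContinuousLinearMap_apply,
    (extChartAt I x₀).left_inv hz]
  congr 1
  ext1 i
  exact transition_chartFrame hz _

/-- The form constant in one chart carries no information outside its domain. A factor f supported
there makes the product globally smooth: in any other chart it is either f times a pull-back under a
smooth coordinate change, or zero near the point. -/
lemma smoothField_smul_chartForm {x₀ : M} {q : ℕ} (a : Vec n [⋀^Fin q]→L[ℝ] V) {f : M → ℝ}
    (hf : ContMDiff I 𝓘(ℝ) ∞ f) (hs : tsupport f ⊆ (extChartAt I x₀).source) :
    SmoothField I fun z => f z • chartForm I x₀ a z := by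
  intro x₁ y hy
  have hcont := continuousAt_extChartAt_symm'' hy
  have hft : ContDiffOn ℝ ∞ (fun y => f ((extChartAt I x₁).symm y)) (extChartAt I x₁).target :=
    (hf.comp_contMDiffOn (contMDiffOn_extChartAt_symm x₁)).contDiffOn
  by_cases hz : (extChartAt I x₁).symm y ∈ tsupport f
  · have hz₀ := hs hz
    have hyr : y ∈ range I := extChartAt_target_subset_range x₁ hy
    have h1 : ContDiffWithinAt ℝ ∞ (extChartAt I x₀ ∘ (extChartAt I x₁).symm) (range I) y := by
      refine contDiffWithinAt_ext_coord_change x₀ x₁ ?_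
      rw [PartialEquiv.trans_source'', PartialEquiv.symm_symm, PartialEquiv.symm_target]
      exact ⟨_, ⟨(extChartAt I x₁).map_target hy, hz₀⟩, (extChartAt I x₁).right_inv hy⟩
    have h2 := h1.fderivWithin_right (m := ∞) I.uniqueDiffOn (by simp) hyr
    have h3 := ((contDiff_compContinuousLinearMap a).contDiffAt.comp_contDiffWithinAt y h2).mono
      (extChartAt_target_subset_range x₁)
    refine ((hft y hy).smul h3).congr_of_eventuallyEq_of_mem ?_ hy
    filter_upwards [self_mem_nhdsWithin, nhdsWithin_le_nhds (hcont.preimage_mem_nhds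
      ((isOpen_extChartAt_source x₀).mem_nhds hz₀))] with y' hy' hy'₀
    exact congrArg (fun A => f ((extChartAt I x₁).symm y') • A) (inChart_chartForm a hy' hy'₀)
  · refine (contDiffWithinAt_const (c := 0)).congr_of_eventuallyEq_of_mem ?_ hy
    filter_upwards [nhdsWithin_le_nhds (hcont.preimage_mem_nhds
      ((isClosed_tsupport f).isOpen_compl.mem_nhds hz))] with y' hy'
    have h4 : f ((extChartAt I x₁).symm y') = 0 := image_eq_zero_of_notMem_tsupport hy'
    simp only [inChart, h4, zero_smul]
    rfl

/-- The test forms only see interior points; density of the interior extends the conclusion to the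
boundary. -/
lemma mem_closure_interior (x : M) : x ∈ closure (I.interior M) := by
  refine mem_closure_iff.2 fun U hU hxU => ?_
  have hmem : (extChartAt I x).target ∩ (extChartAt I x).symm ⁻¹' U ∈
      nhdsWithin (extChartAt I x x) (range I) := by
    refine Filter.inter_mem (extChartAt_target_mem_nhdsWithin x) (nhdsWithin_le_nhds ?_)
    have h4 : ContinuousAt (extChartAt I x).symm (extChartAt I x x) := continuousAt_extChartAt_symm x
    exact h4.preimage_mem_nhds (by rw [extChartAt_to_inv]; exact hU.mem_nhds hxU)
  obtain ⟨V, hVo, hVx, hV⟩ := mem_nhdsWithin.1 hmem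
  have hcl := I.range_subset_closure_interior (extChartAt_target_subset_range x
    (mem_extChartAt_target x))
  obtain ⟨y, hyV, hyI⟩ := mem_closure_iff.1 hcl V hVo hVx
  obtain ⟨hyt, hyU⟩ := hV ⟨hyV, interior_subset hyI⟩
  refine ⟨(extChartAt I x).symm y, hyU, ?_⟩
  have := isManifold_one I M
  have hz : (extChartAt I x).symm y ∈ (chartAt H x).source := by
    have := (extChartAt I x).map_target hyt
    rwa [extChartAt_source] at this
  -- Being an interior point refers to the preferred chart at the point itself; on a C¹ manifold any
  -- chart of the atlas may be used instead.
  refine (ModelWithCorners.isInteriorPoint_iff_of_mem_atlas (n := 1) one_ne_zero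
    (chart_mem_atlas H x) hz).2 ?_
  change extChartAt I x ((extChartAt I x).symm y) ∈ interior (extChartAt I x).target
  rw [(extChartAt I x).right_inv hyt]
  refine mem_interior_iff_mem_nhds.2 ?_
  refine Filter.mem_of_superset ((hVo.inter isOpen_interior).mem_nhds ⟨hyV, hyI⟩) ?_
  exact fun y' hy' => (hV ⟨hy'.1, interior_subset hy'.2⟩).1

variable [MeasurableSpace M] [BorelSpace M] [SecondCountableTopology M] [T2Space M]
  [FiniteDimensional ℝ Z]

/-- The fundamental lemma of the calculus of variations, for forms. -/
theorem eq_zero_of_forall_integral_wedge (Ω : OrientedMetric I M) {b : V →L[ℝ] W →L[ℝ] Z}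
    (hb : ∀ y, (∀ x, b x y = 0) → y = 0) {p q : ℤ} (h : p + q = n) (hp : 0 ≤ p) {E : DForm n M W q}
    (hE : IsSmoothForm I E)
    (hint : ∀ α : DForm n M V p, IsSmoothForm I α → IsCompact (formSupp α) →
      formSupp α ⊆ I.interior M →
      ∫ x, topCoeff Ω (wedge b h α E) x ∂(volumeMeasure Ω) = 0) : E = 0 := by
  have : LocallyCompactSpace H := I.locallyCompactSpace
  have : LocallyCompactSpace M := ChartedSpace.locallyCompactSpace H M
  have hone := isManifold_one I M
  obtain ⟨P, rfl⟩ := Int.eq_ofNat_of_zero_le hp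
  refine dform_ext fun Q hQ x => ?_
  have hPQ : P + Q = n := by omega
  refine eq_zero_of_wedgeAlt_eq_zero hb hPQ (vol_stdVec_ne_zero Ω x) fun a => ?_
  -- T is the coefficient of a ∧ E relative to vol, with a constant in the chart at x. The test form
  -- f·a turns the hypothesis into ∫ f T = 0 for every f supported in U.
  set T : M → Z := fun z => (chartDensity Ω x (extChartAt I x z))⁻¹ •
    wedgeAlt b hPQ a (inChart I (E ⟨Q, hQ⟩) x (extChartAt I x z)) stdVec with hT
  have hTc : ContinuousOn T (extChartAt I x).source := by
    have hm := (extChartAt I x).mapsTo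
    refine ContinuousOn.smul (ContinuousOn.inv₀ ((continuousOn_chartDensity Ω x).comp
      (continuousOn_extChartAt x) hm) fun z hz => chartDensity_ne_zero Ω (hm hz)) ?_
    have h1 := (wedgeCLM b hPQ a).contDiff.comp_contDiffOn (hE.field hQ x)
    exact (contDiffOn_apply h1 stdVec).continuousOn.comp (continuousOn_extChartAt x) hm
  set U := (extChartAt I x).source ∩ I.interior M with hU
  have hUo : IsOpen U := (isOpen_extChartAt_source x).inter (I.isOpen_interior one_ne_zero)
  have hae : ∀ᵐ z ∂(volumeMeasure Ω), z ∈ U → T z = 0 := by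
    refine hUo.ae_eq_zero_of_integral_contMDiff_smul_eq_zero I
      ((hTc.mono inter_subset_left).locallyIntegrableOn hUo.measurableSet) fun f hf hfc hfU => ?_
    -- A form of degree P is indexed by a natural number equal to P. Placing a in degree P of a
    -- family defined in all degrees avoids transport along that equality.
    set c : ∀ q : ℕ, Vec n [⋀^Fin q]→L[ℝ] V := Function.update 0 P a with hc
    set α : DForm n M V P := fun q z => f z • chartForm I x (c q.1) z with hα
    have hsupp : formSupp α ⊆ tsupport f := by
      refine closure_mono ?_
      rintro z ⟨q, hq⟩
      exact left_ne_zero_of_smul hq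
    have h1 := hint α (fun q => smoothField_smul_chartForm _ hf (hfU.trans inter_subset_left))
      (hfc.of_isClosed_subset isClosed_closure hsupp) (hsupp.trans (hfU.trans inter_subset_right))
    rw [← h1]
    congr 1
    ext1 z
    by_cases hz : z ∈ (extChartAt I x).source
    · rw [topCoeff_eq Ω _ hz, smul_comm]
      congr 1
      have h2 : wedge b h α E ⟨n, rfl⟩ = fun z => wedgeAlt b hPQ (α ⟨P, rfl⟩ z) (E ⟨Q, hQ⟩ z) :=
        funext fun z => wedge_apply b h _ _ rfl hQ rfl hPQ z
      have h3 : inChart I (α ⟨P, rfl⟩) x (extChartAt I x z) = f z • a := by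
        have h4 := inChart_chartForm_self (c P) hz
        rw [hc, Function.update_self] at h4
        have h5 : inChart I (α ⟨P, rfl⟩) x (extChartAt I x z) =
            f ((extChartAt I x).symm (extChartAt I x z)) •
              inChart I (chartForm I x (c P)) x (extChartAt I x z) := rfl
        rw [h5, (extChartAt I x).left_inv hz, hc, Function.update_self, h4]
      rw [h2, inChart_wedge]
      simp only [h3, wedgeAlt_smul_left]
      rfl
    · have h2 : f z = 0 := image_eq_zero_of_notMem_tsupport fun h => hz (hfU h).1
      rw [h2, zero_smul, topCoeff, wedge_apply b h _ _ rfl hQ rfl hPQ]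
      simp [hα, h2, wedgeAlt_zero_left]
  -- Vanishing almost everywhere becomes vanishing everywhere on U, since T is continuous and
  -- nonempty open sets have positive volume.
  have hTU : EqOn T 0 U := Measure.eqOn_open_of_ae_eq (μ := volumeMeasure Ω)
    ((ae_restrict_iff' hUo.measurableSet).2 hae) hUo (hTc.mono inter_subset_left) continuousOn_const
  have hTx : T x = 0 := by
    by_contra hne
    have h1 : ∀ᶠ z in nhds x, T z ≠ 0 :=
      (hTc.continuousAt (extChartAt_source_mem_nhds x)).eventually_ne hne
    have h2 := mem_closure_iff_frequently.1 (mem_closure_interior (I := I) x)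
    obtain ⟨z, hz, hz1, hz2⟩ := (h2.and_eventually
      (h1.and (extChartAt_source_mem_nhds (I := I) x))).exists
    exact hz1 (hTU ⟨hz2, hz⟩)
  rw [hT] at hTx
  simp only [inChart_self] at hTx
  have h1 := (smul_eq_zero.1 hTx).resolve_left
    (inv_ne_zero (chartDensity_ne_zero Ω (mem_extChartAt_target x)))
  ext v
  rw [apply_eq_det_smul _ (EuclideanSpace.basisFun (Fin n) ℝ).toBasis v,
    show ((EuclideanSpace.basisFun (Fin n) ℝ).toBasis : Fin n → Vec n) = stdVec by
      ext1 i; simp [stdVec], h1, smul_zero]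
  rfl

end FundamentalLemma

/-! ### The Lagrangian, its expansion in t and its first variation -/

section FirstVariation

variable {n : ℕ} {H : Type*} [TopologicalSpace H] {I : ModelWithCorners ℝ (Vec n) H}
  {M : Type*} [TopologicalSpace M] [ChartedSpace H M] [IsManifold I ∞ M]
  {V : Type*} [NormedAddCommGroup V] [NormedSpace ℝ V]
  {W : Type*} [NormedAddCommGroup W] [NormedSpace ℝ W]
  {Z : Type*} [NormedAddCommGroup Z] [NormedSpace ℝ Z]

lemma wedge_neg_bilin (b : V →L[ℝ] W →L[ℝ] Z) {p q r : ℤ} (h : p + q = r) (α : DForm n M V p)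
    (β : DForm n M W q) : wedge (-b) h α β = -wedge b h α β := by
  have h1 : wedge (-b) h α β = wedge b h ((-1 : ℝ) • α) β := by
    by_cases hpq : p < 0 ∨ q < 0
    · rw [wedge_of_neg _ h _ _ hpq, wedge_of_neg _ h _ _ hpq]
    obtain ⟨P, rfl⟩ := Int.eq_ofNat_of_zero_le (by omega : 0 ≤ p)
    obtain ⟨Q, rfl⟩ := Int.eq_ofNat_of_zero_le (by omega : 0 ≤ q)
    refine dform_ext fun R hR x => ?_
    have hPQ : P + Q = R := by omega
    rw [wedge_apply _ h _ _ rfl rfl hR hPQ, wedge_apply _ h _ _ rfl rfl hR hPQ]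
    have h2 : mulAlt (-b) hPQ (α ⟨P, rfl⟩ x) (β ⟨Q, rfl⟩ x) =
        mulAlt b hPQ (((-1 : ℝ) • α) ⟨P, rfl⟩ x) (β ⟨Q, rfl⟩ x) := by
      ext v
      simp [mulAlt]
    rw [wedgeAlt, wedgeAlt, h2]
  rw [h1, wedge_smul_left, neg_one_smul]

/-- Graded commutativity with one additional sign, from the skew bracket. -/
lemma wedge_skew {br : V →L[ℝ] V →L[ℝ] V} (hbr : ∀ x y, br y x = -br x y) {p q r : ℤ}
    (h : p + q = r) (h' : q + p = r) (α : DForm n M V p) (β : DForm n M V q) {P Q : ℕ}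
    (hP : (P : ℤ) = p) (hQ : (Q : ℤ) = q) :
    wedge br h' β α = (-1 : ℝ) ^ (P * Q + 1) • wedge br h α β := by
  rw [wedge_comm (b := -br) (b' := br) (fun x y => by simp [hbr x y]) h h' α β hP hQ,
    wedge_neg_bilin, pow_succ, mul_neg_one, neg_smul, smul_neg]

lemma cast_wedge (b : V →L[ℝ] W →L[ℝ] Z) {p q r s : ℤ} (h : p + q = r) (hs : r = s)
    (α : DForm n M V p) (β : DForm n M W q) :
    DForm.cast hs (wedge b h α β) = wedge b (h.trans hs) α β := by
  subst hs
  rfl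

/-- Reconciles degrees such as n - 3 + 1 and n - 2, which are equal but not definitionally so. -/
lemma wedge_hodge_congr (Ω : OrientedMetric I M) (b : V →L[ℝ] W →L[ℝ] Z) {p s q q' r : ℤ}
    (h : s + q = r) (h₁ : p + q = n) (h' : s + q' = r) (h₁' : p + q' = n) (α : DForm n M V s)
    (β : DForm n M W p) : wedge b h α (hodge Ω h₁ β) = wedge b h' α (hodge Ω h₁' β) := by
  obtain rfl : q = q' := by omega
  rfl

lemma topCoeff_add (Ω : OrientedMetric I M) (η θ : DForm n M W n) :
    topCoeff Ω (η + θ) = topCoeff Ω η + topCoeff Ω θ := by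
  ext1 x
  simp [topCoeff]

lemma topCoeff_smul (Ω : OrientedMetric I M) (c : ℝ) (η : DForm n M W n) :
    topCoeff Ω (c • η) = c • topCoeff Ω η := by
  ext1 x
  simp [topCoeff, smul_comm c]

variable {𝔤 : Type*} [NormedAddCommGroup 𝔤] [NormedSpace ℝ 𝔤]
  {𝕜 : Type*} [RCLike 𝕜]

/-- The pairing `⟨a ∧ ∗a'⟩ + ⟨b ∧ ∗b'⟩` of pairs of a `2`-form and a `3`-form. -/
def pairing (Ω : OrientedMetric I M) (B : 𝔤 →L[ℝ] 𝔤 →L[ℝ] 𝕜)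
    (𝓜 𝓧 : DForm n M 𝔤 2 × DForm n M 𝔤 3) : DForm n M 𝕜 n :=
  wedge B (q := (n : ℤ) - 2) (by omega) 𝓜.1 (hodge Ω (by omega) 𝓧.1) +
    wedge B (q := (n : ℤ) - 3) (by omega) 𝓜.2 (hodge Ω (by omega) 𝓧.2)

lemma pairing_comm (Ω : OrientedMetric I M) {B : 𝔤 →L[ℝ] 𝔤 →L[ℝ] 𝕜} (hB : ∀ X Y, B X Y = B Y X)
    (𝓜 𝓧 : DForm n M 𝔤 2 × DForm n M 𝔤 3) : pairing Ω B 𝓜 𝓧 = pairing Ω B 𝓧 𝓜 := by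
  rw [pairing, pairing, wedge_hodge_comm Ω hB _ _ 𝓜.1, wedge_hodge_comm Ω hB _ _ 𝓜.2]

lemma pairing_add_left (Ω : OrientedMetric I M) (B : 𝔤 →L[ℝ] 𝔤 →L[ℝ] 𝕜)
    (𝓜 𝓜' 𝓧 : DForm n M 𝔤 2 × DForm n M 𝔤 3) :
    pairing Ω B (𝓜 + 𝓜') 𝓧 = pairing Ω B 𝓜 𝓧 + pairing Ω B 𝓜' 𝓧 := by
  simp only [pairing, Prod.fst_add, Prod.snd_add, wedge_add_left]
  abel

lemma pairing_smul_left (Ω : OrientedMetric I M) (B : 𝔤 →L[ℝ] 𝔤 →L[ℝ] 𝕜) (c : ℝ)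
    (𝓜 𝓧 : DForm n M 𝔤 2 × DForm n M 𝔤 3) :
    pairing Ω B (c • 𝓜) 𝓧 = c • pairing Ω B 𝓜 𝓧 := by
  simp only [pairing, Prod.smul_fst, Prod.smul_snd, wedge_smul_left, smul_add]

/-- By symmetry of the pairing the mixed terms combine, and every coefficient except the constant
one has 𝓟 or 𝓠, which have compact support for a variation, in its left slot. -/
lemma pairing_expand (Ω : OrientedMetric I M) {B : 𝔤 →L[ℝ] 𝔤 →L[ℝ] 𝕜} (hB : ∀ X Y, B X Y = B Y X)
    (𝓕 𝓟 𝓠 : DForm n M 𝔤 2 × DForm n M 𝔤 3) (t : ℝ) :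
    pairing Ω B (𝓕 + t • 𝓟 + t ^ 2 • 𝓠) (𝓕 + t • 𝓟 + t ^ 2 • 𝓠) =
      pairing Ω B 𝓕 𝓕 + t • (2 : ℝ) • pairing Ω B 𝓟 𝓕 +
        t ^ 2 • (pairing Ω B 𝓟 𝓟 + (2 : ℝ) • pairing Ω B 𝓠 𝓕) +
        t ^ 3 • (2 : ℝ) • pairing Ω B 𝓠 𝓟 + t ^ 4 • pairing Ω B 𝓠 𝓠 := by
  have h (𝓧 : DForm n M 𝔤 2 × DForm n M 𝔤 3) :
      pairing Ω B 𝓧 (𝓕 + t • 𝓟 + t ^ 2 • 𝓠) =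
        pairing Ω B 𝓧 𝓕 + t • pairing Ω B 𝓧 𝓟 + t ^ 2 • pairing Ω B 𝓧 𝓠 := by
    rw [pairing_comm Ω hB, pairing_add_left, pairing_add_left, pairing_smul_left,
      pairing_smul_left, pairing_comm Ω hB 𝓕, pairing_comm Ω hB 𝓟, pairing_comm Ω hB 𝓠]
  rw [pairing_add_left, pairing_add_left, pairing_smul_left, pairing_smul_left, h, h, h,
    pairing_comm Ω hB 𝓕 𝓟, pairing_comm Ω hB 𝓕 𝓠, pairing_comm Ω hB 𝓟 𝓠]
  module

variable (I) in
/-- The components `(F + k A², D A²)` of the generalized curvature. -/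
def curvPair (br : 𝔤 →L[ℝ] 𝔤 →L[ℝ] 𝔤) (k : ℝ) (A₁ : DForm n M 𝔤 1) (A₂ : DForm n M 𝔤 2) :
    DForm n M 𝔤 2 × DForm n M 𝔤 3 :=
  (curv I br A₁ + k • A₂, covD I br A₁ (by norm_num) A₂)

lemma gcurv_fst (br : 𝔤 →L[ℝ] 𝔤 →L[ℝ] 𝔤) (k : ℝ) (A₁ : DForm n M 𝔤 1) (A₂ : DForm n M 𝔤 2) :
    (gcurv I br k (A₁, A₂)).1 = (curvPair I br k A₁ A₂).1 := by
  have h : (1 : ℤ) + 1 = 2 := by norm_num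
  change extD I h A₁ + (((-1 : ℝ) ^ (1 + 1 : ℤ)) * k) • A₂ + (1 / 2 : ℝ) • wedge br h A₁ A₁ =
    extD I h A₁ + (1 / 2 : ℝ) • wedge br h A₁ A₁ + k • A₂
  rw [show ((-1 : ℝ) ^ (1 + 1 : ℤ)) = 1 by norm_num, one_mul]
  abel

/-- The two mixed terms of ½ 𝓐 ∧^[,] 𝓐 agree: the sign (-1)^1 of the generalized product cancels the
sign in A² ∧ A¹ = -A¹ ∧ A². -/
lemma gcurv_snd {br : 𝔤 →L[ℝ] 𝔤 →L[ℝ] 𝔤} (hbr : ∀ X Y, br Y X = -br X Y) (k : ℝ)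
    (A₁ : DForm n M 𝔤 1) (A₂ : DForm n M 𝔤 2) :
    (gcurv I br k (A₁, A₂)).2 = (curvPair I br k A₁ A₂).2 := by
  have h : (2 : ℤ) + 1 = 3 := by norm_num
  have h' : (1 : ℤ) + 2 = 3 := by norm_num
  have h1 : ((gcurv I br k (A₁, A₂)).2 : DForm n M 𝔤 3) = extD I h A₂ + (1 / 2 : ℝ) •
      (wedge br h' A₁ A₂ + ((-1 : ℝ) ^ (1 : ℤ)) • wedge br h A₂ A₁) := rfl
  have h2 : (curvPair I br k A₁ A₂).2 = extD I h A₂ + wedge br h' A₁ A₂ := rfl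
  refine h1.trans ?_
  rw [h2, wedge_skew hbr h' h A₁ A₂ (P := 1) (Q := 2) rfl rfl]
  norm_num
  module

lemma neg_one_zpow_mul_self (m : ℤ) : (-1 : ℝ) ^ m * (-1 : ℝ) ^ m = 1 := by
  rw [← mul_zpow]
  simp

/-- The generalized product with a factor of degree n - 3 and the generalized star of a 2-form both
contribute (-1)^(n-3), so their product is 1. -/
lemma lagrangian_snd (Ω : OrientedMetric I M) {br : 𝔤 →L[ℝ] 𝔤 →L[ℝ] 𝔤}
    (hbr : ∀ X Y, br Y X = -br X Y) (B : 𝔤 →L[ℝ] 𝔤 →L[ℝ] 𝕜) (k : ℝ) (A₁ : DForm n M 𝔤 1)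
    (A₂ : DForm n M 𝔤 2) (h : (n : ℤ) - 1 + 1 = n) :
    DForm.cast h (lagrangian Ω br B k (A₁, A₂)).2 =
      pairing Ω B (curvPair I br k A₁ A₂) (curvPair I br k A₁ A₂) := by
  set 𝓕 := curvPair I br k A₁ A₂ with h𝓕
  have h1 : DForm.cast h (lagrangian Ω br B k (A₁, A₂)).2 =
      DForm.cast h (wedge B (q := (n : ℤ) - 3 + 1) (by omega) (gcurv I br k (A₁, A₂)).1
        (hodge Ω (by omega) (gcurv I br k (A₁, A₂)).1)) +
      ((-1 : ℝ) ^ ((n : ℤ) - 3)) • DForm.cast h (wedge B (p := 2 + 1) (q := (n : ℤ) - 3) (by omega)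
        (gcurv I br k (A₁, A₂)).2
        (((-1 : ℝ) ^ ((n : ℤ) - 2 - 1)) • hodge Ω (q := (n : ℤ) - 3) (by omega) (gcurv I br k (A₁, A₂)).2)) := rfl
  rw [h1, gcurv_fst, gcurv_snd hbr, cast_wedge, cast_wedge, wedge_smul_right, smul_smul,
    show (n : ℤ) - 2 - 1 = n - 3 by omega, neg_one_zpow_mul_self, one_smul, pairing]
  congr 1
  exact wedge_hodge_congr Ω B _ _ _ _ _ _

/-! ### The Euler–Lagrange expressions -/

/-- `D ∗a + A² ∧ ∗b`. -/
def eulerLagrange₁ (Ω : OrientedMetric I M) (br : 𝔤 →L[ℝ] 𝔤 →L[ℝ] 𝔤) (A₁ : DForm n M 𝔤 1)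
    (A₂ : DForm n M 𝔤 2) (𝓕 : DForm n M 𝔤 2 × DForm n M 𝔤 3) {q s r : ℤ} (hq : 2 + q = n)
    (hs : 3 + s = n) (hr : 1 + r = n) : DForm n M 𝔤 r :=
  covD I br A₁ (r := r) (by omega) (hodge Ω hq 𝓕.1) + wedge br (by omega) A₂ (hodge Ω hs 𝓕.2)

/-- `k ∗a - D ∗b`. -/
def eulerLagrange₂ (Ω : OrientedMetric I M) (br : 𝔤 →L[ℝ] 𝔤 →L[ℝ] 𝔤) (k : ℝ) (A₁ : DForm n M 𝔤 1)
    (𝓕 : DForm n M 𝔤 2 × DForm n M 𝔤 3) {q s : ℤ} (hq : 2 + q = n) (hs : 3 + s = n) :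
    DForm n M 𝔤 q :=
  k • hodge Ω hq 𝓕.1 - covD I br A₁ (r := q) (by omega) (hodge Ω hs 𝓕.2)

variable (I) in
/-- The first-order part of the curvature of a varied connection. -/
def curvLin (br : 𝔤 →L[ℝ] 𝔤 →L[ℝ] 𝔤) (k : ℝ) (A₁ : DForm n M 𝔤 1) (A₂ : DForm n M 𝔤 2)
    (α : DForm n M 𝔤 1) (β : DForm n M 𝔤 2) : DForm n M 𝔤 2 × DForm n M 𝔤 3 :=
  (covD I br A₁ (by norm_num) α + k • β,
    covD I br A₁ (by norm_num) β + wedge br (by norm_num) α A₂)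

/-- The second-order part of the curvature of a varied connection. -/
def curvQuad (br : 𝔤 →L[ℝ] 𝔤 →L[ℝ] 𝔤) (α : DForm n M 𝔤 1) (β : DForm n M 𝔤 2) :
    DForm n M 𝔤 2 × DForm n M 𝔤 3 :=
  ((1 / 2 : ℝ) • wedge br (by norm_num) α α, wedge br (by norm_num) α β)

section Smooth

variable [FiniteDimensional ℝ 𝔤]

lemma IsSmoothForm.covD (br : 𝔤 →L[ℝ] 𝔤 →L[ℝ] 𝔤) {A : DForm n M 𝔤 1} {p r : ℤ} (h : p + 1 = r)
    {η : DForm n M 𝔤 p} (hA : IsSmoothForm I A) (hη : IsSmoothForm I η) :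
    IsSmoothForm I (covD I br A h η) :=
  (hη.extD h).add (hA.wedge br _ hη)

lemma covD_add (br : 𝔤 →L[ℝ] 𝔤 →L[ℝ] 𝔤) (A : DForm n M 𝔤 1) {p r : ℤ} (h : p + 1 = r)
    {η θ : DForm n M 𝔤 p} (hη : IsSmoothForm I η) (hθ : IsSmoothForm I θ) :
    covD I br A h (η + θ) = covD I br A h η + covD I br A h θ := by
  simp only [covD]
  rw [extD_add h hη hθ, wedge_add_right]
  abel

lemma covD_smul (br : 𝔤 →L[ℝ] 𝔤 →L[ℝ] 𝔤) (A : DForm n M 𝔤 1) {p r : ℤ} (h : p + 1 = r)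
    (c : ℝ) (η : DForm n M 𝔤 p) : covD I br A h (c • η) = c • covD I br A h η := by
  simp only [covD]
  rw [extD_smul h, wedge_smul_right, smul_add]

/-- The expansion is exact, the curvature being quadratic in the connection. For 1-forms the skew
bracket makes ∧ symmetric, so ½(A ∧ α + α ∧ A) = A ∧ α. -/
lemma curvPair_variation {br : 𝔤 →L[ℝ] 𝔤 →L[ℝ] 𝔤} (hbr : ∀ X Y, br Y X = -br X Y) (k : ℝ)
    {A₁ : DForm n M 𝔤 1} {A₂ : DForm n M 𝔤 2} (hA₁ : IsSmoothForm I A₁) (hA₂ : IsSmoothForm I A₂)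
    {α : DForm n M 𝔤 1} {β : DForm n M 𝔤 2} (hα : IsSmoothForm I α) (hβ : IsSmoothForm I β)
    (t : ℝ) : curvPair I br k (A₁ + t • α) (A₂ + t • β) =
      curvPair I br k A₁ A₂ + t • curvLin I br k A₁ A₂ α β + t ^ 2 • curvQuad br α β := by
  refine Prod.ext ?_ ?_
  · simp only [curvPair, curvLin, curvQuad, curv, covD, Prod.fst_add, Prod.smul_fst]
    rw [extD_add _ hA₁ (hα.const_smul t), extD_smul, wedge_add_left, wedge_add_right,
      wedge_add_right, wedge_smul_left, wedge_smul_right, wedge_smul_left, wedge_smul_right,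
      wedge_skew hbr (by norm_num : (1 : ℤ) + 1 = 2) _ A₁ α (P := 1) (Q := 1) rfl rfl]
    norm_num
    module
  · simp only [curvPair, curvLin, curvQuad, covD, Prod.snd_add, Prod.smul_snd]
    rw [extD_add _ hA₂ (hβ.const_smul t), extD_smul, wedge_add_left, wedge_add_right,
      wedge_add_right, wedge_smul_left, wedge_smul_right, wedge_smul_left, wedge_smul_right]
    module

lemma isSmoothForm_curvPair (br : 𝔤 →L[ℝ] 𝔤 →L[ℝ] 𝔤) (k : ℝ)
    {A₁ : DForm n M 𝔤 1} {A₂ : DForm n M 𝔤 2} (hA₁ : IsSmoothForm I A₁) (hA₂ : IsSmoothForm I A₂) :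
    IsSmoothForm I (curvPair I br k A₁ A₂).1 ∧ IsSmoothForm I (curvPair I br k A₁ A₂).2 :=
  ⟨((hA₁.extD _).add ((hA₁.wedge br _ hA₁).const_smul _)).add (hA₂.const_smul k),
    hA₁.covD br _ hA₂⟩

lemma isSmoothForm_curvLin (br : 𝔤 →L[ℝ] 𝔤 →L[ℝ] 𝔤) (k : ℝ)
    {A₁ : DForm n M 𝔤 1} {A₂ : DForm n M 𝔤 2} (hA₁ : IsSmoothForm I A₁) (hA₂ : IsSmoothForm I A₂)
    {α : DForm n M 𝔤 1} {β : DForm n M 𝔤 2} (hα : IsSmoothForm I α) (hβ : IsSmoothForm I β) :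
    IsSmoothForm I (curvLin I br k A₁ A₂ α β).1 ∧ IsSmoothForm I (curvLin I br k A₁ A₂ α β).2 :=
  ⟨(hA₁.covD br _ hα).add (hβ.const_smul k), (hA₁.covD br _ hβ).add (hα.wedge br _ hA₂)⟩

lemma isSmoothForm_curvQuad (br : 𝔤 →L[ℝ] 𝔤 →L[ℝ] 𝔤)
    {α : DForm n M 𝔤 1} {β : DForm n M 𝔤 2} (hα : IsSmoothForm I α) (hβ : IsSmoothForm I β) :
    IsSmoothForm I (curvQuad br α β).1 ∧ IsSmoothForm I (curvQuad br α β).2 :=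
  ⟨(hα.wedge br _ hα).const_smul _, hα.wedge br _ hβ⟩

lemma isSmoothForm_pairing (Ω : OrientedMetric I M) (B : 𝔤 →L[ℝ] 𝔤 →L[ℝ] 𝕜)
    {𝓜 𝓧 : DForm n M 𝔤 2 × DForm n M 𝔤 3} (h𝓜 : IsSmoothForm I 𝓜.1 ∧ IsSmoothForm I 𝓜.2)
    (h𝓧 : IsSmoothForm I 𝓧.1 ∧ IsSmoothForm I 𝓧.2) : IsSmoothForm I (pairing Ω B 𝓜 𝓧) :=
  (h𝓜.1.wedge B _ (h𝓧.1.hodge Ω _)).add (h𝓜.2.wedge B _ (h𝓧.2.hodge Ω _))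

/-- The first variation of the Lagrangian, up to an exact form. -/
lemma pairing_curvLin (Ω : OrientedMetric I M) {br : 𝔤 →L[ℝ] 𝔤 →L[ℝ] 𝔤}
    (hbr : ∀ X Y, br Y X = -br X Y) {B : 𝔤 →L[ℝ] 𝔤 →L[ℝ] 𝕜}
    (hinv : ∀ X Y Z, B (br X Y) Z = B X (br Y Z)) (k : ℝ)
    {A₁ : DForm n M 𝔤 1} {A₂ : DForm n M 𝔤 2}
    {α : DForm n M 𝔤 1} {β : DForm n M 𝔤 2} (hα : IsSmoothForm I α) (hβ : IsSmoothForm I β)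
    {𝓕 : DForm n M 𝔤 2 × DForm n M 𝔤 3} (h𝓕 : IsSmoothForm I 𝓕.1 ∧ IsSmoothForm I 𝓕.2) :
    pairing Ω B (curvLin I br k A₁ A₂ α β) 𝓕 =
      wedge B (by omega) α (eulerLagrange₁ Ω br A₁ A₂ 𝓕 (q := (n : ℤ) - 2) (s := (n : ℤ) - 3)
        (r := (n : ℤ) - 1) (by omega) (by omega) (by omega)) +
      wedge B (by omega) β (eulerLagrange₂ Ω br k A₁ 𝓕 (q := (n : ℤ) - 2) (s := (n : ℤ) - 3)
        (by omega) (by omega)) +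
      extD I (p := (n : ℤ) - 1) (by omega)
        (wedge B (by omega) α (hodge Ω (q := (n : ℤ) - 2) (by omega) 𝓕.1)) +
      extD I (p := (n : ℤ) - 1) (by omega)
        (wedge B (by omega) β (hodge Ω (q := (n : ℤ) - 3) (by omega) 𝓕.2)) := by
  -- Integration by parts: d⟨α ∧ ∗a⟩ = ⟨dα ∧ ∗a⟩ - ⟨α ∧ d∗a⟩ and d⟨β ∧ ∗b⟩ = ⟨dβ ∧ ∗b⟩ + ⟨β ∧ d∗b⟩.
  -- The different signs are those of D∗a and D∗b in the two Euler–Lagrange expressions.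
  rw [extD_wedge B _ _ (by norm_num : (1 : ℤ) + 1 = 2) (by omega : (n : ℤ) - 2 + 1 = n - 1) hα
      (h𝓕.1.hodge Ω _),
    extD_wedge B _ _ (by norm_num : (2 : ℤ) + 1 = 3) (by omega : (n : ℤ) - 3 + 1 = n - 2) hβ
      (h𝓕.2.hodge Ω _)]
  simp only [pairing, curvLin, covD, eulerLagrange₁, eulerLagrange₂]
  -- The variations move to the left: A¹ ∧ α = α ∧ A¹, but A¹ ∧ β = -β ∧ A¹.
  rw [wedge_skew hbr (by norm_num : (1 : ℤ) + 1 = 2) _ α A₁ (P := 1) (Q := 1) rfl rfl,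
    wedge_skew hbr (by norm_num : (2 : ℤ) + 1 = 3) _ β A₁ (P := 2) (Q := 1) rfl rfl]
  simp only [sub_eq_add_neg (k • _), ← neg_one_smul ℝ (extD I _ _ + _), wedge_add_left,
    wedge_add_right, wedge_smul_left, wedge_smul_right, smul_add]
  -- Invariance of B is the compatibility of bilinear maps required for associativity; it passes the
  -- bracket with A¹ or A² from the variation to the starred factor.
  rw [wedge_assoc hinv _ (by omega : (1 : ℤ) + (n - 2) = n - 1) _ (by omega) α A₁,
    wedge_assoc hinv _ (by omega : (1 : ℤ) + (n - 3) = n - 2) _ (by omega) β A₁,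
    wedge_assoc hinv _ (by omega : (2 : ℤ) + (n - 3) = n - 1) _ (by omega) α A₂]
  norm_num
  module

end Smooth

end FirstVariation

/-! ### Stationarity, the Euler–Lagrange equations and the generalized Yang–Mills equation -/

section Stationarity

variable {n : ℕ} {H : Type*} [TopologicalSpace H] {I : ModelWithCorners ℝ (Vec n) H}
  {M : Type*} [TopologicalSpace M] [ChartedSpace H M] [IsManifold I ∞ M]
  {V : Type*} [NormedAddCommGroup V] [NormedSpace ℝ V]
  {W : Type*} [NormedAddCommGroup W] [NormedSpace ℝ W]
  {Z : Type*} [NormedAddCommGroup Z] [NormedSpace ℝ Z]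
  {𝔤 : Type*} [NormedAddCommGroup 𝔤] [NormedSpace ℝ 𝔤]
  {𝕜 : Type*} [RCLike 𝕜]

lemma wedge_apply_eq_zero_left (b : V →L[ℝ] W →L[ℝ] Z) {p q r : ℤ} (h : p + q = r)
    {α : DForm n M V p} (β : DForm n M W q) {x : M} (hα : ∀ c, α c x = 0)
    (c : {c : ℕ // (c : ℤ) = r}) : wedge b h α β c x = 0 := by
  unfold wedge
  split_ifs
  · rw [hα, wedgeAlt_zero_left]
  · rfl

lemma wedge_apply_eq_zero_right (b : V →L[ℝ] W →L[ℝ] Z) {p q r : ℤ} (h : p + q = r)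
    (α : DForm n M V p) {β : DForm n M W q} {x : M} (hβ : ∀ c, β c x = 0)
    (c : {c : ℕ // (c : ℤ) = r}) : wedge b h α β c x = 0 := by
  unfold wedge
  split_ifs
  · rw [hβ, wedgeAlt_zero_right]
  · rfl

lemma formSupp_wedge_subset (b : V →L[ℝ] W →L[ℝ] Z) {p q r : ℤ} (h : p + q = r)
    (α : DForm n M V p) (β : DForm n M W q) : formSupp (wedge b h α β) ⊆ formSupp α := by
  refine closure_mono ?_
  rintro x ⟨c, hc⟩
  by_contra h0
  simp only [mem_ofPred_eq, not_exists, not_not] at h0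
  exact hc (wedge_apply_eq_zero_left b h β h0 c)

lemma formSupp_zero {p : ℤ} : formSupp (0 : DForm n M V p) = ∅ := by
  simp [formSupp]

lemma pairing_apply_eq_zero (Ω : OrientedMetric I M) (B : 𝔤 →L[ℝ] 𝔤 →L[ℝ] 𝕜)
    {𝓜 : DForm n M 𝔤 2 × DForm n M 𝔤 3} (𝓧 : DForm n M 𝔤 2 × DForm n M 𝔤 3) {x : M}
    (h₁ : ∀ c, 𝓜.1 c x = 0) (h₂ : ∀ c, 𝓜.2 c x = 0) (c : {c : ℕ // (c : ℤ) = n}) :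
    pairing Ω B 𝓜 𝓧 c x = 0 := by
  rw [pairing, Pi.add_apply, Pi.add_apply, wedge_apply_eq_zero_left _ _ _ h₁,
    wedge_apply_eq_zero_left _ _ _ h₂, add_zero]

lemma covD_apply_eq_zero (br : 𝔤 →L[ℝ] 𝔤 →L[ℝ] 𝔤) (A : DForm n M 𝔤 1) {p r : ℤ} (h : p + 1 = r)
    {η : DForm n M 𝔤 p} {x : M} (hx : x ∉ formSupp η) (c : {c : ℕ // (c : ℤ) = r}) :
    covD I br A h η c x = 0 := by
  rw [covD, Pi.add_apply, Pi.add_apply, extD_eq_zero_of_notMem_formSupp h hx,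
    wedge_apply_eq_zero_right _ _ _ (eq_zero_of_notMem_formSupp hx), add_zero]

lemma curvLin_apply_eq_zero (br : 𝔤 →L[ℝ] 𝔤 →L[ℝ] 𝔤) (k : ℝ) (A₁ : DForm n M 𝔤 1)
    (A₂ : DForm n M 𝔤 2) {α : DForm n M 𝔤 1} {β : DForm n M 𝔤 2} {x : M} (hα : x ∉ formSupp α)
    (hβ : x ∉ formSupp β) :
    (∀ c, (curvLin I br k A₁ A₂ α β).1 c x = 0) ∧ ∀ c, (curvLin I br k A₁ A₂ α β).2 c x = 0 := by
  refine ⟨fun c => ?_, fun c => ?_⟩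
  · change covD I br A₁ _ α c x + k • β c x = 0
    rw [covD_apply_eq_zero br A₁ _ hα, eq_zero_of_notMem_formSupp hβ, smul_zero, add_zero]
  · change covD I br A₁ _ β c x + wedge br _ α A₂ c x = 0
    rw [covD_apply_eq_zero br A₁ _ hβ,
      wedge_apply_eq_zero_left _ _ _ (eq_zero_of_notMem_formSupp hα), add_zero]

lemma curvQuad_apply_eq_zero (br : 𝔤 →L[ℝ] 𝔤 →L[ℝ] 𝔤) {α : DForm n M 𝔤 1} (β : DForm n M 𝔤 2)
    {x : M} (hα : x ∉ formSupp α) :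
    (∀ c, (curvQuad br α β).1 c x = 0) ∧ ∀ c, (curvQuad br α β).2 c x = 0 := by
  refine ⟨fun c => ?_, fun c => ?_⟩
  · change (1 / 2 : ℝ) • wedge br _ α α c x = 0
    rw [wedge_apply_eq_zero_left _ _ _ (eq_zero_of_notMem_formSupp hα), smul_zero]
  · exact wedge_apply_eq_zero_left br (by norm_num : (1 : ℤ) + 2 = 3) β
      (eq_zero_of_notMem_formSupp hα) c

variable [FiniteDimensional ℝ 𝔤]

lemma isSmoothForm_eulerLagrange₁ (Ω : OrientedMetric I M) (br : 𝔤 →L[ℝ] 𝔤 →L[ℝ] 𝔤)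
    {A₁ : DForm n M 𝔤 1} {A₂ : DForm n M 𝔤 2} (hA₁ : IsSmoothForm I A₁) (hA₂ : IsSmoothForm I A₂)
    {𝓕 : DForm n M 𝔤 2 × DForm n M 𝔤 3} (h𝓕 : IsSmoothForm I 𝓕.1 ∧ IsSmoothForm I 𝓕.2)
    {q s r : ℤ} (hq : 2 + q = n) (hs : 3 + s = n) (hr : 1 + r = n) :
    IsSmoothForm I (eulerLagrange₁ Ω br A₁ A₂ 𝓕 hq hs hr) :=
  (hA₁.covD br _ (h𝓕.1.hodge Ω _)).add (hA₂.wedge br _ (h𝓕.2.hodge Ω _))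

lemma isSmoothForm_eulerLagrange₂ (Ω : OrientedMetric I M) (br : 𝔤 →L[ℝ] 𝔤 →L[ℝ] 𝔤) (k : ℝ)
    {A₁ : DForm n M 𝔤 1} (hA₁ : IsSmoothForm I A₁)
    {𝓕 : DForm n M 𝔤 2 × DForm n M 𝔤 3} (h𝓕 : IsSmoothForm I 𝓕.1 ∧ IsSmoothForm I 𝓕.2)
    {q s : ℤ} (hq : 2 + q = n) (hs : 3 + s = n) :
    IsSmoothForm I (eulerLagrange₂ Ω br k A₁ 𝓕 hq hs) := by
  rw [eulerLagrange₂, sub_eq_add_neg, ← neg_one_smul ℝ (covD I br A₁ _ _)]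
  exact ((h𝓕.1.hodge Ω _).const_smul k).add ((hA₁.covD br _ (h𝓕.2.hodge Ω _)).const_smul _)

/-- A generalized connection, from its components. -/
def gconn (A₁ : DForm n M 𝔤 1) (A₂ : DForm n M 𝔤 2) : GForm n M 𝔤 1 := (A₁, A₂)

/-- The Euler–Lagrange expression of the action with respect to `A¹`. -/
def variation₁ (Ω : OrientedMetric I M) (br : 𝔤 →L[ℝ] 𝔤 →L[ℝ] 𝔤) (k : ℝ) (A₁ : DForm n M 𝔤 1)
    (A₂ : DForm n M 𝔤 2) : DForm n M 𝔤 ((n : ℤ) - 1) :=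
  eulerLagrange₁ Ω br A₁ A₂ (curvPair I br k A₁ A₂) (q := (n : ℤ) - 2) (s := (n : ℤ) - 3)
    (by omega) (by omega) (by omega)

/-- The Euler–Lagrange expression of the action with respect to `A²`. -/
def variation₂ (Ω : OrientedMetric I M) (br : 𝔤 →L[ℝ] 𝔤 →L[ℝ] 𝔤) (k : ℝ) (A₁ : DForm n M 𝔤 1)
    (A₂ : DForm n M 𝔤 2) : DForm n M 𝔤 ((n : ℤ) - 2) :=
  eulerLagrange₂ Ω br k A₁ (curvPair I br k A₁ A₂) (s := (n : ℤ) - 3) (by omega) (by omega)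

lemma equation₁_iff (Ω : OrientedMetric I M) (br : 𝔤 →L[ℝ] 𝔤 →L[ℝ] 𝔤) (k : ℝ)
    {A₁ : DForm n M 𝔤 1} {A₂ : DForm n M 𝔤 2} (hA₁ : IsSmoothForm I A₁) (hA₂ : IsSmoothForm I A₂) :
    Equation₁ Ω br k A₁ A₂ ↔ variation₁ Ω br k A₁ A₂ = 0 := by
  have hF : IsSmoothForm I (curv I br A₁) :=
    (hA₁.extD _).add ((hA₁.wedge br _ hA₁).const_smul _)
  rw [Equation₁, variation₁, eulerLagrange₁, curvPair, hodge_add, hodge_smul,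
    covD_add br A₁ _ (hF.hodge Ω _) ((hA₂.hodge Ω _).const_smul k), covD_smul]

lemma equation₂_iff (Ω : OrientedMetric I M) (br : 𝔤 →L[ℝ] 𝔤 →L[ℝ] 𝔤) (k : ℝ)
    (A₁ : DForm n M 𝔤 1) (A₂ : DForm n M 𝔤 2) :
    Equation₂ Ω br k A₁ A₂ ↔ variation₂ Ω br k A₁ A₂ = 0 := by
  rw [Equation₂, variation₂, eulerLagrange₂, curvPair, hodge_add, hodge_smul, smul_add, smul_smul, pow_two]

lemma eulerLagrange₁_eq_zero_congr (Ω : OrientedMetric I M) (br : 𝔤 →L[ℝ] 𝔤 →L[ℝ] 𝔤)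
    (A₁ : DForm n M 𝔤 1) (A₂ : DForm n M 𝔤 2) (𝓕 : DForm n M 𝔤 2 × DForm n M 𝔤 3)
    {q s r q' s' r' : ℤ} (hq : 2 + q = n) (hs : 3 + s = n) (hr : 1 + r = n)
    (hq' : 2 + q' = n) (hs' : 3 + s' = n) (hr' : 1 + r' = n) :
    eulerLagrange₁ Ω br A₁ A₂ 𝓕 hq hs hr = 0 ↔ eulerLagrange₁ Ω br A₁ A₂ 𝓕 hq' hs' hr' = 0 := by
  obtain rfl : q = q' := by omega
  obtain rfl : s = s' := by omega
  obtain rfl : r = r' := by omega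
  rfl

lemma cast_hodge (Ω : OrientedMetric I M) {p q r : ℤ} (h : p + q = n) (hr : q = r)
    (α : DForm n M W p) : DForm.cast hr (hodge Ω h α) = hodge Ω (by omega) α := by
  subst hr
  rfl

/-- With ε = (-1)^(n-3), ⋆𝓕 = (ε ∗b, ∗a). The second component of 𝓓⋆𝓕 is D∗a + ε² A² ∧ ∗b, and ε² =
1. The first is ε D∗b - ε k ∗a, that is, -ε times the expression for A². -/
lemma generalizedYangMills_iff (Ω : OrientedMetric I M) {br : 𝔤 →L[ℝ] 𝔤 →L[ℝ] 𝔤}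
    (hbr : ∀ X Y, br Y X = -br X Y) (k : ℝ) (A₁ : DForm n M 𝔤 1) (A₂ : DForm n M 𝔤 2) :
    GeneralizedYangMills Ω br k (A₁, A₂) ↔
      variation₁ Ω br k A₁ A₂ = 0 ∧ variation₂ Ω br k A₁ A₂ = 0 := by
  set ε : ℝ := (-1 : ℝ) ^ ((n : ℤ) - 3) with hε
  have hεε : ε * ε = 1 := neg_one_zpow_mul_self _
  have hε' : (-1 : ℝ) ^ ((n : ℤ) - 3 + 1) = -ε := by
    rw [zpow_add₀ (by norm_num), zpow_one, mul_neg_one]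
  set 𝓕 := curvPair I br k A₁ A₂ with h𝓕
  have d₁ : (2 : ℤ) + ((n : ℤ) - 3 + 1) = n := by omega
  have d₂ : (3 : ℤ) + ((n : ℤ) - 3) = n := by omega
  have d₃ : (1 : ℤ) + ((n : ℤ) - 2 + 1) = n := by omega
  have d₄ : (n : ℤ) - 3 + 1 + 1 = (n : ℤ) - 2 + 1 := by omega
  have d₅ : (1 : ℤ) + ((n : ℤ) - 3 + 1) = (n : ℤ) - 2 + 1 := by omega
  have d₆ : (2 : ℤ) + ((n : ℤ) - 3) = (n : ℤ) - 2 + 1 := by omega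
  have d₇ : (n : ℤ) - 3 + 1 = (n : ℤ) - 2 := by omega
  have d₈ : (1 : ℤ) + ((n : ℤ) - 3) = (n : ℤ) - 2 := by omega
  have hst : ghodge Ω (q := (n : ℤ) - 3) (by omega) (gcurv I br k (A₁, A₂)) =
      (ε • hodge Ω (p := 3) (q := (n : ℤ) - 3) (by omega) 𝓕.2,
        hodge Ω (p := 2) (q := (n : ℤ) - 3 + 1) (by omega) 𝓕.1) := by
    refine Prod.ext ?_ ?_
    · change (-1 : ℝ) ^ ((n : ℤ) - 2 - 1) • hodge Ω (p := 2 + 1) d₂ (gcurv I br k (A₁, A₂)).2 = _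
      rw [gcurv_snd hbr, show (n : ℤ) - 2 - 1 = n - 3 by omega]
    · change hodge Ω d₁ (gcurv I br k (A₁, A₂)).1 = _
      rw [gcurv_fst]
  rw [variation₁, variation₂, GeneralizedYangMills, hst, Prod.ext_iff, and_comm]
  refine and_congr ?_ ?_
  · rw [eulerLagrange₁_eq_zero_congr Ω br A₁ A₂ 𝓕 _ _ _ d₁ d₂ d₃]
    change extD I d₄ (hodge Ω d₁ 𝓕.1) + (wedge br d₅ A₁ (hodge Ω d₁ 𝓕.1) +
      ε • wedge br d₆ A₂ (ε • hodge Ω d₂ 𝓕.2)) = 0 ↔ _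
    rw [wedge_smul_right, smul_smul, hεε, one_smul, eulerLagrange₁, covD, add_assoc]
  · change extD I d₇ (ε • hodge Ω d₂ 𝓕.2) + (((-1 : ℝ) ^ ((n : ℤ) - 3 + 1)) * k) •
      DForm.cast d₇ (hodge Ω d₁ 𝓕.1) + wedge br d₈ A₁ (ε • hodge Ω d₂ 𝓕.2) = 0 ↔ _
    rw [extD_smul, wedge_smul_right, cast_hodge, hε', eulerLagrange₂, covD]
    have hε0 : -ε ≠ 0 := neg_ne_zero.2 (left_ne_zero_of_mul_eq_one hεε)
    rw [← (IsUnit.mk0 (-ε) hε0).smul_eq_zero (x := k • hodge Ω _ 𝓕.1 - _)]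
    refine Eq.congr ?_ rfl
    module

variable [MeasurableSpace M]

/-- Half of the first variation of the action. -/
def firstVariation (Ω : OrientedMetric I M) (br : 𝔤 →L[ℝ] 𝔤 →L[ℝ] 𝔤) (B : 𝔤 →L[ℝ] 𝔤 →L[ℝ] 𝕜)
    (k : ℝ) (A₁ : DForm n M 𝔤 1) (A₂ : DForm n M 𝔤 2) (α : DForm n M 𝔤 1) (β : DForm n M 𝔤 2) : 𝕜 :=
  ∫ x, topCoeff Ω (wedge B (by omega) α (variation₁ Ω br k A₁ A₂)) x ∂(volumeMeasure Ω) +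
    ∫ x, topCoeff Ω (wedge B (by omega) β (variation₂ Ω br k A₁ A₂)) x ∂(volumeMeasure Ω)

variable [BorelSpace M] [SecondCountableTopology M] [T2Space M]

lemma gymAction_eq (Ω : OrientedMetric I M) {br : 𝔤 →L[ℝ] 𝔤 →L[ℝ] 𝔤}
    (hbr : ∀ X Y, br Y X = -br X Y) (B : 𝔤 →L[ℝ] 𝔤 →L[ℝ] 𝕜) (k : ℝ) (D : Set M)
    (A₁ : DForm n M 𝔤 1) (A₂ : DForm n M 𝔤 2) : gymAction Ω br B k D (A₁, A₂) =
      ∫ x in D, topCoeff Ω (pairing Ω B (curvPair I br k A₁ A₂) (curvPair I br k A₁ A₂)) x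
        ∂(volumeMeasure Ω) := by
  rw [gymAction, gintegral, formIntegral, lagrangian_snd Ω hbr]

lemma hasDerivAt_quartic (c₀ c₁ c₂ c₃ c₄ : 𝕜) :
    HasDerivAt (fun t : ℝ => c₀ + t • c₁ + t ^ 2 • c₂ + t ^ 3 • c₃ + t ^ 4 • c₄) c₁ 0 := by
  have h1 := (hasDerivAt_id (0 : ℝ)).smul_const c₁
  have h (m : ℕ) (c : 𝕜) := (hasDerivAt_pow m (0 : ℝ)).smul_const c
  have h2 := ((((hasDerivAt_const (0 : ℝ) c₀).add h1).add (h 2 c₂)).add (h 3 c₃)).add (h 4 c₄)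
  refine h2.congr_deriv ?_
  simp

/-- The first variation of the action. -/
theorem hasDerivAt_gymAction (Ω : OrientedMetric I M) {br : 𝔤 →L[ℝ] 𝔤 →L[ℝ] 𝔤}
    (hbr : ∀ X Y, br Y X = -br X Y) {B : 𝔤 →L[ℝ] 𝔤 →L[ℝ] 𝕜} (hB : ∀ X Y, B X Y = B Y X)
    (hinv : ∀ X Y Z, B (br X Y) Z = B X (br Y Z)) (k : ℝ)
    {A₁ : DForm n M 𝔤 1} {A₂ : DForm n M 𝔤 2} (hA₁ : IsSmoothForm I A₁) (hA₂ : IsSmoothForm I A₂)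
    {D : Set M} (hD : IntegrableOn (topCoeff Ω (pairing Ω B (curvPair I br k A₁ A₂)
      (curvPair I br k A₁ A₂))) D (volumeMeasure Ω))
    {α : DForm n M 𝔤 1} {β : DForm n M 𝔤 2} (hδ : IsVariation I (gconn α β))
    (hαD : formSupp α ⊆ D) (hβD : formSupp β ⊆ D) :
    HasDerivAt (fun t : ℝ => gymAction Ω br B k D (gconn A₁ A₂ + t • gconn α β))
      ((2 : ℝ) • firstVariation Ω br B k A₁ A₂ α β) 0 := by
  obtain ⟨hα, hβ, hαc, hβc, hαI, hβI⟩ : IsSmoothForm I α ∧ IsSmoothForm I β ∧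
    IsCompact (formSupp α) ∧ IsCompact (formSupp β) ∧ formSupp α ⊆ I.interior M ∧
    formSupp β ⊆ I.interior M := hδ
  set μ := volumeMeasure Ω with hμ
  set 𝓕 := curvPair I br k A₁ A₂ with h𝓕
  set 𝓟 := curvLin I br k A₁ A₂ α β with h𝓟
  set 𝓠 := curvQuad br α β with h𝓠
  have s𝓕 := isSmoothForm_curvPair br k hA₁ hA₂
  have s𝓟 := isSmoothForm_curvLin br k hA₁ hA₂ hα hβ
  have s𝓠 := isSmoothForm_curvQuad br hα hβ
  set K := formSupp α ∪ formSupp β with hK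
  have hKc : IsCompact K := hαc.union hβc
  have hKcl : IsClosed K := isClosed_closure.union isClosed_closure
  have hKD : K ⊆ D := union_subset hαD hβD
  have z𝓟 (x : M) (hx : x ∉ K) := curvLin_apply_eq_zero (I := I) br k A₁ A₂
    (fun h => hx (.inl h)) (fun h => hx (.inr h)) (α := α) (β := β)
  have z𝓠 (x : M) (hx : x ∉ K) := curvQuad_apply_eq_zero br β (fun h => hx (.inl h)) (α := α)
  -- Every coefficient of positive power of t is smooth and vanishes off the compact set K, hence is
  -- integrable. Only the constant term needs the hypothesis on D.
  have hi𝓟 (𝓧 : DForm n M 𝔤 2 × DForm n M 𝔤 3) (h𝓧 : IsSmoothForm I 𝓧.1 ∧ IsSmoothForm I 𝓧.2) :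
      Integrable (topCoeff Ω (pairing Ω B 𝓟 𝓧)) μ :=
    integrable_topCoeff Ω (isSmoothForm_pairing Ω B s𝓟 h𝓧) hKc hKcl
      fun x hx => pairing_apply_eq_zero Ω B 𝓧 (z𝓟 x hx).1 (z𝓟 x hx).2
  have hi𝓠 (𝓧 : DForm n M 𝔤 2 × DForm n M 𝔤 3) (h𝓧 : IsSmoothForm I 𝓧.1 ∧ IsSmoothForm I 𝓧.2) :
      Integrable (topCoeff Ω (pairing Ω B 𝓠 𝓧)) μ :=
    integrable_topCoeff Ω (isSmoothForm_pairing Ω B s𝓠 h𝓧) hKc hKcl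
      fun x hx => pairing_apply_eq_zero Ω B 𝓧 (z𝓠 x hx).1 (z𝓠 x hx).2
  set ℓ₁ := (2 : ℝ) • topCoeff Ω (pairing Ω B 𝓟 𝓕) with hℓ₁
  set ℓ₂ := topCoeff Ω (pairing Ω B 𝓟 𝓟) + (2 : ℝ) • topCoeff Ω (pairing Ω B 𝓠 𝓕) with hℓ₂
  set ℓ₃ := (2 : ℝ) • topCoeff Ω (pairing Ω B 𝓠 𝓟) with hℓ₃
  set ℓ₄ := topCoeff Ω (pairing Ω B 𝓠 𝓠) with hℓ₄
  have i₁ : Integrable ℓ₁ (μ.restrict D) := ((hi𝓟 𝓕 s𝓕).smul (2 : ℝ)).restrict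
  have i₂ : Integrable ℓ₂ (μ.restrict D) :=
    ((hi𝓟 𝓟 s𝓟).add ((hi𝓠 𝓕 s𝓕).smul (2 : ℝ))).restrict
  have i₃ : Integrable ℓ₃ (μ.restrict D) := ((hi𝓠 𝓟 s𝓟).smul (2 : ℝ)).restrict
  have i₄ : Integrable ℓ₄ (μ.restrict D) := (hi𝓠 𝓠 s𝓠).restrict
  have hpoly (t : ℝ) : gymAction Ω br B k D (gconn A₁ A₂ + t • gconn α β) =
      ∫ x in D, topCoeff Ω (pairing Ω B 𝓕 𝓕) x ∂μ + t • ∫ x in D, ℓ₁ x ∂μ +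
        t ^ 2 • ∫ x in D, ℓ₂ x ∂μ + t ^ 3 • ∫ x in D, ℓ₃ x ∂μ + t ^ 4 • ∫ x in D, ℓ₄ x ∂μ := by
    refine (gymAction_eq Ω hbr B k D (A₁ + t • α) (A₂ + t • β)).trans ?_
    rw [curvPair_variation hbr k hA₁ hA₂ hα hβ t, pairing_expand Ω hB]
    simp only [topCoeff_add, topCoeff_smul]
    change ∫ x in D, (topCoeff Ω (pairing Ω B 𝓕 𝓕) + t • ℓ₁ + t ^ 2 • ℓ₂ + t ^ 3 • ℓ₃ + t ^ 4 • ℓ₄) x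
      ∂μ = _
    rw [integral_add' (((hD.add (i₁.smul t)).add (i₂.smul (t ^ 2))).add (i₃.smul (t ^ 3)))
        (i₄.smul (t ^ 4)),
      integral_add' ((hD.add (i₁.smul t)).add (i₂.smul (t ^ 2))) (i₃.smul (t ^ 3)),
      integral_add' (hD.add (i₁.smul t)) (i₂.smul (t ^ 2)), integral_add' hD (i₁.smul t)]
    simp only [Pi.smul_apply, integral_smul]
  -- As K ⊆ D, the linear term may be integrated over all of M, where Stokes' theorem is available.
  have hlin : ∫ x in D, ℓ₁ x ∂μ = (2 : ℝ) • ∫ x, topCoeff Ω (pairing Ω B 𝓟 𝓕) x ∂μ := by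
    rw [setIntegral_eq_integral_of_forall_compl_eq_zero, ← integral_smul]
    · rfl
    · intro x hx
      have hxK : x ∉ K := fun h => hx (hKD h)
      change (2 : ℝ) • topCoeff Ω (pairing Ω B 𝓟 𝓕) x = 0
      rw [topCoeff, pairing_apply_eq_zero Ω B 𝓕 (z𝓟 x hxK).1 (z𝓟 x hxK).2]
      simp
  have hder := hasDerivAt_quartic (∫ x in D, topCoeff Ω (pairing Ω B 𝓕 𝓕) x ∂μ)
    (∫ x in D, ℓ₁ x ∂μ) (∫ x in D, ℓ₂ x ∂μ) (∫ x in D, ℓ₃ x ∂μ) (∫ x in D, ℓ₄ x ∂μ)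
  rw [← funext hpoly] at hder
  refine hder.congr_deriv ?_
  rw [hlin]
  congr 1
  rw [firstVariation, h𝓟, pairing_curvLin Ω hbr hinv k hα hβ s𝓕]
  simp only [topCoeff_add]
  have sE₁ := isSmoothForm_eulerLagrange₁ Ω br hA₁ hA₂ s𝓕 (q := (n : ℤ) - 2) (s := (n : ℤ) - 3)
            (r := (n : ℤ) - 1) (by omega) (by omega) (by omega)
  have sE₂ := isSmoothForm_eulerLagrange₂ Ω br k hA₁ s𝓕 (q := (n : ℤ) - 2) (s := (n : ℤ) - 3)
            (by omega) (by omega)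
  have sw₁ := hα.wedge B (by omega : (1 : ℤ) + (n - 2) = n - 1)
    (s𝓕.1.hodge Ω (q := (n : ℤ) - 2) (by omega))
  have sw₂ := hβ.wedge B (by omega : (2 : ℤ) + (n - 3) = n - 1)
    (s𝓕.2.hodge Ω (q := (n : ℤ) - 3) (by omega))
  have hw {p q r : ℤ} {η : DForm n M 𝔤 p} {θ : DForm n M 𝔤 q} (h : p + q = r) :=
    formSupp_wedge_subset B h η θ
  have e₁ := integrable_topCoeff Ω (hα.wedge B (by omega) sE₁) hαc isClosed_closure
    fun x hx => wedge_apply_eq_zero_left B _ _ (eq_zero_of_notMem_formSupp hx)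
  have e₂ := integrable_topCoeff Ω (hβ.wedge B (by omega) sE₂) hβc isClosed_closure
    fun x hx => wedge_apply_eq_zero_left B _ _ (eq_zero_of_notMem_formSupp hx)
  have e₃ := integrable_topCoeff Ω (sw₁.extD (by omega)) hαc isClosed_closure
    fun x hx => extD_eq_zero_of_notMem_formSupp _ fun h => hx (hw _ h)
  have e₄ := integrable_topCoeff Ω (sw₂.extD (by omega)) hβc isClosed_closure
    fun x hx => extD_eq_zero_of_notMem_formSupp _ fun h => hx (hw _ h)
  -- The primitives inherit compact support in the interior from α and β, so the exact terms drop
  -- out.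
  have t₁ := integral_topCoeff_extD Ω (by omega) sw₁
    (hαc.of_isClosed_subset isClosed_closure (hw _)) ((hw _).trans hαI)
  have t₂ := integral_topCoeff_extD Ω (by omega) sw₂
    (hβc.of_isClosed_subset isClosed_closure (hw _)) ((hw _).trans hβI)
  rw [integral_add' ((e₁.add e₂).add e₃) e₄, integral_add' (e₁.add e₂) e₃, integral_add' e₁ e₂,
    t₁, t₂, add_zero, add_zero]
  rfl

lemma isStationaryOn_iff (Ω : OrientedMetric I M) {br : 𝔤 →L[ℝ] 𝔤 →L[ℝ] 𝔤}
    (hbr : ∀ X Y, br Y X = -br X Y) {B : 𝔤 →L[ℝ] 𝔤 →L[ℝ] 𝕜} (hB : ∀ X Y, B X Y = B Y X)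
    (hinv : ∀ X Y Z, B (br X Y) Z = B X (br Y Z)) (k : ℝ)
    {A₁ : DForm n M 𝔤 1} {A₂ : DForm n M 𝔤 2} (hA₁ : IsSmoothForm I A₁) (hA₂ : IsSmoothForm I A₂)
    {D : Set M} (hD : IntegrableOn (topCoeff Ω (pairing Ω B (curvPair I br k A₁ A₂)
      (curvPair I br k A₁ A₂))) D (volumeMeasure Ω)) (𝒱 : Set (GForm n M 𝔤 1)) :
    IsStationaryOn Ω br B k (gconn A₁ A₂) 𝒱 D ↔ ∀ (α : DForm n M 𝔤 1) (β : DForm n M 𝔤 2),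
      gconn α β ∈ 𝒱 → IsVariation I (gconn α β) → formSupp α ⊆ D → formSupp β ⊆ D →
        firstVariation Ω br B k A₁ A₂ α β = 0 := by
  constructor
  · intro h α β h𝒱 hv hα hβ
    have h1 := (h (gconn α β) h𝒱 hv hα hβ).unique
      (hasDerivAt_gymAction Ω hbr hB hinv k hA₁ hA₂ hD hv hα hβ)
    exact (smul_eq_zero.1 h1.symm).resolve_left two_ne_zero
  · intro h δ h𝒱 hv hα hβ
    refine (hasDerivAt_gymAction Ω hbr hB hinv k hA₁ hA₂ hD (α := δ.1) (β := δ.2)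
      hv hα hβ).congr_deriv ?_
    rw [h δ.1 δ.2 h𝒱 hv hα hβ, smul_zero]

lemma integral_topCoeff_zero (Ω : OrientedMetric I M) :
    ∫ x, topCoeff Ω (0 : DForm n M 𝕜 n) x ∂(volumeMeasure Ω) = 0 := by
  simp [topCoeff]

lemma firstVariation_zero_left (Ω : OrientedMetric I M) (br : 𝔤 →L[ℝ] 𝔤 →L[ℝ] 𝔤)
    (B : 𝔤 →L[ℝ] 𝔤 →L[ℝ] 𝕜) (k : ℝ) (A₁ : DForm n M 𝔤 1) (A₂ β : DForm n M 𝔤 2) :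
    firstVariation Ω br B k A₁ A₂ 0 β =
      ∫ x, topCoeff Ω (wedge B (by omega) β (variation₂ Ω br k A₁ A₂)) x ∂(volumeMeasure Ω) := by
  rw [firstVariation, wedge_zero_left, integral_topCoeff_zero, zero_add]

lemma firstVariation_zero_right (Ω : OrientedMetric I M) (br : 𝔤 →L[ℝ] 𝔤 →L[ℝ] 𝔤)
    (B : 𝔤 →L[ℝ] 𝔤 →L[ℝ] 𝕜) (k : ℝ) (A₁ : DForm n M 𝔤 1) (A₂ : DForm n M 𝔤 2)
    (α : DForm n M 𝔤 1) : firstVariation Ω br B k A₁ A₂ α 0 =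
      ∫ x, topCoeff Ω (wedge B (by omega) α (variation₁ Ω br k A₁ A₂)) x ∂(volumeMeasure Ω) := by
  rw [firstVariation, wedge_zero_left, integral_topCoeff_zero, add_zero]

/-- Stationarity over a sufficiently large family of domains is equivalent to the Euler–Lagrange
equations. -/
theorem stationary_iff (Ω : OrientedMetric I M) {br : 𝔤 →L[ℝ] 𝔤 →L[ℝ] 𝔤}
    (hbr : ∀ X Y, br Y X = -br X Y) {B : 𝔤 →L[ℝ] 𝔤 →L[ℝ] 𝕜} (hB : ∀ X Y, B X Y = B Y X)
    (hnd : ∀ X, (∀ Y, B X Y = 0) → X = 0) (hinv : ∀ X Y Z, B (br X Y) Z = B X (br Y Z)) (k : ℝ)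
    {A₁ : DForm n M 𝔤 1} {A₂ : DForm n M 𝔤 2} (hA₁ : IsSmoothForm I A₁) (hA₂ : IsSmoothForm I A₂)
    {𝒟 : Set (Set M)} (h𝒟 : ∀ D ∈ 𝒟, IntegrableOn (topCoeff Ω (pairing Ω B (curvPair I br k A₁ A₂)
      (curvPair I br k A₁ A₂))) D (volumeMeasure Ω))
    (hcov : ∀ K, IsCompact K → ∃ D ∈ 𝒟, K ⊆ D) :
    ((∀ D ∈ 𝒟, IsStationaryOn Ω br B k (gconn A₁ A₂) {δ | δ.2 = 0} D) ↔ Equation₁ Ω br k A₁ A₂) ∧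
      ((∀ D ∈ 𝒟, IsStationaryOn Ω br B k (gconn A₁ A₂) {δ | δ.1 = 0} D) ↔
        Equation₂ Ω br k A₁ A₂) ∧
      ((∀ D ∈ 𝒟, IsStationaryOn Ω br B k (gconn A₁ A₂) univ D) ↔
        Equation₁ Ω br k A₁ A₂ ∧ Equation₂ Ω br k A₁ A₂) := by
  have s𝓕 := isSmoothForm_curvPair br k hA₁ hA₂
  have sE₁ : IsSmoothForm I (variation₁ Ω br k A₁ A₂) :=
    isSmoothForm_eulerLagrange₁ Ω br hA₁ hA₂ s𝓕 _ _ _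
  have sE₂ : IsSmoothForm I (variation₂ Ω br k A₁ A₂) :=
    isSmoothForm_eulerLagrange₂ Ω br k hA₁ s𝓕 _ _
  -- The variation occupies the first slot of B, so nondegeneracy is needed in the second.
  have hnd' : ∀ Y, (∀ X, B X Y = 0) → Y = 0 := fun Y h => hnd Y fun X => (hB Y X).trans (h X)
  have hst (D : Set M) (hD : D ∈ 𝒟) := isStationaryOn_iff Ω hbr hB hinv k hA₁ hA₂ (h𝒟 D hD)
  have f₁ : (∀ D ∈ 𝒟, IsStationaryOn Ω br B k (gconn A₁ A₂) {δ | δ.2 = 0} D) →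
      Equation₁ Ω br k A₁ A₂ := by
    intro h
    rw [equation₁_iff Ω br k hA₁ hA₂]
    refine eq_zero_of_forall_integral_wedge Ω hnd' (by omega : (1 : ℤ) + (n - 1) = n) (by norm_num)
      sE₁ fun α hα hαc hαI => ?_
    obtain ⟨D, hD, hαD⟩ := hcov _ hαc
    have h0 : formSupp (0 : DForm n M 𝔤 2) = ∅ := formSupp_zero
    have hv : IsVariation I (gconn α 0) :=
      ⟨hα, IsSmoothForm.zero (p := 2), hαc, h0 ▸ isCompact_empty, hαI, h0 ▸ empty_subset _⟩
    rw [← firstVariation_zero_right]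
    exact (hst D hD _).1 (h D hD) α 0 rfl hv hαD (h0 ▸ empty_subset _)
  have f₂ : (∀ D ∈ 𝒟, IsStationaryOn Ω br B k (gconn A₁ A₂) {δ | δ.1 = 0} D) →
      Equation₂ Ω br k A₁ A₂ := by
    intro h
    rw [equation₂_iff]
    refine eq_zero_of_forall_integral_wedge Ω hnd' (by omega : (2 : ℤ) + (n - 2) = n) (by norm_num)
      sE₂ fun β hβ hβc hβI => ?_
    obtain ⟨D, hD, hβD⟩ := hcov _ hβc
    have h0 : formSupp (0 : DForm n M 𝔤 1) = ∅ := formSupp_zero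
    have hv : IsVariation I (gconn 0 β) :=
      ⟨IsSmoothForm.zero, hβ, h0 ▸ isCompact_empty, hβc, h0 ▸ empty_subset _, hβI⟩
    rw [← firstVariation_zero_left]
    exact (hst D hD _).1 (h D hD) 0 β rfl hv (h0 ▸ empty_subset _) hβD
  refine ⟨⟨f₁, fun h D hD => ?_⟩, ⟨f₂, fun h D hD => ?_⟩, ⟨fun h => ⟨f₁ fun D hD δ _ => h D hD δ
    trivial, f₂ fun D hD δ _ => h D hD δ trivial⟩, fun h D hD => ?_⟩⟩
  · refine (hst D hD _).2 fun α β h𝒱 _ _ _ => ?_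
    obtain rfl : β = 0 := h𝒱
    rw [firstVariation_zero_right, (equation₁_iff Ω br k hA₁ hA₂).1 h, wedge_zero_right,
      integral_topCoeff_zero]
  · refine (hst D hD _).2 fun α β h𝒱 _ _ _ => ?_
    obtain rfl : α = 0 := h𝒱
    rw [firstVariation_zero_left, (equation₂_iff Ω br k A₁ A₂).1 h, wedge_zero_right,
      integral_topCoeff_zero]
  · refine (hst D hD _).2 fun α β _ _ _ _ => ?_
    rw [firstVariation, (equation₁_iff Ω br k hA₁ hA₂).1 h.1, (equation₂_iff Ω br k A₁ A₂).1 h.2,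
      wedge_zero_right, wedge_zero_right, integral_topCoeff_zero, add_zero]

end Stationarity

end GDC
end

/-! ### The main theorem -/

theorem mainTheorem5 {n : ℕ} {H : Type*} [TopologicalSpace H]
    (I : ModelWithCorners ℝ (Vec n) H)
    {M : Type*} [TopologicalSpace M] [ChartedSpace H M] [IsManifold I ∞ M]
    [T2Space M] [SecondCountableTopology M] [MeasurableSpace M] [BorelSpace M]
    (Ω : OrientedMetric I M)
    {𝔤 : Type*} [NormedAddCommGroup 𝔤] [NormedSpace ℝ 𝔤] [FiniteDimensional ℝ 𝔤]
    {G : Type*} [Group G] [TopologicalSpace G] [ChartedSpace 𝔤 G]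
    [LieGroup 𝓘(ℝ, 𝔤) (minSmoothness ℝ 3) G]
    {𝕜 : Type*} [RCLike 𝕜] (B : 𝔤 →L[ℝ] 𝔤 →L[ℝ] 𝕜) (hB : IsInvariantForm 𝔤 G B)
    (k : ℝ) (A₁ : DForm n M 𝔤 1) (A₂ : DForm n M 𝔤 2)
    (hA₁ : IsSmoothForm I A₁) (hA₂ : IsSmoothForm I A₂) :
    (IsLocallyStationary Ω (lieBracket 𝔤 G) B k (A₁, A₂) {δ | δ.2 = 0} ↔
        Equation₁ Ω (lieBracket 𝔤 G) k A₁ A₂) ∧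
      (IsLocallyStationary Ω (lieBracket 𝔤 G) B k (A₁, A₂) {δ | δ.1 = 0} ↔
        Equation₂ Ω (lieBracket 𝔤 G) k A₁ A₂) ∧
      (IsLocallyStationary Ω (lieBracket 𝔤 G) B k (A₁, A₂) univ ↔
        Equation₁ Ω (lieBracket 𝔤 G) k A₁ A₂ ∧ Equation₂ Ω (lieBracket 𝔤 G) k A₁ A₂) ∧
      (HasFiniteAction Ω (lieBracket 𝔤 G) B k (A₁, A₂) →
        (IsStationaryOn Ω (lieBracket 𝔤 G) B k (A₁, A₂) {δ | δ.2 = 0} univ ↔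
            Equation₁ Ω (lieBracket 𝔤 G) k A₁ A₂) ∧
          (IsStationaryOn Ω (lieBracket 𝔤 G) B k (A₁, A₂) {δ | δ.1 = 0} univ ↔
            Equation₂ Ω (lieBracket 𝔤 G) k A₁ A₂) ∧
          (IsStationaryOn Ω (lieBracket 𝔤 G) B k (A₁, A₂) univ univ ↔
            Equation₁ Ω (lieBracket 𝔤 G) k A₁ A₂ ∧ Equation₂ Ω (lieBracket 𝔤 G) k A₁ A₂)) ∧
      (Equation₁ Ω (lieBracket 𝔤 G) k A₁ A₂ ∧ Equation₂ Ω (lieBracket 𝔤 G) k A₁ A₂ ↔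
        GeneralizedYangMills Ω (lieBracket 𝔤 G) k (A₁, A₂)) := by
  have hbr := fun X Y => lieBracket_skew 𝔤 G X Y
  have hinv := fun X Y Z => hB.lieBracket_left X Y Z
  have s𝓕 := isSmoothForm_curvPair (I := I) (lieBracket 𝔤 G) k hA₁ hA₂
  have hc := continuous_topCoeff Ω (isSmoothForm_pairing Ω B s𝓕 s𝓕)
  -- Local stationarity is the case where the domains are all compact sets: the Lagrangian density
  -- is continuous, hence integrable over each of them. The global statement below takes M as the
  -- only domain, with integrability supplied by the finite action.
  have L := stationary_iff Ω hbr hB.symm hB.nondeg hinv k hA₁ hA₂ (𝒟 := {K | IsCompact K})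
    (fun K hK => hc.continuousOn.integrableOn_compact hK) (fun K hK => ⟨K, hK, subset_rfl⟩)
  refine ⟨L.1, L.2.1, L.2.2, fun hfin => ?_, ?_⟩
  · have hint : IntegrableOn (topCoeff Ω (pairing Ω B (curvPair I (lieBracket 𝔤 G) k A₁ A₂)
        (curvPair I (lieBracket 𝔤 G) k A₁ A₂))) univ (volumeMeasure Ω) := by
      rw [integrableOn_univ, ← lagrangian_snd Ω hbr B k A₁ A₂ (by omega)]
      exact hfin
    have T := stationary_iff Ω hbr hB.symm hB.nondeg hinv k hA₁ hA₂ (𝒟 := {univ})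
      (by simpa using hint) (fun K _ => ⟨univ, rfl, subset_univ K⟩)
    simp only [mem_singleton_iff, forall_eq] at T
    exact T
  · rw [equation₁_iff Ω _ k hA₁ hA₂, equation₂_iff, ← generalizedYangMills_iff Ω hbr]
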